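/- All manifolds, bundles, sections and connections are smooth. Let $M$ and $N$ be oriented Riemannian manifolds of dimensions $3$ and $2$, with Levi-Civita connections written $\nabla$ on one-forms, and let $\phi:M\to N$ be a Riemannian submersion (each differential $\phi_*:T_pM\to T_{\phi(p)}N$ is surjective and isometric on the orthogonal complement of its kernel). Let $\nu=*\phi^*(\mathrm{vol}_N)$, a one-form on $M$. Let $\Psi_N$ be a $Spin^c$ spinor bundle on $N$: a Hermitian complex vector bundle of rank $2$ with a Clifford multiplication $\sigma_N$, that is, a real-linear bundle map from $T^*N$ into the self-adjoint trace-free endomorphisms of $\Psi_N$ with $\frac12\mathrm{Tr}[\sigma_N(\alpha)\sigma_N(\beta)]=(\alpha,\beta)$. Let $\nabla^N$ be a $Spin^c$ connection on $\Psi_N$: $X(\xi,\eta)=(\nabla^N_X\xi,\eta)+(\xi,\nabla^N_X\eta)$ and $[\nabla^N_X,\sigma_N(\alpha)]=\sigma_N(\nabla_X\alpha)$. Its Dirac operator is $\mathcal D_N=-i\sum_j\sigma_N(f^j)\nabla^N_{f_j}$ for an orthonormal basis $f_j$ of vectors with dual basis $f^j$. Spinor bundles, $Spin^c$ connections and Dirac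 operators on $M$ are defined in the same way. Let $\Psi_M=\phi^*(\Psi_N)$ be the induced bundle, with the Clifford multiplication $\sigma_M$ given by $\sigma_M(\phi^*\omega)=\sigma_N(\omega)\circ\phi$ for one-forms $\omega$ on $N$ and $\sigma_M(\nu)=\bigl(-i\sigma_N(f^1)\sigma_N(f^2)\bigr)\circ\phi$ for an oriented orthonormal frame $f^1,f^2$ of $T^*N$. Let $\phi^*(\nabla^N)$ be the induced connection on $\Psi_M$ (the one with $\phi^*(\nabla^N)_Y(\xi\circ\phi)=(\nabla^N_{\phi_*Y}\xi)\circ\phi$) and put $$\nabla^M_X=\phi^*(\nabla^N)_X-\tfrac12\sigma_M(\nu)\sigma_M(\nabla_X\nu)-\tfrac i4\,\nu(X)\,(\nu,*d\nu)\,\sigma_M(\nu),$$ $$\nabla^{M,\pm}=\nabla^M\mp\tfrac i2\Bigl(*d\nu-\tfrac12(\nu,*d\nu)\nu\Bigr).$$ Then: 1. $\Psi_M$ with $\sigma_M$ is a $Spin^c$ spinor bundle on $M$, and $\nabla^{M,+}$ and $\nabla^{M,-}$ are $Spin^c$ connections on it. 2. The Dirac operators $\mathcal D_M^\pm$ of $\nabla^{M,\pm}$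 satisfy $\mathcal D_M^\pm(\xi\circ\phi)=(\mathcal D_N\xi)\circ\phi$ for every section $\xi$ of $\Psi_N$ with $\sigma_M(\nu)(\xi\circ\phi)=\pm\,\xi\circ\phi$. 3. Let $\xi\neq0$ be a section of $\Psi_N$ with $\mathcal D_N\xi=0$ and with definite spin $S\in\{+1,-1\}$, in the sense that either $\int_N|\xi|^2=1$ and $\int_N(\xi,-i\sigma_N(f^1)\sigma_N(f^2)\xi)=S$ (integrals with respect to the Riemannian measure), or $(\xi,-i\sigma_N(f^1)\sigma_N(f^2)\xi)=S|\xi|^2$ at every point of $N$. Then $\xi\circ\phi$ is a section of $\Psi_M$ with $\mathcal D_M^{\mathrm{sgn}(S)}(\xi\circ\phi)=0$, and $\xi\circ\phi\neq0$ if $\phi$ is surjective. -/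

import Mathlib

open Bundle Manifold
open scoped ContDiff

noncomputable section

/-! ## Riemannian geometry of a manifold of dimension `n` -/

abbrev Euc (n : ℕ) := EuclideanSpace ℝ (Fin n)

section Riemannian

variable {n : ℕ} {M : Type*} [TopologicalSpace M] [ChartedSpace (Euc n) M]

theorem finrank_tangentSpace_eq (x : M) : Module.finrank ℝ (TangentSpace (𝓡 n) x) = n :=
  (finrank_euclideanSpace_fin : Module.finrank ℝ (Euc n) = n)

instance instFactFinrankTangentSpace (x : M) :
    Fact (Module.finrank ℝ (TangentSpace (𝓡 n) x) = n) := ⟨finrank_tangentSpace_eq x⟩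

instance instFiniteDimensionalTangentSpaceEuc (x : M) :
    FiniteDimensional ℝ (TangentSpace (𝓡 n) x) :=
  inferInstanceAs (FiniteDimensional ℝ (Euc n))

/-- The cotangent space `T*_x M`. -/
abbrev CotangentSpace (n : ℕ) {M : Type*} [TopologicalSpace M] [ChartedSpace (Euc n) M] (x : M) :=
  TangentSpace (𝓡 n) x →L[ℝ] ℝ

/-- The vector field `X` is smooth at `x`. -/
def SmoothFieldAt [IsManifold (𝓡 n) ∞ M] (X : Π x : M, TangentSpace (𝓡 n) x) (x : M) : Prop :=
  ContMDiffAt (𝓡 n) ((𝓡 n).prod (𝓡 n)) ∞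
    (fun y => TotalSpace.mk' (Euc n) (E := (TangentSpace (𝓡 n) : M → Type _)) y (X y)) x

/-- The one-form `α` is smooth at `x`. -/
def SmoothFormAt [IsManifold (𝓡 n) ∞ M] (α : Π x : M, CotangentSpace n x) (x : M) : Prop :=
  ContMDiffAt (𝓡 n) ((𝓡 n).prod 𝓘(ℝ, Euc n →L[ℝ] ℝ)) ∞
    (fun y => TotalSpace.mk' (Euc n →L[ℝ] ℝ)
      (E := fun y : M => TangentSpace (𝓡 n) y →L[ℝ] ℝ) y (α y)) x

variable [RiemannianBundle (fun x : M => TangentSpace (𝓡 n) x)]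

/-- The covector `v♭ = ⟪v, ·⟫`. If `e` is an orthonormal basis, `flat (e i)` is the dual basis. -/
def flat {x : M} (v : TangentSpace (𝓡 n) x) : CotangentSpace n x := innerSL ℝ v

/-- Some orthonormal basis of `T_x M`. All notions below that use it do not depend on it. -/
def onb (x : M) : OrthonormalBasis (Fin n) ℝ (TangentSpace (𝓡 n) x) :=
  (stdOrthonormalBasis ℝ (TangentSpace (𝓡 n) x)).reindex (finCongr (finrank_tangentSpace_eq x))

/-- The metric on `T*_x M`. -/
def cometric {x : M} (α β : CotangentSpace n x) : ℝ := ∑ i, α (onb x i) * β (onb x i)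

/-- The matrix of the metric in the chart `c` at the point with coordinates `u`. -/
def gramMatrix (c : OpenPartialHomeomorph M (Euc n)) (u : Euc n) : Matrix (Fin n) (Fin n) ℝ :=
  fun i j =>
    inner ℝ
      (mfderiv (𝓡 n) (𝓡 n) c.symm u (EuclideanSpace.single i (1 : ℝ) : Euc n) :
        TangentSpace (𝓡 n) (c.symm u))
      (mfderiv (𝓡 n) (𝓡 n) c.symm u (EuclideanSpace.single j (1 : ℝ) : Euc n) :
        TangentSpace (𝓡 n) (c.symm u))

/-- The Riemannian measure: it is the least measure which, on the domain of every chart, is at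
least the image of the measure `√(det g) du` on the range of the chart. -/
def riemannianMeasure (n : ℕ) (M : Type*) [TopologicalSpace M] [ChartedSpace (Euc n) M]
    [RiemannianBundle (fun x : M => TangentSpace (𝓡 n) x)] [MeasurableSpace M] :
    MeasureTheory.Measure M :=
  ⨆ c : atlas (Euc n) M, MeasureTheory.Measure.map c.1.symm
    ((MeasureTheory.volume.restrict c.1.target).withDensity
      fun u => ENNReal.ofReal (Real.sqrt (gramMatrix c.1 u).det))

/-- Orientations of all tangent spaces that vary continuously: near each point there is a smooth
frame of positive bases. -/
structure ManifoldOrientation (n : ℕ) (M : Type*) [TopologicalSpace M] [ChartedSpace (Euc n) M]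
    [IsManifold (𝓡 n) ∞ M] where
  orient : Π x : M, Orientation ℝ (TangentSpace (𝓡 n) x) (Fin n)
  exists_frame : ∀ x : M, ∃ X : Fin n → Π y : M, TangentSpace (𝓡 n) y,
    (∀ i, SmoothFieldAt (X i) x) ∧
    ∀ᶠ y in nhds x, ∃ b : Module.Basis (Fin n) ℝ (TangentSpace (𝓡 n) y),
      (∀ i, b i = X i y) ∧ b.orientation = orient y

variable [IsManifold (𝓡 n) ∞ M]

/-- The Riemannian volume form of an oriented Riemannian manifold. -/
def volForm (o : ManifoldOrientation n M) (x : M) : TangentSpace (𝓡 n) x [⋀^Fin n]→ₗ[ℝ] ℝ :=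
  (o.orient x).volumeForm

/-- The exterior derivative of a one-form,
`dα(u, v) = u(α(V)) - v(α(U)) - α([U, V])`, where `U`, `V` are fields extending `u`, `v`. -/
def extDerivForm (α : Π x : M, CotangentSpace n x) (x : M) (u v : TangentSpace (𝓡 n) x) : ℝ :=
  mvfderiv (𝓡 n) (fun y => α y (FiberBundle.extend (Euc n) v y)) x u
    - mvfderiv (𝓡 n) (fun y => α y (FiberBundle.extend (Euc n) u y)) x v
    - α x (VectorField.mlieBracket (𝓡 n) (FiberBundle.extend (Euc n) u)
        (FiberBundle.extend (Euc n) v) x)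

theorem isContMDiffRiemannianBundle_one
    [IsContMDiffRiemannianBundle (𝓡 n) ∞ (Euc n) (fun x : M => TangentSpace (𝓡 n) x)] :
    IsContMDiffRiemannianBundle (𝓡 n) 1 (Euc n) (fun x : M => TangentSpace (𝓡 n) x) :=
  IsContMDiffRiemannianBundle.of_le (n := ∞) (by simp)

/-- `D` is the Levi-Civita connection: it is torsion free and compatible with the metric. -/
def IsLeviCivita
    [IsContMDiffRiemannianBundle (𝓡 n) ∞ (Euc n) (fun x : M => TangentSpace (𝓡 n) x)]
    (D : CovariantDerivative (𝓡 n) (Euc n) (TangentSpace (𝓡 n) : M → Type _)) : Prop :=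
  haveI := isContMDiffRiemannianBundle_one (n := n) (M := M)
  D.torsion = 0 ∧ D.IsMetricCompatible

/-- The covariant derivative of a one-form,
`(D_v α)(w) = v(α(W)) - α(D_v W)`, where `W` is a field extending `w`; the covector is written out
by its values at an orthonormal basis. -/
def covDerivForm (D : CovariantDerivative (𝓡 n) (Euc n) (TangentSpace (𝓡 n) : M → Type _))
    (α : Π x : M, CotangentSpace n x) (x : M) (v : TangentSpace (𝓡 n) x) : CotangentSpace n x :=
  ∑ i, (mvfderiv (𝓡 n) (fun y => α y (FiberBundle.extend (Euc n) (onb x i) y)) x v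
    - α x (D (FiberBundle.extend (Euc n) (onb x i)) x v)) • flat (onb x i)

end Riemannian

/-- The Hodge star of a two-form `β` in dimension three, `(*β)(u) = ½ ∑ vol(u, eᵢ, eⱼ) β(eᵢ, eⱼ)`
for an orthonormal basis `e`. -/
def hodgeTwoForm {M : Type*} [TopologicalSpace M] [ChartedSpace (Euc 3) M] [IsManifold (𝓡 3) ∞ M]
    [RiemannianBundle (fun x : M => TangentSpace (𝓡 3) x)] (o : ManifoldOrientation 3 M) (x : M)
    (β : TangentSpace (𝓡 3) x → TangentSpace (𝓡 3) x → ℝ) : CotangentSpace 3 x :=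
  ∑ k, ((1 / 2 : ℝ) * ∑ i, ∑ j, volForm o x ![onb x k, onb x i, onb x j]
    * β (onb x i) (onb x j)) • flat (onb x k)

/-! ## Spinor bundles -/

/-- The model fiber of spinor bundles. -/
abbrev SpinorFiber := EuclideanSpace ℂ (Fin 2)

section Spinors

variable {n : ℕ} {M : Type*} [TopologicalSpace M] [ChartedSpace (Euc n) M]
  [IsManifold (𝓡 n) ∞ M]
  {V : M → Type*} [∀ x, NormedAddCommGroup (V x)] [∀ x, InnerProductSpace ℂ (V x)]
  [TopologicalSpace (TotalSpace SpinorFiber V)] [FiberBundle SpinorFiber V]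

/-- The section `ξ` is smooth at `x`. -/
def SmoothSectionAt (n : ℕ) {M : Type*} [TopologicalSpace M] [ChartedSpace (Euc n) M]
    {V : M → Type*} [∀ x, NormedAddCommGroup (V x)] [∀ x, InnerProductSpace ℂ (V x)]
    [TopologicalSpace (TotalSpace SpinorFiber V)] [FiberBundle SpinorFiber V]
    (ξ : Π x : M, V x) (x : M) : Prop :=
  ContMDiffAt (𝓡 n) ((𝓡 n).prod 𝓘(ℝ, SpinorFiber)) ∞
    (fun y => TotalSpace.mk' SpinorFiber y (ξ y)) x

/-- A smooth section of the spinor bundle `V`. -/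
def IsSmoothSection (n : ℕ) {M : Type*} [TopologicalSpace M] [ChartedSpace (Euc n) M]
    {V : M → Type*} [∀ x, NormedAddCommGroup (V x)] [∀ x, InnerProductSpace ℂ (V x)]
    [TopologicalSpace (TotalSpace SpinorFiber V)] [FiberBundle SpinorFiber V]
    (ξ : Π x : M, V x) : Prop :=
  ∀ x, SmoothSectionAt n ξ x

variable [RiemannianBundle (fun x : M => TangentSpace (𝓡 n) x)]

/-- The Hermitian plane bundle `V` is a (`Spin^c`) spinor bundle with Clifford multiplication `σ`:
the inner product is smooth and `σ` is a smooth isometric embedding of `T*M` into the bundle of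
self-adjoint trace-free endomorphisms of `V` with the inner product `½ Tr(A B)`. -/
structure IsSpinorBundle (σ : Π x : M, CotangentSpace n x →ₗ[ℝ] Module.End ℂ (V x)) : Prop where
  smooth_inner : ∀ (ξ η : Π x : M, V x) (x : M), SmoothSectionAt n ξ x → SmoothSectionAt n η x →
    ContMDiffAt (𝓡 n) 𝓘(ℝ, ℂ) ∞ (fun y => inner ℂ (ξ y) (η y)) x
  isSymmetric : ∀ (x : M) (α : CotangentSpace n x), (σ x α).IsSymmetric
  trace_eq_zero : ∀ (x : M) (α : CotangentSpace n x), LinearMap.trace ℂ (V x) (σ x α) = 0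
  isometry : ∀ (x : M) (α β : CotangentSpace n x),
    (1 / 2 : ℂ) * LinearMap.trace ℂ (V x) (σ x α * σ x β) = (cometric α β : ℂ)
  smooth : ∀ (α : Π x : M, CotangentSpace n x) (ξ : Π x : M, V x) (x : M),
    SmoothFormAt α x → SmoothSectionAt n ξ x → SmoothSectionAt n (fun y => σ y (α y) (ξ y)) x

/-- `nab` is a smooth connection on the complex vector bundle `V` (`nab ξ x X` is `∇_X ξ` at `x`)
which is a `Spin^c` connection for the Clifford multiplication `σ`, where `D` is the Levi-Civita
connection:
`X(ξ, η) = (∇_X ξ, η) + (ξ, ∇_X η)` and `[∇_X, σ(α)] = σ(D_X α)`. -/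
structure IsSpincConnection
    (D : CovariantDerivative (𝓡 n) (Euc n) (TangentSpace (𝓡 n) : M → Type _))
    (σ : Π x : M, CotangentSpace n x →ₗ[ℝ] Module.End ℂ (V x))
    (nab : (Π x : M, V x) → Π x : M, TangentSpace (𝓡 n) x →L[ℝ] V x) : Prop where
  isCovariantDerivative : IsCovariantDerivativeOn SpinorFiber nab Set.univ
  map_I_smul : ∀ (ξ : Π x : M, V x) (x : M) (X : TangentSpace (𝓡 n) x), SmoothSectionAt n ξ x →
    nab (fun y => Complex.I • ξ y) x X = Complex.I • nab ξ x X
  smooth : ∀ (ξ : Π x : M, V x) (X : Π x : M, TangentSpace (𝓡 n) x) (x : M),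
    SmoothSectionAt n ξ x → SmoothFieldAt X x → SmoothSectionAt n (fun y => nab ξ y (X y)) x
  metric : ∀ (ξ η : Π x : M, V x) (x : M) (X : TangentSpace (𝓡 n) x),
    SmoothSectionAt n ξ x → SmoothSectionAt n η x →
    mvfderiv (𝓡 n) (fun y => (inner ℂ (ξ y) (η y) : ℂ)) x X
      = inner ℂ (nab ξ x X) (η x) + inner ℂ (ξ x) (nab η x X)
  clifford : ∀ (α : Π x : M, CotangentSpace n x) (ξ : Π x : M, V x) (x : M)
    (X : TangentSpace (𝓡 n) x), SmoothFormAt α x → SmoothSectionAt n ξ x →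
    nab (fun y => σ y (α y) (ξ y)) x X - σ x (α x) (nab ξ x X)
      = σ x (covDerivForm D α x X) (ξ x)

end Spinors

/-- The Dirac operator `-i ∑ σ(eʲ) ∇_{eⱼ}`. -/
def diracOperator {n : ℕ} {M : Type*} [TopologicalSpace M] [ChartedSpace (Euc n) M]
    [RiemannianBundle (fun x : M => TangentSpace (𝓡 n) x)]
    {V : M → Type*} [∀ x, NormedAddCommGroup (V x)] [∀ x, InnerProductSpace ℂ (V x)]
    (σ : Π x : M, CotangentSpace n x →ₗ[ℝ] Module.End ℂ (V x))
    (nab : (Π x : M, V x) → Π x : M, TangentSpace (𝓡 n) x →L[ℝ] V x)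
    (ξ : Π x : M, V x) (x : M) : V x :=
  (-Complex.I) • ∑ j, σ x (flat (onb x j)) (nab ξ x (onb x j))

/-! ## Lifting along a Riemannian submersion from dimension three to dimension two -/

section Lift

variable {M : Type*} [TopologicalSpace M] [ChartedSpace (Euc 3) M]
  {N : Type*} [TopologicalSpace N] [ChartedSpace (Euc 2) N]

/-- The differential of `φ` at `p`. -/
abbrev diff (φ : C^∞⟮𝓡 3, M; 𝓡 2, N⟯) (p : M) :
    TangentSpace (𝓡 3) p →L[ℝ] TangentSpace (𝓡 2) (φ p) :=
  mfderiv (𝓡 3) (𝓡 2) φ p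

/-- The smooth map `φ` is a Riemannian submersion: each differential is a surjective partial
isometry, that is, isometric on the orthogonal complement of its kernel. -/
structure IsRiemannianSubmersion [RiemannianBundle (fun x : M => TangentSpace (𝓡 3) x)]
    [RiemannianBundle (fun y : N => TangentSpace (𝓡 2) y)] (φ : C^∞⟮𝓡 3, M; 𝓡 2, N⟯) : Prop where
  surjective : ∀ p, Function.Surjective (diff φ p)
  isometry : ∀ (p : M) (u v : TangentSpace (𝓡 3) p),
    (∀ w, diff φ p w = 0 → (inner ℝ u w : ℝ) = 0) → (∀ w, diff φ p w = 0 → (inner ℝ v w : ℝ) = 0) →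
    (inner ℝ (diff φ p u) (diff φ p v) : ℝ) = inner ℝ u v

/-- The induced bundle `φ*(Ψ)`, with fiber `Ψ (φ p)` at `p`. -/
def LiftedBundle (φ : C^∞⟮𝓡 3, M; 𝓡 2, N⟯) (Ψ : N → Type*) : M → Type _ := fun p => Ψ (φ p)

section instances

variable (φ : C^∞⟮𝓡 3, M; 𝓡 2, N⟯) (Ψ : N → Type*) [∀ y, NormedAddCommGroup (Ψ y)]
  [∀ y, InnerProductSpace ℂ (Ψ y)]

instance instLiftedNormedAddCommGroup (p : M) : NormedAddCommGroup (LiftedBundle φ Ψ p) :=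
  inferInstanceAs (NormedAddCommGroup (Ψ (φ p)))

instance instLiftedInnerProductSpace (p : M) : InnerProductSpace ℂ (LiftedBundle φ Ψ p) :=
  inferInstanceAs (InnerProductSpace ℂ (Ψ (φ p)))

variable [TopologicalSpace (TotalSpace SpinorFiber Ψ)] [FiberBundle SpinorFiber Ψ]

instance instLiftedTopologicalSpace :
    TopologicalSpace (TotalSpace SpinorFiber (LiftedBundle φ Ψ)) :=
  inferInstanceAs (TopologicalSpace (TotalSpace SpinorFiber (φ *ᵖ Ψ)))

instance instLiftedFiberBundle : FiberBundle SpinorFiber (LiftedBundle φ Ψ) :=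
  inferInstanceAs (FiberBundle SpinorFiber (φ *ᵖ Ψ))

instance instLiftedVectorBundle [VectorBundle ℝ SpinorFiber Ψ] :
    VectorBundle ℝ SpinorFiber (LiftedBundle φ Ψ) :=
  inferInstanceAs (VectorBundle ℝ SpinorFiber (φ *ᵖ Ψ))

instance instLiftedVectorBundleComplex [VectorBundle ℂ SpinorFiber Ψ] :
    VectorBundle ℂ SpinorFiber (LiftedBundle φ Ψ) :=
  inferInstanceAs (VectorBundle ℂ SpinorFiber (φ *ᵖ Ψ))

instance instLiftedContMDiffVectorBundle [VectorBundle ℝ SpinorFiber Ψ]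
    [ContMDiffVectorBundle ∞ SpinorFiber Ψ (𝓡 2)] :
    ContMDiffVectorBundle ∞ SpinorFiber (LiftedBundle φ Ψ) (𝓡 3) :=
  inferInstanceAs (ContMDiffVectorBundle ∞ SpinorFiber (φ *ᵖ Ψ) (𝓡 3))

end instances

variable {φ : C^∞⟮𝓡 3, M; 𝓡 2, N⟯} {Ψ : N → Type*}
  [∀ y, NormedAddCommGroup (Ψ y)] [∀ y, InnerProductSpace ℂ (Ψ y)]

/-- The section `ξ ∘ φ` of the induced bundle. -/
def liftSection (φ : C^∞⟮𝓡 3, M; 𝓡 2, N⟯) (ξ : Π y : N, Ψ y) : Π p : M, LiftedBundle φ Ψ p :=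
  fun p => ξ (φ p)

/-- The induced connection on the induced bundle. In the trivialization of `Ψ` around `φ p`, a
section `s` is `∑ aᵢ (ξᵢ ∘ φ)` for a local frame `ξᵢ`, and its derivative along `X` at `p` is
`∑ X(aᵢ) (ξᵢ ∘ φ) + ∑ aᵢ(p) (∇_{φ_* X} ξᵢ) ∘ φ`. -/
def inducedConnection [TopologicalSpace (TotalSpace SpinorFiber Ψ)] [FiberBundle SpinorFiber Ψ]
    [VectorBundle ℝ SpinorFiber Ψ] (φ : C^∞⟮𝓡 3, M; 𝓡 2, N⟯)
    (nab : (Π y : N, Ψ y) → Π y : N, TangentSpace (𝓡 2) y →L[ℝ] Ψ y)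
    (s : Π p : M, LiftedBundle φ Ψ p) (p : M) :
    TangentSpace (𝓡 3) p →L[ℝ] LiftedBundle φ Ψ p :=
  let e := trivializationAt SpinorFiber Ψ (φ p)
  let a : M → SpinorFiber := fun q => (e (TotalSpace.mk' SpinorFiber (φ q) (s q))).2
  (show TangentSpace (𝓡 3) p →L[ℝ] Ψ (φ p) from
    e.symmL ℝ (φ p) ∘L mvfderiv (𝓡 3) a p
      + nab (FiberBundle.extend SpinorFiber (show Ψ (φ p) from s p)) (φ p) ∘L diff φ p)

variable [IsManifold (𝓡 3) ∞ M] [IsManifold (𝓡 2) ∞ N]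
  [RiemannianBundle (fun x : M => TangentSpace (𝓡 3) x)]
  [RiemannianBundle (fun y : N => TangentSpace (𝓡 2) y)]

/-- The one-form `ν = *φ*(vol_N)` on `M`. -/
def nuForm (oM : ManifoldOrientation 3 M) (oN : ManifoldOrientation 2 N)
    (φ : C^∞⟮𝓡 3, M; 𝓡 2, N⟯) (p : M) : CotangentSpace 3 p :=
  hodgeTwoForm oM p fun u v => volForm oN (φ p) ![diff φ p u, diff φ p v]

/-- The one-form `*dν` on `M`. -/
def starDNu (oM : ManifoldOrientation 3 M) (oN : ManifoldOrientation 2 N)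
    (φ : C^∞⟮𝓡 3, M; 𝓡 2, N⟯) (p : M) : CotangentSpace 3 p :=
  hodgeTwoForm oM p (extDerivForm (nuForm oM oN φ) p)

/-- The spin operator `-i σ_N(f¹) σ_N(f²)`, with an oriented orthonormal basis `f¹, f²`. -/
def spinOperator (oN : ManifoldOrientation 2 N)
    (σ : Π y : N, CotangentSpace 2 y →ₗ[ℝ] Module.End ℂ (Ψ y)) (y : N) : Module.End ℂ (Ψ y) :=
  let f : OrthonormalBasis (Fin 2) ℝ (TangentSpace (𝓡 2) y) :=
    (oN.orient y).finOrthonormalBasis (by norm_num) (finrank_tangentSpace_eq y)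
  (-Complex.I) • (σ y (flat (f 0)) * σ y (flat (f 1)))

/-- For a covector `α` at `p`, the covector `ω` at `φ p` such that `α - φ*ω` is a multiple
of `ν`; explicitly, `ω` is `α` composed with the adjoint of the differential of `φ`. -/
def descend (φ : C^∞⟮𝓡 3, M; 𝓡 2, N⟯) (p : M) (α : CotangentSpace 3 p) :
    CotangentSpace 2 (φ p) :=
  ∑ i, α (onb p i) • flat (diff φ p (onb p i))

/-- The lifted Clifford multiplication, with `σ_M(φ*ω) = σ_N(ω) ∘ φ` and
`σ_M(ν) = (-i σ_N(f¹) σ_N(f²)) ∘ φ`: a general covector is `α = φ*ω + (α, ν) ν`. -/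
def liftClifford (oM : ManifoldOrientation 3 M) (oN : ManifoldOrientation 2 N)
    (φ : C^∞⟮𝓡 3, M; 𝓡 2, N⟯)
    (σ : Π y : N, CotangentSpace 2 y →ₗ[ℝ] Module.End ℂ (Ψ y)) (p : M) :
    CotangentSpace 3 p →ₗ[ℝ] Module.End ℂ (LiftedBundle φ Ψ p) where
  toFun α := (show Module.End ℂ (Ψ (φ p)) from
    σ (φ p) (descend φ p α) + cometric α (nuForm oM oN φ p) • spinOperator oN σ (φ p))
  map_add' α β := by
    have h1 : descend φ p (α + β) = descend φ p α + descend φ p β := by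
      simp [descend, add_smul, Finset.sum_add_distrib]
    have h2 : cometric (α + β) (nuForm oM oN φ p)
        = cometric α (nuForm oM oN φ p) + cometric β (nuForm oM oN φ p) := by
      simp [cometric, add_mul, Finset.sum_add_distrib]
    change (_ : Module.End ℂ (Ψ (φ p))) = (_ : Module.End ℂ (Ψ (φ p)))
    rw [h1, h2, map_add, add_smul]
    exact add_add_add_comm _ _ _ _
  map_smul' c α := by
    have h1 : descend φ p (c • α) = c • descend φ p α := by
      simp [descend, mul_smul, Finset.smul_sum]
    have h2 : cometric (c • α) (nuForm oM oN φ p) = c * cometric α (nuForm oM oN φ p) := by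
      simp [cometric, mul_assoc, Finset.mul_sum]
    change (_ : Module.End ℂ (Ψ (φ p))) = (_ : Module.End ℂ (Ψ (φ p)))
    rw [h1, h2, map_smul, mul_smul]
    exact (smul_add _ _ _).symm

variable [TopologicalSpace (TotalSpace SpinorFiber Ψ)] [FiberBundle SpinorFiber Ψ]
  [VectorBundle ℝ SpinorFiber Ψ]

/-- The lifted `Spin^c` connection
`∇^M_X = φ*(∇^N)_X - ½ σ_M(ν) σ_M(D_X ν) - (i/4) ν(X) (ν, *dν) σ_M(ν)`,
where `D` is the Levi-Civita connection of `M`. -/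
def liftConnection (oM : ManifoldOrientation 3 M) (oN : ManifoldOrientation 2 N)
    (D : CovariantDerivative (𝓡 3) (Euc 3) (TangentSpace (𝓡 3) : M → Type _))
    (φ : C^∞⟮𝓡 3, M; 𝓡 2, N⟯)
    (σ : Π y : N, CotangentSpace 2 y →ₗ[ℝ] Module.End ℂ (Ψ y))
    (nab : (Π y : N, Ψ y) → Π y : N, TangentSpace (𝓡 2) y →L[ℝ] Ψ y)
    (s : Π p : M, LiftedBundle φ Ψ p) (p : M) :
    TangentSpace (𝓡 3) p →L[ℝ] LiftedBundle φ Ψ p :=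
  let ν := nuForm oM oN φ
  let c : ℝ := cometric (ν p) (starDNu oM oN φ p)
  let σM := liftClifford oM oN φ σ p
  LinearMap.toContinuousLinearMap
    { toFun := fun X => inducedConnection φ nab s p X
        - (1 / 2 : ℂ) • σM (ν p) (σM (covDerivForm D ν p X) (s p))
        - (Complex.I / 4 * (ν p X : ℂ) * (c : ℂ)) • σM (ν p) (s p)
      map_add' := by
        intro X Y
        have h : covDerivForm D ν p (X + Y) = covDerivForm D ν p X + covDerivForm D ν p Y := by
          simp only [covDerivForm, map_add, ← Finset.sum_add_distrib, ← add_smul]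
          exact Finset.sum_congr rfl fun i _ => by congr 1; ring
        rw [h]
        simp only [map_add, LinearMap.add_apply, Complex.ofReal_add]
        module
      map_smul' := by
        intro r X
        have h : covDerivForm D ν p (r • X) = r • covDerivForm D ν p X := by
          simp only [covDerivForm, map_smul, Finset.smul_sum, smul_smul, smul_eq_mul]
          exact Finset.sum_congr rfl fun i _ => by congr 1; ring
        rw [h]
        simp only [map_smul, LinearMap.smul_apply, smul_eq_mul, Complex.ofReal_mul,
          RingHom.id_apply, ← Complex.coe_smul]
        module }

/-- The corrected connection `∇^{M,±} = ∇^M ∓ (i/2) (*dν - ½ (ν, *dν) ν)`; the sign is `ε = ±1`. -/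
def correctedConnection (oM : ManifoldOrientation 3 M) (oN : ManifoldOrientation 2 N)
    (D : CovariantDerivative (𝓡 3) (Euc 3) (TangentSpace (𝓡 3) : M → Type _))
    (φ : C^∞⟮𝓡 3, M; 𝓡 2, N⟯)
    (σ : Π y : N, CotangentSpace 2 y →ₗ[ℝ] Module.End ℂ (Ψ y))
    (nab : (Π y : N, Ψ y) → Π y : N, TangentSpace (𝓡 2) y →L[ℝ] Ψ y) (ε : ℝ)
    (s : Π p : M, LiftedBundle φ Ψ p) (p : M) :
    TangentSpace (𝓡 3) p →L[ℝ] LiftedBundle φ Ψ p :=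
  let ν := nuForm oM oN φ p
  let η := starDNu oM oN φ p
  liftConnection oM oN D φ σ nab s p
    - (η - ((1 / 2 : ℝ) * cometric ν η) • ν).smulRight ((ε * (Complex.I / 2) : ℂ) • s p)

end Lift

end

/-! All assertions but those on integrals and on nonvanishing are local, so near each point of `M`
an adapted frame is fixed (`IsAdaptedFrame`): an oriented orthonormal frame f₀, f₁ of `N`, its
horizontal lifts e₀, e₁, and a unit vertical field e₂. In it ν = e₂♭.

Geometry. The brackets [e₀, e₁], [e₀, e₂], [e₁, e₂] are φ-related to [f₀, f₁], 0, 0. Vanishing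
torsion and metric compatibility then express the Levi-Civita connection D of `M` by that of `N` and
three functions, the `twist` c and the `bend`s h₀, h₁: the covariant derivatives of e₂ along e₀, e₁,
e₂ are (c/2)e₁, -(c/2)e₀, h₀e₀ + h₁e₁, and ⟨D_X e₀, e₁⟩ exceeds its value on `N` at φ_*X by
(c/2)ν(X). Hence *dν is dual to -h₁e₀ + h₀e₁ + ce₂, and (ν, *dν) = c.

Algebra. In rank two, trace-free endomorphisms satisfy the Clifford relations, so the actions A, B,
C of e₀, e₁, e₂ multiply like Pauli matrices (`IsPauliTriple`). In these terms ∇^{M,±}_X = φ*(∇^N)_X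
+ i(a₀A + a₁B + a₂C + a₃) with real a_j linear in X (`correctedConnection_eq`, `spinCoeff`).
Self-adjointness of A, B, C makes this metric. Commutators with the first three terms supply exactly
the part of D e_i that does not come from `N`, and the scalar term commutes with everything; so the
Clifford rule holds (`correctedConnection_clifford`) and extends to all one-forms by the Leibniz
rule (`IsSpincConnection.lift`).

Dirac operator. On ξ∘φ the induced derivative along e₂ vanishes, and those along e₀, e₁ are the
derivatives of ξ along f₀, f₁. The remaining zeroth-order terms cancel if Cs = εs, since C
anticommutes with A and B and C² = 1 (`IsPauliTriple.sum_eq`).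

Definite spin. The spin operator is a self-adjoint involution T, so (ξ, Tξ) = S|ξ|² forces Tξ = Sξ.
In the integrated version |ξ|² - S Re(ξ, Tξ) is continuous, nonnegative and of integral zero; it
vanishes everywhere because the Riemannian measure is positive on nonempty open sets. -/

set_option linter.unusedSectionVars false

/-! ### Musical isomorphisms and the cometric -/

section Musical

variable {n : ℕ} {M : Type*} [TopologicalSpace M] [ChartedSpace (Euc n) M]
  [RiemannianBundle (fun x : M => TangentSpace (𝓡 n) x)]

/-- The vector `α♯` with `⟪α♯, w⟫ = α w`. -/
noncomputable def sharp {x : M} (α : CotangentSpace n x) : TangentSpace (𝓡 n) x :=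
  ∑ i, α (onb x i) • onb x i

theorem flat_apply {x : M} (v w : TangentSpace (𝓡 n) x) : flat v w = inner ℝ v w := rfl

theorem inner_sharp {x : M} (α : CotangentSpace n x) (w : TangentSpace (𝓡 n) x) :
    inner ℝ (sharp α) w = α w := by
  conv_rhs => rw [← (onb x).sum_repr' w]
  simp [sharp, sum_inner, inner_smul_left, map_sum, mul_comm]

theorem flat_sharp {x : M} (α : CotangentSpace n x) : flat (sharp α) = α := by
  ext w; rw [flat_apply, inner_sharp]

theorem flat_add {x : M} (v w : TangentSpace (𝓡 n) x) : flat (v + w) = flat v + flat w :=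
  map_add (innerSL ℝ) v w

theorem flat_smul {x : M} (r : ℝ) (v : TangentSpace (𝓡 n) x) : flat (r • v) = r • flat v := by
  ext w; simp [flat_apply, inner_smul_left]

theorem flat_sum {x : M} {ι : Type*} (s : Finset ι) (v : ι → TangentSpace (𝓡 n) x) :
    flat (∑ i ∈ s, v i) = ∑ i ∈ s, flat (v i) :=
  map_sum (innerSL ℝ) v s

theorem cometric_flat {x : M} (u v : TangentSpace (𝓡 n) x) :
    cometric (flat u) (flat v) = inner ℝ u v := by
  simp only [cometric, flat_apply]
  rw [← (onb x).sum_inner_mul_inner u v]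
  exact Finset.sum_congr rfl fun i _ => by rw [real_inner_comm v]

end Musical

/-! ### Smooth fields and one-forms -/

section Smooth

variable {n : ℕ} {M : Type*} [TopologicalSpace M] [ChartedSpace (Euc n) M]
  [IsManifold (𝓡 n) ∞ M]

theorem SmoothFieldAt.mdifferentiableAt {X : Π x : M, TangentSpace (𝓡 n) x} {x : M}
    (h : SmoothFieldAt X x) : MDifferentiableAt (𝓡 n) ((𝓡 n).prod (𝓡 n))
      (fun y => TotalSpace.mk' (Euc n) (E := (TangentSpace (𝓡 n) : M → Type _)) y (X y)) x :=
  ContMDiffAt.mdifferentiableAt h (by simp)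

theorem SmoothFieldAt.congr {X Y : Π x : M, TangentSpace (𝓡 n) x} {x : M}
    (h : SmoothFieldAt X x) (e : ∀ᶠ y in nhds x, Y y = X y) : SmoothFieldAt Y x :=
  ContMDiffAt.congr_of_eventuallyEq h (e.mono fun y hy => by simp [hy])

theorem SmoothFieldAt.add {X Y : Π x : M, TangentSpace (𝓡 n) x} {x : M}
    (hX : SmoothFieldAt X x) (hY : SmoothFieldAt Y x) : SmoothFieldAt (fun y => X y + Y y) x :=
  ContMDiffAt.add_section hX hY

theorem SmoothFieldAt.sub {X Y : Π x : M, TangentSpace (𝓡 n) x} {x : M}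
    (hX : SmoothFieldAt X x) (hY : SmoothFieldAt Y x) : SmoothFieldAt (fun y => X y - Y y) x :=
  ContMDiffAt.sub_section hX hY

theorem SmoothFieldAt.smul {f : M → ℝ} {X : Π x : M, TangentSpace (𝓡 n) x} {x : M}
    (hf : ContMDiffAt (𝓡 n) 𝓘(ℝ) ∞ f x) (hX : SmoothFieldAt X x) :
    SmoothFieldAt (fun y => f y • X y) x :=
  ContMDiffAt.smul_section hf hX

theorem SmoothFieldAt.sum {ι : Type*} (s : Finset ι) {X : ι → Π x : M, TangentSpace (𝓡 n) x}
    {x : M} (hX : ∀ i ∈ s, SmoothFieldAt (X i) x) : SmoothFieldAt (fun y => ∑ i ∈ s, X i y) x :=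
  ContMDiffAt.sum_section hX

theorem exists_smoothField (x : M) (v : TangentSpace (𝓡 n) x) :
    ∃ X : Π x : M, TangentSpace (𝓡 n) x, X x = v ∧ ∀ᶠ y in nhds x, SmoothFieldAt X y := by
  let t := trivializationAt (Euc n) (TangentSpace (𝓡 n) : M → Type _) x
  have hx := FiberBundle.mem_baseSet_trivializationAt' (F := Euc n)
    (E := (TangentSpace (𝓡 n) : M → Type _)) x
  -- The extension is constant in the trivialization at `x`, hence smooth on the whole base set and
  -- not only at `x`, as frames near a point require.
  refine ⟨FiberBundle.extend (Euc n) v, FiberBundle.extend_apply_self _ v, ?_⟩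
  filter_upwards [t.open_baseSet.mem_nhds hx] with y hy
  refine (t.contMDiffAt_section_iff (n := ∞) hy).2 ?_
  refine (contMDiffAt_const (c := (t ⟨x, v⟩).2)).congr_of_eventuallyEq ?_
  filter_upwards [t.open_baseSet.mem_nhds hy] with z hz
  simp [FiberBundle.extend, t, Bundle.Trivialization.apply_mk_symm _ hz]

theorem SmoothFormAt.apply {α : Π x : M, CotangentSpace n x} {X : Π x : M, TangentSpace (𝓡 n) x}
    {x : M} (hα : SmoothFormAt α x) (hX : SmoothFieldAt X x) :
    ContMDiffAt (𝓡 n) 𝓘(ℝ) ∞ (fun y => α y (X y)) x := by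
  have h := ContMDiffAt.clm_bundle_apply (F₂ := ℝ) (E₂ := Bundle.Trivial M ℝ) hα hX
  exact (contMDiffAt_section (F := ℝ) (E := Bundle.Trivial M ℝ) _).1 h

/-- The derivative of a smooth function along a smooth field is smooth. -/
theorem SmoothFieldAt.mvfderiv_apply {F : Type*} [NormedAddCommGroup F] [NormedSpace ℝ F]
    {f : M → F} {X : Π x : M, TangentSpace (𝓡 n) x}
    {x : M} (hf : ContMDiffAt (𝓡 n) 𝓘(ℝ, F) ∞ f x) (hX : SmoothFieldAt X x) :
    ContMDiffAt (𝓡 n) 𝓘(ℝ, F) ∞ (fun y => mvfderiv (𝓡 n) f y (X y)) x := by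
  have h := ContMDiffAt.clm_apply_of_inCoordinates (n := ∞) (IB₁ := 𝓡 n) (IB₂ := 𝓘(ℝ, F))
    (E₁ := (TangentSpace (𝓡 n) : M → Type _)) (E₂ := (TangentSpace 𝓘(ℝ, F) : F → Type _))
    (F₁ := Euc n) (F₂ := F) (b₁ := id) (b₂ := f) (ϕ := fun m => mfderiv (𝓡 n) 𝓘(ℝ, F) f m)
    (hf.mfderiv_const (m := ∞) (by simp)) hX hf
  rw [contMDiffAt_totalSpace] at h
  simpa [mvfderiv] using! h.2

variable [RiemannianBundle (fun x : M => TangentSpace (𝓡 n) x)]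
    [IsContMDiffRiemannianBundle (𝓡 n) ∞ (Euc n) (fun x : M => TangentSpace (𝓡 n) x)]

theorem SmoothFieldAt.inner {X Y : Π x : M, TangentSpace (𝓡 n) x} {x : M}
    (hX : SmoothFieldAt X x) (hY : SmoothFieldAt Y x) :
    ContMDiffAt (𝓡 n) 𝓘(ℝ) ∞ (fun y => inner ℝ (X y) (Y y)) x :=
  ContMDiffAt.inner_bundle (IM := 𝓡 n) (b := id) hX hY

/-- The metric is itself a smooth section of the bundle of maps from `TM` to its dual, and lowering
an index is applying that section. -/
theorem SmoothFieldAt.flat {X : Π x : M, TangentSpace (𝓡 n) x} {x : M}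
    (hX : SmoothFieldAt X x) : SmoothFormAt (fun y => flat (X y)) x := by
  obtain ⟨g, hg, h⟩ := IsContMDiffRiemannianBundle.exists_contMDiff (IB := 𝓡 n) (n := ∞)
    (F := Euc n) (E := fun x : M => TangentSpace (𝓡 n) x)
  have h1 := ContMDiffAt.clm_bundle_apply (F₁ := Euc n) (F₂ := Euc n →L[ℝ] ℝ)
    (E₂ := fun y : M => TangentSpace (𝓡 n) y →L[ℝ] ℝ) (b := id) hg.contMDiffAt hX
  refine h1.congr_of_eventuallyEq (Filter.Eventually.of_forall fun y => ?_)
  have : _root_.flat (X y) = g y (X y) := by ext w; exact h y (X y) w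
  simp [this]

end Smooth


theorem exists_orthonormalBasis_orientation_eq {n : ℕ} [NeZero n] {E : Type*}
    [NormedAddCommGroup E] [InnerProductSpace ℝ E] [Fact (Module.finrank ℝ E = n)]
    (o : Orientation ℝ E (Fin n)) :
    ∃ b : OrthonormalBasis (Fin n) ℝ E, b.toBasis.orientation = o :=
  ⟨o.finOrthonormalBasis (Nat.pos_of_ne_zero (NeZero.ne n)) Fact.out,
    o.finOrthonormalBasis_orientation _ _⟩

/-! ### Smooth orthonormal and oriented frames -/

section Frames

variable {n : ℕ} {M : Type*} [TopologicalSpace M] [ChartedSpace (Euc n) M]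
  [IsManifold (𝓡 n) ∞ M] [RiemannianBundle (fun x : M => TangentSpace (𝓡 n) x)]
  [IsContMDiffRiemannianBundle (𝓡 n) ∞ (Euc n) (fun x : M => TangentSpace (𝓡 n) x)]

/-- A unit vector orthogonal to an orthonormal family of smooth fields extends to a smooth unit
field orthogonal to the family. -/
theorem exists_unit_extension {ι : Type*} [Fintype ι] [DecidableEq ι] {x : M}
    {e : ι → Π x : M, TangentSpace (𝓡 n) x}
    (he : ∀ᶠ y in nhds x, (∀ i, SmoothFieldAt (e i) y) ∧
      ∀ i j, inner ℝ (e i y) (e j y) = if i = j then (1 : ℝ) else 0)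
    {v : TangentSpace (𝓡 n) x} (hv : inner ℝ v v = (1 : ℝ))
    (hperp : ∀ i, inner ℝ (e i x) v = (0 : ℝ)) :
    ∃ Z : Π x : M, TangentSpace (𝓡 n) x, Z x = v ∧ ∀ᶠ y in nhds x, SmoothFieldAt Z y ∧
      inner ℝ (Z y) (Z y) = (1 : ℝ) ∧ ∀ i, inner ℝ (e i y) (Z y) = (0 : ℝ) := by
  obtain ⟨V, hVx, hV⟩ := exists_smoothField x v
  -- The components along the family are removed. At `x` there are none, so `W x = v` has norm one
  -- and `W` can be normalized nearby.
  let W : Π x : M, TangentSpace (𝓡 n) x := fun y => V y - ∑ i, (inner ℝ (e i y) (V y) : ℝ) • e i y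
  have hW : ∀ᶠ y in nhds x, SmoothFieldAt W y := by
    filter_upwards [he, hV] with y hy hVy
    exact hVy.sub (SmoothFieldAt.sum _ fun i _ => SmoothFieldAt.smul ((hy.1 i).inner hVy) (hy.1 i))
  have hWx : W x = v := by simp [W, hVx, hperp]
  have hpos : ∀ᶠ y in nhds x, 0 < (inner ℝ (W y) (W y) : ℝ) := by
    have := (hW.self_of_nhds.inner hW.self_of_nhds).continuousAt
    refine this.eventually (lt_mem_nhds ?_)
    show 0 < (inner ℝ (W x) (W x) : ℝ)
    rw [hWx, hv]; exact one_pos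
  refine ⟨fun y => (Real.sqrt (inner ℝ (W y) (W y)))⁻¹ • W y, by
    beta_reduce; rw [hWx, hv, Real.sqrt_one, inv_one, one_smul], ?_⟩
  filter_upwards [he, hW, hpos] with y hy hWy hp
  refine ⟨SmoothFieldAt.smul ?_ hWy, ?_, fun i => ?_⟩
  · have h1 : ContDiffAt ℝ ∞ (fun t : ℝ => (Real.sqrt t)⁻¹) (inner ℝ (W y) (W y)) :=
      (Real.contDiffAt_sqrt hp.ne').inv (Real.sqrt_pos.2 hp).ne'
    exact h1.contMDiffAt.comp (f := fun y => (inner ℝ (W y) (W y) : ℝ)) y (hWy.inner hWy)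
  · rw [inner_smul_left, inner_smul_right, ← mul_assoc]
    have := Real.mul_self_sqrt hp.le
    have h0 := (Real.sqrt_pos.2 hp).ne'
    simp only [conj_trivial]
    rw [← mul_inv, this, inv_mul_cancel₀ hp.ne']
  · rw [inner_smul_right]
    have : (inner ℝ (e i y) (W y) : ℝ) = 0 := by
      simp [W, inner_sub_right, inner_sum, inner_smul_right, hy.2]
    rw [this, mul_zero]

/-- The fields `e` form a smooth orthonormal frame near `x`. -/
def IsOrthonormalFrameNear (e : Fin n → Π x : M, TangentSpace (𝓡 n) x) (x : M) : Prop :=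
  ∀ᶠ y in nhds x, (∀ i, SmoothFieldAt (e i) y) ∧
    ∀ i j, inner ℝ (e i y) (e j y) = if i = j then (1 : ℝ) else 0

/-- Gram–Schmidt, one vector at a time by `exists_unit_extension`. The values at `x` are prescribed
so that the frame can start from an oriented basis. -/
theorem exists_orthonormalFrame {x : M} (b : OrthonormalBasis (Fin n) ℝ (TangentSpace (𝓡 n) x)) :
    ∃ e : Fin n → Π x : M, TangentSpace (𝓡 n) x, (∀ i, e i x = b i) ∧
      IsOrthonormalFrameNear e x := by
  have key : ∀ s : Finset (Fin n), ∃ e : Fin n → Π x : M, TangentSpace (𝓡 n) x,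
      (∀ i, e i x = b i) ∧ ∀ᶠ y in nhds x, (∀ i ∈ s, SmoothFieldAt (e i) y) ∧
        ∀ i ∈ s, ∀ j ∈ s, inner ℝ (e i y) (e j y) = if i = j then (1 : ℝ) else 0 := by
    intro s
    induction s using Finset.induction_on with
    | empty =>
      choose X hX using fun i => exists_smoothField x (b i)
      exact ⟨X, fun i => (hX i).1, by simp⟩
    | insert a s ha ih =>
      obtain ⟨e, hex, he⟩ := ih
      have hb := orthonormal_iff_ite.1 b.orthonormal
      obtain ⟨Z, hZx, hZ⟩ := exists_unit_extension (x := x) (e := fun i : s => e i) (v := b a)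
        (by
          filter_upwards [he] with y hy
          refine ⟨fun i => hy.1 i i.2, fun i j => ?_⟩
          simpa only [Subtype.ext_iff] using hy.2 i i.2 j j.2)
        (by rw [hb]; simp)
        (by
          intro i
          rw [hex, hb, if_neg]
          rintro rfl
          exact ha i.2)
      refine ⟨Function.update e a Z, fun i => ?_, ?_⟩
      · rcases eq_or_ne i a with rfl | h
        · simp [hZx]
        · simp [h, hex]
      · filter_upwards [he, hZ] with y hy hZy
        have hne : ∀ i ∈ s, i ≠ a := fun i hi h => ha (h ▸ hi)
        refine ⟨fun i hi => ?_, fun i hi j hj => ?_⟩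
        · rcases Finset.mem_insert.1 hi with rfl | hi
          · simpa using hZy.1
          · simpa [hne i hi] using hy.1 i hi
        · rcases Finset.mem_insert.1 hi with hia | hi' <;>
          rcases Finset.mem_insert.1 hj with hja | hj'
          · subst hia; subst hja; simpa using hZy.2.1
          · subst hia
            simp only [Function.update_self, Function.update_of_ne (hne j hj'),
              if_neg (hne j hj').symm]
            rw [real_inner_comm]; exact hZy.2.2 ⟨j, hj'⟩
          · subst hja
            simpa [hne i hi'] using hZy.2.2 ⟨i, hi'⟩
          · simpa [hne i hi', hne j hj'] using hy.2 i hi' j hj'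
  obtain ⟨e, h1, h2⟩ := key Finset.univ
  exact ⟨e, h1, h2.mono fun y hy => ⟨fun i => hy.1 i (Finset.mem_univ i),
    fun i j => hy.2 i (Finset.mem_univ i) j (Finset.mem_univ j)⟩⟩

theorem exists_orthonormalBasis_of_inner {x : M} {v : Fin n → TangentSpace (𝓡 n) x}
    (h : ∀ i j, inner ℝ (v i) (v j) = if i = j then (1 : ℝ) else 0) :
    ∃ b : OrthonormalBasis (Fin n) ℝ (TangentSpace (𝓡 n) x), ∀ i, b i = v i := by
  have ho : Orthonormal ℝ v := orthonormal_iff_ite.2 h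
  refine ⟨OrthonormalBasis.mk ho ?_, fun i => congrFun (OrthonormalBasis.coe_mk ho _) i⟩
  rw [ho.linearIndependent.span_eq_top_of_card_eq_finrank'
    (by rw [Fintype.card_fin, finrank_tangentSpace_eq])]

/-- The fields `e` form an oriented smooth orthonormal frame near `x`. -/
def IsOrientedFrameNear (o : ManifoldOrientation n M)
    (e : Fin n → Π x : M, TangentSpace (𝓡 n) x) (x : M) : Prop :=
  ∀ᶠ y in nhds x, (∀ i, SmoothFieldAt (e i) y) ∧
    ∃ b : OrthonormalBasis (Fin n) ℝ (TangentSpace (𝓡 n) y), (∀ i, b i = e i y) ∧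
      b.toBasis.orientation = o.orient y

/-- Being positively oriented is an open condition: the determinant comparing the frame with a
smooth positive frame has the inner products ⟨e_i, X_j⟩ as entries, so it is continuous and stays
positive near `x`. -/
theorem IsOrthonormalFrameNear.isOrientedFrameNear (o : ManifoldOrientation n M) {x : M}
    {e : Fin n → Π x : M, TangentSpace (𝓡 n) x} (he : IsOrthonormalFrameNear e x)
    {b : OrthonormalBasis (Fin n) ℝ (TangentSpace (𝓡 n) x)} (hb : ∀ i, b i = e i x)
    (hbo : b.toBasis.orientation = o.orient x) : IsOrientedFrameNear o e x := by
  obtain ⟨X, hX, hXo⟩ := o.exists_frame x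
  have hdet : ∀ {y : M} (b : OrthonormalBasis (Fin n) ℝ (TangentSpace (𝓡 n) y))
      (c : Module.Basis (Fin n) ℝ (TangentSpace (𝓡 n) y)), (∀ i, b i = e i y) →
      (∀ i, c i = X i y) → b.toBasis.det c =
        Matrix.det (Matrix.of fun i j => (inner ℝ (e i y) (X j y) : ℝ)) := by
    intro y b c hb hc
    rw [Module.Basis.det_apply]
    congr 1
    ext i j
    simp [Module.Basis.toMatrix_apply, OrthonormalBasis.repr_apply_apply, hb, hc]
  have hcont : ContinuousAt (fun y =>
      Matrix.det (Matrix.of fun i j => (inner ℝ (e i y) (X j y) : ℝ))) x := by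
    refine (Continuous.matrix_det continuous_id).continuousAt.comp
      (f := fun y => Matrix.of fun i j => (inner ℝ (e i y) (X j y) : ℝ)) ?_
    refine continuousAt_pi.2 fun i => continuousAt_pi.2 fun j => ?_
    exact ((he.self_of_nhds.1 i).inner (hX j)).continuousAt
  obtain ⟨c, hc, hco⟩ := hXo.self_of_nhds
  have hpos := (Module.Basis.orientation_eq_iff_det_pos b.toBasis c).1 (hbo.trans hco.symm)
  rw [hdet b c hb hc] at hpos
  filter_upwards [he, hXo, hcont.eventually (lt_mem_nhds hpos)] with y hy ⟨c', hc', hco'⟩ hp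
  obtain ⟨b', hb'⟩ := exists_orthonormalBasis_of_inner hy.2
  refine ⟨hy.1, b', hb', ?_⟩
  rw [← hco', Module.Basis.orientation_eq_iff_det_pos, hdet b' c' hb' hc']
  exact hp

theorem IsOrientedFrameNear.isOrthonormalFrameNear {o : ManifoldOrientation n M} {x : M}
    {e : Fin n → Π x : M, TangentSpace (𝓡 n) x} (he : IsOrientedFrameNear o e x) :
    IsOrthonormalFrameNear e x := by
  refine he.mono fun y ⟨h1, b, hb, _⟩ => ⟨h1, fun i j => ?_⟩
  rw [← hb, ← hb]
  exact orthonormal_iff_ite.1 b.orthonormal i j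

theorem exists_orientedFrame [NeZero n] (o : ManifoldOrientation n M) (x : M) :
    ∃ e : Fin n → Π x : M, TangentSpace (𝓡 n) x, IsOrientedFrameNear o e x := by
  obtain ⟨b, hb⟩ := exists_orthonormalBasis_orientation_eq (n := n) (o.orient x)
  obtain ⟨e, hex, he⟩ := exists_orthonormalFrame b
  exact ⟨e, he.isOrientedFrameNear o (fun i => (hex i).symm) hb⟩

theorem IsOrthonormalFrameNear.eventually_eq_sum {x : M}
    {e : Fin n → Π x : M, TangentSpace (𝓡 n) x} (he : IsOrthonormalFrameNear e x)
    (A : Π x : M, TangentSpace (𝓡 n) x) :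
    ∀ᶠ y in nhds x, A y = ∑ i, (inner ℝ (e i y) (A y) : ℝ) • e i y := by
  filter_upwards [he] with y hy
  obtain ⟨b, hb⟩ := exists_orthonormalBasis_of_inner hy.2
  simp only [← hb]
  exact (b.sum_repr' (A y)).symm

theorem IsOrthonormalFrameNear.smoothFieldAt {x : M}
    {e : Fin n → Π x : M, TangentSpace (𝓡 n) x} (he : IsOrthonormalFrameNear e x)
    {A : Π x : M, TangentSpace (𝓡 n) x}
    (hA : ∀ i, ContMDiffAt (𝓡 n) 𝓘(ℝ) ∞ (fun y => (inner ℝ (e i y) (A y) : ℝ)) x) :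
    SmoothFieldAt A x :=
  (SmoothFieldAt.sum Finset.univ fun i _ => SmoothFieldAt.smul (hA i) (he.self_of_nhds.1 i)).congr
    (he.eventually_eq_sum A)

theorem SmoothFormAt.sharp {α : Π x : M, CotangentSpace n x} {x : M} (hα : SmoothFormAt α x) :
    SmoothFieldAt (fun y => _root_.sharp (α y)) x := by
  obtain ⟨e, -, he⟩ := exists_orthonormalFrame (onb (n := n) x)
  refine he.smoothFieldAt fun i => ?_
  refine (hα.apply (he.self_of_nhds.1 i)).congr_of_eventuallyEq
    (Filter.Eventually.of_forall fun y => ?_)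
  exact (real_inner_comm (_root_.sharp (α y)) (e i y)).trans (inner_sharp (α y) (e i y))

end Frames

/-! ### Lie brackets as commutators and under maps -/

section Bracket

theorem mvfderiv_comp_mfderiv {n m : ℕ} {M : Type*} [TopologicalSpace M] [ChartedSpace (Euc n) M]
    {N : Type*} [TopologicalSpace N] [ChartedSpace (Euc m) N] {F : Type*} [NormedAddCommGroup F]
    [NormedSpace ℝ F] {φ : M → N} {f : N → F} {p : M}
    (hf : MDifferentiableAt (𝓡 m) 𝓘(ℝ, F) f (φ p)) (hφ : MDifferentiableAt (𝓡 n) (𝓡 m) φ p)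
    (X : TangentSpace (𝓡 n) p) :
    mvfderiv (𝓡 n) (fun q => f (φ q)) p X
      = mvfderiv (𝓡 m) f (φ p) (mfderiv (𝓡 n) (𝓡 m) φ p X) :=
  mfderiv_comp_apply p hf hφ X

theorem mvfderiv_congr {n : ℕ} {M : Type*} [TopologicalSpace M] [ChartedSpace (Euc n) M]
    {F : Type*} [NormedAddCommGroup F] [NormedSpace ℝ F] {f g : M → F} {p : M}
    (h : f =ᶠ[nhds p] g) (X : TangentSpace (𝓡 n) p) :
    mvfderiv (𝓡 n) f p X = mvfderiv (𝓡 n) g p X := by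
  have : mfderiv (𝓡 n) 𝓘(ℝ, F) f p = mfderiv (𝓡 n) 𝓘(ℝ, F) g p := h.mfderiv_eq
  have hp := h.self_of_nhds
  change mfderiv (𝓡 n) 𝓘(ℝ, F) f p X = mfderiv (𝓡 n) 𝓘(ℝ, F) g p X
  rw [this]
  rfl

variable {n : ℕ} {M : Type*} [TopologicalSpace M] [ChartedSpace (Euc n) M]
  [IsManifold (𝓡 n) ∞ M]

theorem ContMDiffAt.eventually_mdifferentiableAt {E : Type*} [NormedAddCommGroup E]
    [NormedSpace ℝ E] {H : Type*} [TopologicalSpace H] {I : ModelWithCorners ℝ E H} {P : Type*}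
    [TopologicalSpace P] [ChartedSpace H P] [IsManifold I 1 P]
    {f : M → P} {x : M} (hf : ContMDiffAt (𝓡 n) I ∞ f x) :
    ∀ᶠ y in nhds x, MDifferentiableAt (𝓡 n) I f y :=
  ((contMDiffAt_iff_contMDiffAt_nhds (n := 1) (by simp)).1 (hf.of_le (by simp))).mono
    fun _ hy => hy.mdifferentiableAt (by simp)

/-- The bracket of fields acts on functions as the commutator of derivations. -/
theorem mvfderiv_mlieBracket {F : Type*} [NormedAddCommGroup F] [NormedSpace ℝ F]
    {f : M → F} {V W : Π x : M, TangentSpace (𝓡 n) x} {x : M}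
    (hf : ContMDiffAt (𝓡 n) 𝓘(ℝ, F) ∞ f x) (hV : SmoothFieldAt V x) (hW : SmoothFieldAt W x) :
    mvfderiv (𝓡 n) f x (VectorField.mlieBracket (𝓡 n) V W x)
      = mvfderiv (𝓡 n) (fun y => mvfderiv (𝓡 n) f y (W y)) x (V x)
        - mvfderiv (𝓡 n) (fun y => mvfderiv (𝓡 n) f y (V y)) x (W x) := by
  -- The identity is transported to the chart at `x`, where it is the commutator formula for the
  -- flat Lie bracket.
  let c := extChartAt (𝓡 n) x
  have hc : ContMDiffAt 𝓘(ℝ, Euc n) (𝓡 n) ∞ c.symm (c x) :=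
    (contMDiffOn_extChartAt_symm (I := 𝓡 n) (n := ∞) x).contMDiffAt
      (extChartAt_target_mem_nhds (I := 𝓡 n) x)
  have hcx : c.symm (c x) = x := extChartAt_to_inv x
  let G : Euc n → F := fun u => f (c.symm u)
  have hG : ContDiffAt ℝ ∞ G (c x) := by
    refine ContMDiffAt.contDiffAt (ContMDiffAt.comp (c x) (g := f) ?_ hc)
    rw [hcx]; exact hf
  -- the chart expressions of the fields
  let P : (Π x : M, TangentSpace (𝓡 n) x) → Euc n → Euc n := fun V u =>
    VectorField.mpullbackWithin 𝓘(ℝ, Euc n) (𝓡 n) c.symm V (Set.range (𝓡 n)) u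
  have hinv : ∀ᶠ u in nhds (c x), ∀ V : Π x : M, TangentSpace (𝓡 n) x,
      mfderiv 𝓘(ℝ, Euc n) (𝓡 n) c.symm u (P V u) = V (c.symm u) := by
    filter_upwards [extChartAt_target_mem_nhds (I := 𝓡 n) x] with u hu V
    have h1 := isInvertible_mfderivWithin_extChartAt_symm (I := 𝓡 n) (x := x) hu
    simp only [modelWithCornersSelf_coe, Set.range_id, mfderivWithin_univ] at h1
    simp only [P, VectorField.mpullbackWithin, modelWithCornersSelf_coe, Set.range_id,
      mfderivWithin_univ]
    obtain ⟨L, hL⟩ := h1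
    change (mfderiv 𝓘(ℝ, Euc n) (𝓡 n) c.symm u)
      ((mfderiv 𝓘(ℝ, Euc n) (𝓡 n) c.symm u).inverse (V (c.symm u))) = _
    rw [← hL, ContinuousLinearMap.inverse_equiv]
    exact L.apply_symm_apply _
  -- Chain rule: differentiating `K` in the chart along the chart expression of a field is
  -- differentiating `K` along the field. It is needed on a neighbourhood because it is
  -- differentiated once more in `hsecond`.
  have hder : ∀ {K : M → F}, (∀ᶠ y in nhds x, MDifferentiableAt (𝓡 n) 𝓘(ℝ, F) K y) →
      ∀ᶠ u in nhds (c x), ∀ V : Π x : M, TangentSpace (𝓡 n) x,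
        fderiv ℝ (fun u => K (c.symm u)) u (P V u)
          = mvfderiv (𝓡 n) K (c.symm u) (V (c.symm u)) := by
    intro K hK
    have hcont : Filter.Tendsto c.symm (nhds (c x)) (nhds x) := by
      have := hc.continuousAt.tendsto
      rwa [hcx] at this
    filter_upwards [hinv, hcont.eventually hK,
      extChartAt_target_mem_nhds (I := 𝓡 n) x, eventually_mem_nhds_iff.2
        (extChartAt_target_mem_nhds (I := 𝓡 n) x)] with u hu hKu hut hut' V
    have hcu : MDifferentiableAt 𝓘(ℝ, Euc n) (𝓡 n) c.symm u :=
      ((contMDiffOn_extChartAt_symm (I := 𝓡 n) (n := ∞) x).contMDiffAt hut').mdifferentiableAt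
        (by simp)
    rw [← hu V, ← mfderiv_eq_fderiv]
    exact mfderiv_comp_apply u hKu hcu (P V u)
  have hr : c.symm ⁻¹' Set.univ ∩ Set.range (𝓡 n) = Set.univ := by simp
  have hPd : ∀ {V : Π x : M, TangentSpace (𝓡 n) x}, SmoothFieldAt V x →
      DifferentiableAt ℝ (P V) (c x) := by
    intro V hV
    have h := (hV.mdifferentiableAt.mdifferentiableWithinAt
      (s := Set.univ)).differentiableWithinAt_mpullbackWithin_vectorField
    have h' : DifferentiableWithinAt ℝ (P V) (c.symm ⁻¹' Set.univ ∩ Set.range (𝓡 n)) (c x) := h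
    rwa [hr, differentiableWithinAt_univ] at h'
  have hsecond : ∀ {V W : Π x : M, TangentSpace (𝓡 n) x}, SmoothFieldAt W x →
      fderiv ℝ (fun u => fderiv ℝ G u (P W u)) (c x) (P V (c x))
        = mvfderiv (𝓡 n) (fun y => mvfderiv (𝓡 n) f y (W y)) x (V x) := by
    intro V W hW
    have e1 : (fun u => fderiv ℝ G u (P W u)) =ᶠ[nhds (c x)]
        fun u => (fun y => mvfderiv (𝓡 n) f y (W y)) (c.symm u) :=
      (hder hf.eventually_mdifferentiableAt).mono fun u hu => hu W
    rw [e1.fderiv_eq, (hder (hW.mvfderiv_apply hf).eventually_mdifferentiableAt).self_of_nhds V]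
    exact congrArg (fun z => mvfderiv (𝓡 n) (fun y => mvfderiv (𝓡 n) f y (W y)) z (V z)) hcx
  rw [← hsecond hW, ← hsecond hV, ← VectorField.fderiv_apply_lieBracket (n := ∞) hG
    (by rw [minSmoothness_of_isRCLikeNormedField]; exact WithTop.coe_le_coe.2 le_top)
    (hPd hW) (hPd hV)]
  have e2 : f =ᶠ[nhds x] fun y => G (c y) := by
    filter_upwards [extChartAt_source_mem_nhds (I := 𝓡 n) x] with y hy
    simp only [G, c]
    rw [(extChartAt (𝓡 n) x).left_inv hy]
  rw [mvfderiv_congr e2]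
  have hcd : MDifferentiableAt (𝓡 n) 𝓘(ℝ, Euc n) c x :=
    (contMDiffAt_extChartAt (I := 𝓡 n) (n := ∞)).mdifferentiableAt (by simp)
  rw [mvfderiv_comp_mfderiv (hG.differentiableAt (by simp)).mdifferentiableAt hcd]
  have h1 := isInvertible_mfderiv_extChartAt (I := 𝓡 n) (mem_extChartAt_source (I := 𝓡 n) x)
  -- The manifold bracket is defined by pulling back the bracket of the chart expressions, so the
  -- derivative of the chart undoes the pullback.
  have h2 : mfderiv (𝓡 n) 𝓘(ℝ, Euc n) c x (VectorField.mlieBracket (𝓡 n) V W x)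
      = VectorField.lieBracket ℝ (P V) (P W) (c x) := by
    have hb : VectorField.lieBracketWithin ℝ (P V) (P W)
        (c.symm ⁻¹' Set.univ ∩ Set.range (𝓡 n)) (c x)
          = VectorField.lieBracket ℝ (P V) (P W) (c x) := by
      rw [hr, VectorField.lieBracketWithin_univ]
    rw [← hb]
    obtain ⟨L, hL⟩ := h1
    change (mfderiv (𝓡 n) 𝓘(ℝ, Euc n) (extChartAt (𝓡 n) x) x)
      ((mfderiv (𝓡 n) 𝓘(ℝ, Euc n) (extChartAt (𝓡 n) x) x).inverse _) = _
    rw [← hL, ContinuousLinearMap.inverse_equiv]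
    exact L.apply_symm_apply _
  rw [h2]
  exact congrArg (fun L : Euc n →L[ℝ] F => L (VectorField.lieBracket ℝ (P V) (P W) (c x)))
    (mfderiv_eq_fderiv (f := G) (x := c x))

theorem SmoothFieldAt.mlieBracket {V W : Π x : M, TangentSpace (𝓡 n) x} {x : M}
    (hV : SmoothFieldAt V x) (hW : SmoothFieldAt W x) :
    SmoothFieldAt (VectorField.mlieBracket (𝓡 n) V W) x := by
  have : IsManifold (𝓡 n) (((⊤ : ℕ∞) : WithTop ℕ∞) + 1) M := by simpa using ‹IsManifold (𝓡 n) ∞ M›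
  have : IsManifold (𝓡 n) (minSmoothness ℝ 2) M := by
    rw [minSmoothness_of_isRCLikeNormedField]; infer_instance
  have : IsManifold (𝓡 n) (minSmoothness ℝ 3) M := by
    rw [minSmoothness_of_isRCLikeNormedField]; infer_instance
  exact ContMDiffAt.mlieBracket_vectorField (m := ⊤) (n := ⊤) hV hW (by simp)

/-- Brackets of related fields are related. -/
theorem mfderiv_mlieBracket {m : ℕ} {N : Type*} [TopologicalSpace N] [ChartedSpace (Euc m) N]
    [IsManifold (𝓡 m) ∞ N] {φ : M → N} {p : M} (hφ : ContMDiffAt (𝓡 n) (𝓡 m) ∞ φ p)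
    {V W : Π x : M, TangentSpace (𝓡 n) x} {V' W' : Π y : N, TangentSpace (𝓡 m) y}
    (hV : SmoothFieldAt V p) (hW : SmoothFieldAt W p)
    (hV' : SmoothFieldAt V' (φ p)) (hW' : SmoothFieldAt W' (φ p))
    (hVV' : ∀ᶠ q in nhds p, mfderiv (𝓡 n) (𝓡 m) φ q (V q) = V' (φ q))
    (hWW' : ∀ᶠ q in nhds p, mfderiv (𝓡 n) (𝓡 m) φ q (W q) = W' (φ q)) :
    mfderiv (𝓡 n) (𝓡 m) φ p (VectorField.mlieBracket (𝓡 n) V W p)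
      = VectorField.mlieBracket (𝓡 m) V' W' (φ p) := by
  -- A tangent vector is determined by its action on one vector-valued function, the chart at `φ p`.
  -- On such functions both brackets are commutators, and relatedness says V(f∘φ) = (V'f)∘φ.
  let f := extChartAt (𝓡 m) (φ p)
  have hf : ContMDiffAt (𝓡 m) 𝓘(ℝ, Euc m) ∞ f (φ p) := contMDiffAt_extChartAt
  have hinj : Function.Injective (mvfderiv (𝓡 m) f (φ p)) := by
    obtain ⟨L, hL⟩ := isInvertible_mfderiv_extChartAt (I := 𝓡 m)
      (mem_extChartAt_source (I := 𝓡 m) (φ p))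
    change Function.Injective (mfderiv (𝓡 m) 𝓘(ℝ, Euc m) (extChartAt (𝓡 m) (φ p)) (φ p))
    rw [← hL]
    exact L.injective
  apply hinj
  have key : ∀ {V W : Π x : M, TangentSpace (𝓡 n) x} {V' W' : Π y : N, TangentSpace (𝓡 m) y},
      SmoothFieldAt W' (φ p) →
      (∀ᶠ q in nhds p, mfderiv (𝓡 n) (𝓡 m) φ q (V q) = V' (φ q)) →
      (∀ᶠ q in nhds p, mfderiv (𝓡 n) (𝓡 m) φ q (W q) = W' (φ q)) →
      mvfderiv (𝓡 n) (fun q => mvfderiv (𝓡 n) (fun r => f (φ r)) q (W q)) p (V p)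
        = mvfderiv (𝓡 m) (fun y => mvfderiv (𝓡 m) f y (W' y)) (φ p) (V' (φ p)) := by
    intro V W V' W' hW' hV hW
    have e : (fun q => mvfderiv (𝓡 n) (fun r => f (φ r)) q (W q)) =ᶠ[nhds p]
        fun q => (fun y => mvfderiv (𝓡 m) f y (W' y)) (φ q) := by
      filter_upwards [hW, hφ.eventually_mdifferentiableAt,
        hφ.continuousAt.eventually hf.eventually_mdifferentiableAt] with q hq hφq hfq
      rw [mvfderiv_comp_mfderiv hfq hφq, hq]
    rw [mvfderiv_congr e, mvfderiv_comp_mfderiv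
      ((hW'.mvfderiv_apply hf).mdifferentiableAt (by simp)) (hφ.mdifferentiableAt (by simp)),
      hV.self_of_nhds]
  rw [mvfderiv_mlieBracket hf hV' hW', ← key hW' hVV' hWW', ← key hV' hWW' hVV',
    ← mvfderiv_comp_mfderiv (hf.mdifferentiableAt (by simp)) (hφ.mdifferentiableAt (by simp)),
    mvfderiv_mlieBracket (f := fun r => f (φ r)) (hf.comp p hφ) hV hW]

end Bracket

/-! ### The Levi-Civita connection on fields and one-forms -/

section LeviCivita

variable {n : ℕ} {M : Type*} [TopologicalSpace M] [ChartedSpace (Euc n) M]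
  [IsManifold (𝓡 n) ∞ M]

/-- The vector field `X` is differentiable at `x`. -/
abbrev DiffFieldAt (X : Π x : M, TangentSpace (𝓡 n) x) (x : M) : Prop :=
  MDifferentiableAt (𝓡 n) ((𝓡 n).prod (𝓡 n))
    (fun y => TotalSpace.mk' (Euc n) (E := (TangentSpace (𝓡 n) : M → Type _)) y (X y)) x

variable (D : CovariantDerivative (𝓡 n) (Euc n) (TangentSpace (𝓡 n) : M → Type _))

theorem covariantDerivative_add {X Y : Π x : M, TangentSpace (𝓡 n) x} {x : M}
    (hX : DiffFieldAt X x) (hY : DiffFieldAt Y x) (v : TangentSpace (𝓡 n) x) :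
    D (fun y => X y + Y y) x v = D X x v + D Y x v := by
  have := D.isCovariantDerivativeOn.add (s := Set.univ) hX hY
  exact congrArg (fun L => L v) this

theorem covariantDerivative_smul {f : M → ℝ} {X : Π x : M, TangentSpace (𝓡 n) x} {x : M}
    (hf : MDifferentiableAt (𝓡 n) 𝓘(ℝ) f x) (hX : DiffFieldAt X x) (v : TangentSpace (𝓡 n) x) :
    D (fun y => f y • X y) x v = f x • D X x v + mvfderiv (𝓡 n) f x v • X x := by
  have := D.isCovariantDerivativeOn.leibniz (s := Set.univ) hX hf
  exact congrArg (fun L => L v) this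

theorem covariantDerivative_congr {X Y : Π x : M, TangentSpace (𝓡 n) x} {x : M}
    (hX : DiffFieldAt X x) (h : ∀ᶠ y in nhds x, Y y = X y) (v : TangentSpace (𝓡 n) x) :
    D Y x v = D X x v := by
  have hY : DiffFieldAt Y x := hX.congr_of_eventuallyEq (h.mono fun y hy => by simp [hy])
  have := D.isCovariantDerivativeOn.congr_of_eventuallyEq (s := Set.univ) hY hX
    Filter.univ_mem h
  rw [this]

variable [RiemannianBundle (fun x : M => TangentSpace (𝓡 n) x)]
  [IsContMDiffRiemannianBundle (𝓡 n) ∞ (Euc n) (fun x : M => TangentSpace (𝓡 n) x)]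

variable {D}

theorem IsLeviCivita.sub_eq_mlieBracket (hD : IsLeviCivita D)
    {X Y : Π x : M, TangentSpace (𝓡 n) x} {x : M}
    (hX : DiffFieldAt X x) (hY : DiffFieldAt Y x) :
    D Y x (X x) - D X x (Y x) = VectorField.mlieBracket (𝓡 n) X Y x :=
  D.torsion_eq_zero_iff.1 hD.1 hX hY

theorem IsLeviCivita.mvfderiv_inner (hD : IsLeviCivita D)
    {X Y : Π x : M, TangentSpace (𝓡 n) x} {x : M}
    (hX : DiffFieldAt X x) (hY : DiffFieldAt Y x) (v : TangentSpace (𝓡 n) x) :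
    mvfderiv (𝓡 n) (fun y => (inner ℝ (X y) (Y y) : ℝ)) x v
      = inner ℝ (D X x v) (Y x) + inner ℝ (X x) (D Y x v) := by
  have := isContMDiffRiemannianBundle_one (n := n) (M := M)
  obtain ⟨V, rfl, -⟩ := exists_smoothField x v
  exact hD.2.mvfderiv_inner_eq V hX hY

/-- Metric compatibility cancels the derivative of the auxiliary extension, so derivatives of
one-forms reduce to derivatives of fields. -/
theorem IsLeviCivita.covDerivForm_flat (hD : IsLeviCivita D)
    {A : Π x : M, TangentSpace (𝓡 n) x} {x : M} (hA : DiffFieldAt A x)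
    (v : TangentSpace (𝓡 n) x) :
    covDerivForm D (fun y => flat (A y)) x v = flat (D A x v) := by
  have h : ∀ i, mvfderiv (𝓡 n) (fun y => flat (A y) (FiberBundle.extend (Euc n) (onb x i) y)) x v
      - flat (A x) (D (FiberBundle.extend (Euc n) (onb x i)) x v)
      = inner ℝ (onb x i) (D A x v) := by
    intro i
    simp only [flat_apply]
    rw [hD.mvfderiv_inner hA (FiberBundle.mdifferentiableAt_extend ..),
      FiberBundle.extend_apply_self, real_inner_comm]
    ring
  simp only [covDerivForm, h]
  conv_rhs => rw [← (onb x).sum_repr' (D A x v)]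
  rw [flat_sum]
  simp only [flat_smul]

/-- The bracket in the definition of the exterior derivative is replaced, by vanishing torsion, with
derivatives of the two extensions; these cancel against those from metric compatibility. -/
theorem IsLeviCivita.extDerivForm_flat (hD : IsLeviCivita D)
    {A : Π x : M, TangentSpace (𝓡 n) x} {x : M} (hA : DiffFieldAt A x)
    (u v : TangentSpace (𝓡 n) x) :
    extDerivForm (fun y => flat (A y)) x u v = inner ℝ (D A x u) v - inner ℝ (D A x v) u := by
  simp only [extDerivForm, flat_apply]
  rw [hD.mvfderiv_inner hA (FiberBundle.mdifferentiableAt_extend ..),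
    hD.mvfderiv_inner hA (FiberBundle.mdifferentiableAt_extend ..),
    ← hD.sub_eq_mlieBracket (FiberBundle.mdifferentiableAt_extend ..)
      (FiberBundle.mdifferentiableAt_extend ..)]
  simp only [FiberBundle.extend_apply_self, inner_sub_right]
  ring

theorem IsOrthonormalFrameNear.inner_covariantDerivative {x : M}
    {e : Fin n → Π x : M, TangentSpace (𝓡 n) x} (he : IsOrthonormalFrameNear e x)
    (hD : IsLeviCivita D) (i j : Fin n) (v : TangentSpace (𝓡 n) x) :
    inner ℝ (D (e i) x v) (e j x) = -(inner ℝ (D (e j) x v) (e i x) : ℝ) := by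
  have h := hD.mvfderiv_inner (he.self_of_nhds.1 i).mdifferentiableAt
    (he.self_of_nhds.1 j).mdifferentiableAt v
  have h0 : mvfderiv (𝓡 n) (fun y => (inner ℝ (e i y) (e j y) : ℝ)) x v = 0 := by
    rw [mvfderiv_congr (g := fun _ => if i = j then (1 : ℝ) else 0)
      (he.mono fun y hy => hy.2 i j), mvfderiv_const]
    rfl
  rw [h0, real_inner_comm (D (e j) x v)] at h
  linarith

end LeviCivita

/-! ### Traces in orthonormal bases -/

section Trace

variable {E F : Type*} [NormedAddCommGroup E] [InnerProductSpace ℝ E] [AddCommGroup F]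
  [Module ℝ F]

/-- The trace of a bilinear map does not depend on the orthonormal basis. -/
theorem OrthonormalBasis.sum_apply_self_eq {ι κ : Type*} [Fintype ι] [Fintype κ]
    (a : OrthonormalBasis ι ℝ E) (b : OrthonormalBasis κ ℝ E) (T : E → E → F)
    (hal : ∀ x y z, T (x + y) z = T x z + T y z) (hsl : ∀ (r : ℝ) x z, T (r • x) z = r • T x z)
    (har : ∀ x y z, T x (y + z) = T x y + T x z) (hsr : ∀ (r : ℝ) x z, T x (r • z) = r • T x z) :
    ∑ i, T (a i) (a i) = ∑ j, T (b j) (b j) := by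
  classical
  let B : E →ₗ[ℝ] E →ₗ[ℝ] F := LinearMap.mk₂ ℝ T hal hsl har hsr
  change ∑ i, B (a i) (a i) = ∑ j, B (b j) (b j)
  have h1 : ∀ i, B (a i) (a i) = ∑ j, ∑ k, (inner ℝ (b j) (a i) * inner ℝ (a i) (b k) : ℝ) •
      B (b j) (b k) := by
    intro i
    conv_lhs => rw [← b.sum_repr' (a i)]
    simp only [map_sum, LinearMap.sum_apply, map_smul, LinearMap.smul_apply, Finset.smul_sum,
      smul_smul]
    rw [Finset.sum_comm]
    refine Finset.sum_congr rfl fun j _ => Finset.sum_congr rfl fun k _ => ?_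
    rw [real_inner_comm (b k), mul_comm]
  simp only [h1]
  rw [Finset.sum_comm]
  refine Finset.sum_congr rfl fun j _ => ?_
  rw [Finset.sum_comm]
  simp only [← Finset.sum_smul, a.sum_inner_mul_inner, orthonormal_iff_ite.1 b.orthonormal]
  simp

end Trace

/-! ### Volume form and Hodge star in an oriented basis -/

section Volume

variable {M : Type*} [TopologicalSpace M]

theorem volForm_eq_det {n : ℕ} [ChartedSpace (Euc n) M] [IsManifold (𝓡 n) ∞ M]
    [RiemannianBundle (fun x : M => TangentSpace (𝓡 n) x)] (o : ManifoldOrientation n M) {x : M}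
    {b : OrthonormalBasis (Fin n) ℝ (TangentSpace (𝓡 n) x)}
    (hb : b.toBasis.orientation = o.orient x) (v : Fin n → TangentSpace (𝓡 n) x) :
    volForm o x v = Matrix.det (Matrix.of fun i j => (inner ℝ (b i) (v j) : ℝ)) := by
  have h : volForm o x = b.toBasis.det := Orientation.volumeForm_robust _ _ hb
  rw [h, Module.Basis.det_apply]
  congr 1
  ext i j
  simp [Module.Basis.toMatrix_apply, OrthonormalBasis.repr_apply_apply]

theorem volForm_two [ChartedSpace (Euc 2) M] [IsManifold (𝓡 2) ∞ M]
    [RiemannianBundle (fun x : M => TangentSpace (𝓡 2) x)] (o : ManifoldOrientation 2 M) {x : M}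
    {b : OrthonormalBasis (Fin 2) ℝ (TangentSpace (𝓡 2) x)}
    (hb : b.toBasis.orientation = o.orient x) (u v : TangentSpace (𝓡 2) x) :
    volForm o x ![u, v]
      = inner ℝ (b 0) u * inner ℝ (b 1) v - inner ℝ (b 0) v * inner ℝ (b 1) u := by
  rw [volForm_eq_det o hb, Matrix.det_fin_two]
  simp

variable [ChartedSpace (Euc 3) M] [IsManifold (𝓡 3) ∞ M]
  [RiemannianBundle (fun x : M => TangentSpace (𝓡 3) x)]

theorem volForm_three (o : ManifoldOrientation 3 M) {x : M}
    {b : OrthonormalBasis (Fin 3) ℝ (TangentSpace (𝓡 3) x)}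
    (hb : b.toBasis.orientation = o.orient x) (u v w : TangentSpace (𝓡 3) x) :
    volForm o x ![u, v, w]
      = inner ℝ (b 0) u * (inner ℝ (b 1) v * inner ℝ (b 2) w - inner ℝ (b 1) w * inner ℝ (b 2) v)
      - inner ℝ (b 0) v * (inner ℝ (b 1) u * inner ℝ (b 2) w - inner ℝ (b 1) w * inner ℝ (b 2) u)
      + inner ℝ (b 0) w * (inner ℝ (b 1) u * inner ℝ (b 2) v - inner ℝ (b 1) v * inner ℝ (b 2) u)
      := by
  rw [volForm_eq_det o hb, Matrix.det_fin_three]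
  simp
  ring

/-- The Hodge star of an alternating form in an oriented orthonormal basis. -/
theorem hodgeTwoForm_eq (o : ManifoldOrientation 3 M) {x : M}
    {b : OrthonormalBasis (Fin 3) ℝ (TangentSpace (𝓡 3) x)}
    (hb : b.toBasis.orientation = o.orient x)
    (β : TangentSpace (𝓡 3) x → TangentSpace (𝓡 3) x → ℝ)
    (hadd : ∀ u v w, β (u + v) w = β u w + β v w) (hsmul : ∀ (r : ℝ) u w, β (r • u) w = r * β u w)
    (halt : ∀ u v, β v u = -β u v) :
    hodgeTwoForm o x β
      = flat (β (b 1) (b 2) • b 0 + β (b 2) (b 0) • b 1 + β (b 0) (b 1) • b 2) := by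
  have hadd' : ∀ u v w, β u (v + w) = β u v + β u w := fun u v w => by
    rw [halt, hadd, halt u v, halt u w]; ring
  have hsmul' : ∀ (r : ℝ) u w, β u (r • w) = r * β u w := fun r u w => by
    rw [halt, hsmul, halt u w]; ring
  have e0 : hodgeTwoForm o x β = ∑ k, ∑ i, ∑ j, ((1 / 2 : ℝ) *
      (volForm o x ![onb x k, onb x i, onb x j] * β (onb x i) (onb x j))) • flat (onb x k) := by
    simp only [hodgeTwoForm, Finset.mul_sum, Finset.sum_smul]
  -- The three summation indices are exchanged one at a time: each occurs twice and bilinearly, so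
  -- each sum is a trace and may be taken in the basis `b`.
  have e1 : ∀ u v : TangentSpace (𝓡 3) x, ∑ k, ((1 / 2 : ℝ) *
      (volForm o x ![onb x k, u, v] * β u v)) • flat (onb x k)
      = ∑ k, ((1 / 2 : ℝ) * (volForm o x ![b k, u, v] * β u v)) • flat (b k) := by
    intro u v
    refine OrthonormalBasis.sum_apply_self_eq (onb x) b
      (fun y z => ((1 / 2 : ℝ) * (volForm o x ![y, u, v] * β u v)) • flat z) ?_ ?_ ?_ ?_ <;>
    intros <;>
    simp only [volForm_three o hb, inner_add_right, inner_smul_right, flat_add, flat_smul] <;>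
    module
  have e2 : ∀ k, ∀ u : TangentSpace (𝓡 3) x, ∑ i, ((1 / 2 : ℝ) *
      (volForm o x ![b k, onb x i, u] * β (onb x i) u)) • flat (b k)
      = ∑ i, ((1 / 2 : ℝ) * (volForm o x ![b k, b i, u] * β (b i) u)) • flat (b k) := by
    intro k u
    refine OrthonormalBasis.sum_apply_self_eq (onb x) b
      (fun y z => ((1 / 2 : ℝ) * (volForm o x ![b k, y, u] * β z u)) • flat (b k)) ?_ ?_ ?_ ?_ <;>
    intros <;>
    simp only [volForm_three o hb, inner_add_right, inner_smul_right, hadd, hsmul] <;>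
    module
  have e3 : ∀ k, ∀ u : TangentSpace (𝓡 3) x, ∑ i, ((1 / 2 : ℝ) *
      (volForm o x ![b k, u, onb x i] * β u (onb x i))) • flat (b k)
      = ∑ i, ((1 / 2 : ℝ) * (volForm o x ![b k, u, b i] * β u (b i))) • flat (b k) := by
    intro k u
    refine OrthonormalBasis.sum_apply_self_eq (onb x) b
      (fun y z => ((1 / 2 : ℝ) * (volForm o x ![b k, u, y] * β u z)) • flat (b k)) ?_ ?_ ?_ ?_ <;>
    intros <;>
    simp only [volForm_three o hb, inner_add_right, inner_smul_right, hadd', hsmul'] <;>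
    module
  have e4 : hodgeTwoForm o x β = ∑ k, ∑ i, ∑ j, ((1 / 2 : ℝ) *
      (volForm o x ![b k, b i, b j] * β (b i) (b j))) • flat (b k) := by
    rw [e0, Finset.sum_comm]
    simp_rw [fun i => Finset.sum_comm (s := Finset.univ) (t := Finset.univ)
      (f := fun k j => ((1 / 2 : ℝ) * (volForm o x ![onb x k, onb x i, onb x j]
        * β (onb x i) (onb x j))) • flat (onb x k)), e1]
    simp_rw [fun i => Finset.sum_comm (s := Finset.univ) (t := Finset.univ)
      (f := fun j k => ((1 / 2 : ℝ) * (volForm o x ![b k, onb x i, onb x j]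
        * β (onb x i) (onb x j))) • flat (b k)), e3]
    rw [Finset.sum_comm]
    refine Finset.sum_congr rfl fun k _ => ?_
    rw [Finset.sum_comm]
    simp_rw [e2]
    rw [Finset.sum_comm]
  rw [e4]
  have hself : ∀ i, β (b i) (b i) = 0 := fun i => by have := halt (b i) (b i); linarith
  simp only [Fin.sum_univ_three, volForm_three o hb, orthonormal_iff_ite.1 b.orthonormal, hself,
    flat_add, flat_smul, halt (b 0) (b 1), halt (b 0) (b 2), halt (b 1) (b 2)]
  simp
  module

end Volume

/-! ### Horizontal lifts and adapted frames -/

section Submersion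

variable {M : Type*} [TopologicalSpace M] [ChartedSpace (Euc 3) M]
  {N : Type*} [TopologicalSpace N] [ChartedSpace (Euc 2) N]
  [RiemannianBundle (fun x : M => TangentSpace (𝓡 3) x)]
  [RiemannianBundle (fun y : N => TangentSpace (𝓡 2) y)]
  {φ : C^∞⟮𝓡 3, M; 𝓡 2, N⟯}

/-- The horizontal lift of a tangent vector of the base. -/
noncomputable def horizontalLift (φ : C^∞⟮𝓡 3, M; 𝓡 2, N⟯) (p : M)
    (w : TangentSpace (𝓡 2) (φ p)) : TangentSpace (𝓡 3) p :=
  sharp ((flat w).comp (diff φ p))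

theorem inner_horizontalLift (p : M) (w : TangentSpace (𝓡 2) (φ p)) (u : TangentSpace (𝓡 3) p) :
    inner ℝ (horizontalLift φ p w) u = (inner ℝ w (diff φ p u) : ℝ) := by
  rw [horizontalLift, inner_sharp]
  rfl

/-- The horizontal lift is the adjoint of the differential, and a surjective partial isometry
composed with its adjoint is the identity. The preimage of `w` orthogonal to the kernel is shown to
be the adjoint's value. -/
theorem IsRiemannianSubmersion.diff_horizontalLift (hφ : IsRiemannianSubmersion φ) (p : M)
    (w : TangentSpace (𝓡 2) (φ p)) : diff φ p (horizontalLift φ p w) = w := by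
  let K : Submodule ℝ (TangentSpace (𝓡 3) p) := LinearMap.ker (diff φ p).toLinearMap
  have hK : ∀ u ∈ K, diff φ p u = 0 := fun u hu => hu
  have hK' : ∀ u ∈ Kᗮ, ∀ w, diff φ p w = 0 → (inner ℝ u w : ℝ) = 0 := fun u hu w hw => by
    rw [real_inner_comm]; exact hu w hw
  have hdec : ∀ u : TangentSpace (𝓡 3) p, ∃ v ∈ Kᗮ, diff φ p v = diff φ p u ∧
      ∃ k ∈ K, u = v + k := by
    intro u
    obtain ⟨k, hk, v, hv, h⟩ := K.exists_add_mem_mem_orthogonal u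
    refine ⟨v, hv, ?_, k, hk, by rw [h, add_comm]⟩
    rw [h, map_add, hK k hk, zero_add]
  obtain ⟨u, hu⟩ := hφ.surjective p w
  obtain ⟨v, hv, hvu, -⟩ := hdec u
  have : horizontalLift φ p w = v := by
    refine ext_inner_right ℝ fun z => ?_
    rw [inner_horizontalLift]
    obtain ⟨z', hz', hzz, k, hk, rfl⟩ := hdec z
    rw [← hzz, inner_add_right, hK' v hv k (hK k hk), add_zero, ← hu, ← hvu]
    exact hφ.isometry p v z' (hK' v hv) (hK' z' hz')
  rw [this, hvu, hu]

variable [IsManifold (𝓡 3) ∞ M] [IsManifold (𝓡 2) ∞ N]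
  [IsContMDiffRiemannianBundle (𝓡 3) ∞ (Euc 3) (fun x : M => TangentSpace (𝓡 3) x)]
  [IsContMDiffRiemannianBundle (𝓡 2) ∞ (Euc 2) (fun y : N => TangentSpace (𝓡 2) y)]

/-- In a smooth orthonormal frame the components of the lift are the inner products ⟨f∘φ, φ_*E_i⟩,
taken in the pulled-back tangent bundle of `N`. -/
theorem SmoothFieldAt.horizontalLift {p : M} {f : Π y : N, TangentSpace (𝓡 2) y}
    (hf : SmoothFieldAt f (φ p)) : SmoothFieldAt (fun q => horizontalLift φ q (f (φ q))) p := by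
  obtain ⟨E, -, hE⟩ := exists_orthonormalFrame (onb (n := 3) p)
  refine hE.smoothFieldAt fun i => ?_
  have h1 : ContMDiffAt (𝓡 3) ((𝓡 2).prod (𝓡 2)) ∞ (fun q => TotalSpace.mk' (Euc 2)
      (E := (TangentSpace (𝓡 2) : N → Type _)) (φ q) (f (φ q))) p :=
    ContMDiffAt.comp p hf φ.contMDiff.contMDiffAt
  have h2 : ContMDiffAt (𝓡 3) ((𝓡 2).prod (𝓡 2)) ∞ (fun q => TotalSpace.mk' (Euc 2)
      (E := (TangentSpace (𝓡 2) : N → Type _)) (φ q) (diff φ q (E i q))) p :=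
    ContMDiffAt.comp p (φ.contMDiff.contMDiff_tangentMap (m := ∞) (by simp)).contMDiffAt
      (hE.self_of_nhds.1 i)
  refine (ContMDiffAt.inner_bundle (b := φ) h1 h2).congr_of_eventuallyEq
    (Filter.Eventually.of_forall fun q => ?_)
  exact (real_inner_comm _ _).trans (inner_horizontalLift q (f (φ q)) (E i q))

/-- Oriented orthonormal frames `f` of `N` near `φ p` and `e` of `M` near `p` such that `e 0`, `e 1`
are the horizontal lifts of `f 0`, `f 1` and `e 2` is vertical. -/
structure IsAdaptedFrame (oM : ManifoldOrientation 3 M) (oN : ManifoldOrientation 2 N)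
    (φ : C^∞⟮𝓡 3, M; 𝓡 2, N⟯) (f : Fin 2 → Π y : N, TangentSpace (𝓡 2) y)
    (e : Fin 3 → Π p : M, TangentSpace (𝓡 3) p) (p : M) : Prop where
  base : IsOrientedFrameNear oN f (φ p)
  total : IsOrientedFrameNear oM e p
  lift_zero : ∀ᶠ q in nhds p, diff φ q (e 0 q) = f 0 (φ q)
  lift_one : ∀ᶠ q in nhds p, diff φ q (e 1 q) = f 1 (φ q)
  vertical : ∀ᶠ q in nhds p, diff φ q (e 2 q) = 0

theorem IsAdaptedFrame.eventually {oM : ManifoldOrientation 3 M} {oN : ManifoldOrientation 2 N}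
    {f : Fin 2 → Π y : N, TangentSpace (𝓡 2) y} {e : Fin 3 → Π p : M, TangentSpace (𝓡 3) p}
    {p : M} (h : IsAdaptedFrame oM oN φ f e p) :
    ∀ᶠ q in nhds p, IsAdaptedFrame oM oN φ f e q := by
  filter_upwards [φ.contMDiff.continuous.continuousAt.eventually (eventually_eventually_nhds.2
    h.base), eventually_eventually_nhds.2 h.total, eventually_eventually_nhds.2 h.lift_zero,
    eventually_eventually_nhds.2 h.lift_one, eventually_eventually_nhds.2 h.vertical]
    with q h1 h2 h3 h4 h5
  exact ⟨h1, h2, h3, h4, h5⟩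

/-- Two orthonormal vectors are completed to an oriented orthonormal basis. -/
theorem exists_orientedBasis_extending (oM : ManifoldOrientation 3 M) (p : M)
    {u v : TangentSpace (𝓡 3) p} (hu : inner ℝ u u = (1 : ℝ)) (hv : inner ℝ v v = (1 : ℝ))
    (huv : inner ℝ u v = (0 : ℝ)) :
    ∃ b : OrthonormalBasis (Fin 3) ℝ (TangentSpace (𝓡 3) p), b 0 = u ∧ b 1 = v ∧
      b.toBasis.orientation = oM.orient p := by
  have hvu : inner ℝ v u = (0 : ℝ) := by rw [real_inner_comm]; exact huv
  obtain ⟨b, hb⟩ := Orthonormal.exists_orthonormalBasis_extension_of_card_eq (𝕜 := ℝ)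
    (E := TangentSpace (𝓡 3) p) (ι := Fin 3) (by rw [finrank_tangentSpace_eq, Fintype.card_fin])
    (v := ![u, v, 0]) (s := {0, 1}) (by
      rw [orthonormal_iff_ite]
      rintro ⟨i, hi⟩ ⟨j, hj⟩
      simp only [Set.mem_insert_iff, Set.mem_singleton_iff] at hi hj
      rcases hi with rfl | rfl <;> rcases hj with rfl | rfl <;>
        simp [hu, hv, huv, hvu, -inner_self_eq_norm_sq_to_K])
  have hb0 : b 0 = u := by simpa using hb 0 (by simp)
  have hb1 : b 1 = v := by simpa using hb 1 (by simp)
  by_cases ho : b.toBasis.orientation = oM.orient p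
  · exact ⟨b, hb0, hb1, ho⟩
  have hon := orthonormal_iff_ite.1 b.orthonormal
  -- In the wrong orientation the third vector is reversed, which keeps the prescribed two and
  -- changes the determinant to -1.
  obtain ⟨b', hb'⟩ := exists_orthonormalBasis_of_inner (v := ![b 0, b 1, -b 2]) (by
    intro i j
    fin_cases i <;> fin_cases j <;> simp [hon, -inner_self_eq_norm_sq_to_K])
  refine ⟨b', by simpa [hb0] using hb' 0, by simpa [hb1] using hb' 1, ?_⟩
  have hdet : b.toBasis.det b'.toBasis = -1 := by
    rw [Module.Basis.det_apply, Matrix.det_fin_three]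
    simp [Module.Basis.toMatrix_apply, hb', -inner_self_eq_norm_sq_to_K]
  have h2 : b.toBasis.orientation ≠ b'.toBasis.orientation := fun h => by
    rw [Module.Basis.orientation_eq_iff_det_pos, hdet] at h
    norm_num at h
  rcases Module.Basis.orientation_eq_or_eq_neg b.toBasis (oM.orient p) with h | h
  · exact absurd h.symm ho
  · rcases Module.Basis.orientation_eq_or_eq_neg b.toBasis b'.toBasis.orientation with h' | h'
    · exact absurd h'.symm h2
    · rw [h, h']

theorem IsRiemannianSubmersion.exists_adaptedFrame (hφ : IsRiemannianSubmersion φ)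
    (oM : ManifoldOrientation 3 M) (oN : ManifoldOrientation 2 N) (p : M) :
    ∃ f e, IsAdaptedFrame oM oN φ f e p := by
  obtain ⟨f, hf⟩ := exists_orientedFrame oN (φ p)
  have hfo := hf.isOrthonormalFrameNear
  let E : Fin 2 → Π q : M, TangentSpace (𝓡 3) q := fun a q => horizontalLift φ q (f a (φ q))
  have hfφ : ∀ᶠ q in nhds p, (∀ i, SmoothFieldAt (f i) (φ q)) ∧
      ∀ i j, inner ℝ (f i (φ q)) (f j (φ q)) = if i = j then (1 : ℝ) else 0 :=
    φ.contMDiff.continuous.continuousAt.eventually hfo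
  have hE : ∀ᶠ q in nhds p, (∀ i, SmoothFieldAt (E i) q) ∧
      ∀ i j, inner ℝ (E i q) (E j q) = if i = j then (1 : ℝ) else 0 := by
    filter_upwards [hfφ] with q hq
    refine ⟨fun i => (hq.1 i).horizontalLift, fun i j => ?_⟩
    rw [inner_horizontalLift, hφ.diff_horizontalLift, hq.2]
  have hEp := hE.self_of_nhds.2
  obtain ⟨b, hb0, hb1, hbo⟩ := exists_orientedBasis_extending oM p (u := E 0 p) (v := E 1 p)
    (by simpa using! hEp 0 0) (by simpa using! hEp 1 1) (by simpa using! hEp 0 1)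
  have hon := orthonormal_iff_ite.1 b.orthonormal
  obtain ⟨Z, hZp, hZ⟩ := exists_unit_extension hE (v := b 2) (by rw [hon]; simp) (by
    intro i
    fin_cases i
    · change inner ℝ (E 0 p) (b 2) = (0 : ℝ)
      rw [← hb0, hon]; simp
    · change inner ℝ (E 1 p) (b 2) = (0 : ℝ)
      rw [← hb1, hon]; simp)
  have hframe : IsOrthonormalFrameNear (n := 3) ![E 0, E 1, Z] p := by
    filter_upwards [hE, hZ] with q hq hZq
    have hZ' : ∀ i, inner ℝ (Z q) (E i q) = (0 : ℝ) := fun i => by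
      rw [real_inner_comm]; exact hZq.2.2 i
    refine ⟨fun i => ?_, fun i j => ?_⟩
    · fin_cases i
      exacts [hq.1 0, hq.1 1, hZq.1]
    · fin_cases i <;> fin_cases j
      · exact hq.2 0 0
      · exact hq.2 0 1
      · exact hZq.2.2 0
      · exact hq.2 1 0
      · exact hq.2 1 1
      · exact hZq.2.2 1
      · exact hZ' 0
      · exact hZ' 1
      · exact hZq.2.1
  refine ⟨f, ![E 0, E 1, Z], hf, hframe.isOrientedFrameNear oM (b := b) ?_ hbo, ?_, ?_, ?_⟩
  · intro i
    fin_cases i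
    exacts [hb0, hb1, hZp.symm]
  · exact Filter.Eventually.of_forall fun q => hφ.diff_horizontalLift q _
  · exact Filter.Eventually.of_forall fun q => hφ.diff_horizontalLift q _
  · filter_upwards [hZ, hfφ] with q hZq hq
    obtain ⟨c, hc⟩ := exists_orthonormalBasis_of_inner hq.2
    -- By adjointness ⟨f_i, φ_*Z⟩ = ⟨E_i, Z⟩ = 0, so every component of φ_*Z vanishes.
    change diff φ q (Z q) = 0
    rw [← c.sum_repr' (diff φ q (Z q))]
    refine Finset.sum_eq_zero fun i _ => ?_
    rw [hc, ← inner_horizontalLift, hZq.2.2 i, zero_smul]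

/-- The pullback of the area form is 1 on (e₀, e₁) and 0 on every pair containing the vertical
vector, so its Hodge star is dual to e₂. -/
theorem IsAdaptedFrame.nuForm_eq {oM : ManifoldOrientation 3 M} {oN : ManifoldOrientation 2 N}
    {f : Fin 2 → Π y : N, TangentSpace (𝓡 2) y} {e : Fin 3 → Π p : M, TangentSpace (𝓡 3) p}
    {p : M} (h : IsAdaptedFrame oM oN φ f e p) : nuForm oM oN φ p = flat (e 2 p) := by
  obtain ⟨-, b, hb, hbo⟩ := h.total.self_of_nhds
  obtain ⟨-, c, hc, hco⟩ := h.base.self_of_nhds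
  have hon := orthonormal_iff_ite.1 c.orthonormal
  rw [nuForm, hodgeTwoForm_eq oM hbo]
  · simp only [hb, h.lift_zero.self_of_nhds, h.lift_one.self_of_nhds, h.vertical.self_of_nhds,
      ← hc, volForm_two oN hco, hon]
    simp
  · intro u v w
    simp only [volForm_two oN hco, map_add, inner_add_right]
    ring
  · intro r u w
    simp only [volForm_two oN hco, map_smul, inner_smul_right]
    ring
  · intro u v
    simp only [volForm_two oN hco]
    ring

end Submersion

/-! ### The Levi-Civita connection in an adapted frame -/

section AdaptedGeometry

variable {M : Type*} [TopologicalSpace M] [ChartedSpace (Euc 3) M]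
  {N : Type*} [TopologicalSpace N] [ChartedSpace (Euc 2) N]
  [RiemannianBundle (fun x : M => TangentSpace (𝓡 3) x)]
  [RiemannianBundle (fun y : N => TangentSpace (𝓡 2) y)]
  {φ : C^∞⟮𝓡 3, M; 𝓡 2, N⟯}
  [IsManifold (𝓡 3) ∞ M] [IsManifold (𝓡 2) ∞ N]
  [IsContMDiffRiemannianBundle (𝓡 3) ∞ (Euc 3) (fun x : M => TangentSpace (𝓡 3) x)]
  [IsContMDiffRiemannianBundle (𝓡 2) ∞ (Euc 2) (fun y : N => TangentSpace (𝓡 2) y)]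
  {oM : ManifoldOrientation 3 M} {oN : ManifoldOrientation 2 N}
  {DM : CovariantDerivative (𝓡 3) (Euc 3) (TangentSpace (𝓡 3) : M → Type _)}
  {DN : CovariantDerivative (𝓡 2) (Euc 2) (TangentSpace (𝓡 2) : N → Type _)}
  {f : Fin 2 → Π y : N, TangentSpace (𝓡 2) y} {e : Fin 3 → Π p : M, TangentSpace (𝓡 3) p}
  {p : M}

/-- Twice the rotation of the vertical unit field along the horizontal plane. -/
noncomputable def twist (D : CovariantDerivative (𝓡 3) (Euc 3) (TangentSpace (𝓡 3) : M → Type _))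
    (e : Fin 3 → Π p : M, TangentSpace (𝓡 3) p) (p : M) : ℝ :=
  2 * inner ℝ (D (e 2) p (e 0 p)) (e 1 p)

/-- The components of the curvature vector of the fibers. -/
noncomputable def bend (D : CovariantDerivative (𝓡 3) (Euc 3) (TangentSpace (𝓡 3) : M → Type _))
    (e : Fin 3 → Π p : M, TangentSpace (𝓡 3) p) (i : Fin 3) (p : M) : ℝ :=
  inner ℝ (D (e 2) p (e 2 p)) (e i p)

namespace IsAdaptedFrame

theorem smooth_base (h : IsAdaptedFrame oM oN φ f e p) (i : Fin 2) : SmoothFieldAt (f i) (φ p) :=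
  h.base.self_of_nhds.1 i

theorem smooth_total (h : IsAdaptedFrame oM oN φ f e p) (i : Fin 3) : SmoothFieldAt (e i) p :=
  h.total.self_of_nhds.1 i

theorem inner_base (h : IsAdaptedFrame oM oN φ f e p) (i j : Fin 2) :
    inner ℝ (f i (φ p)) (f j (φ p)) = if i = j then (1 : ℝ) else 0 :=
  h.base.isOrthonormalFrameNear.self_of_nhds.2 i j

theorem inner_total (h : IsAdaptedFrame oM oN φ f e p) (i j : Fin 3) :
    inner ℝ (e i p) (e j p) = if i = j then (1 : ℝ) else 0 :=
  h.total.isOrthonormalFrameNear.self_of_nhds.2 i j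

theorem eq_sum_total (h : IsAdaptedFrame oM oN φ f e p) (u : TangentSpace (𝓡 3) p) :
    u = (inner ℝ (e 0 p) u : ℝ) • e 0 p + (inner ℝ (e 1 p) u : ℝ) • e 1 p
      + (inner ℝ (e 2 p) u : ℝ) • e 2 p := by
  obtain ⟨b, hb⟩ := exists_orthonormalBasis_of_inner h.inner_total
  have := b.sum_repr' u
  rw [Fin.sum_univ_three] at this
  simp only [hb] at this
  exact this.symm

theorem diff_eq (h : IsAdaptedFrame oM oN φ f e p) (u : TangentSpace (𝓡 3) p) :
    diff φ p u = (inner ℝ (e 0 p) u : ℝ) • f 0 (φ p) + (inner ℝ (e 1 p) u : ℝ) • f 1 (φ p) := by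
  conv_lhs => rw [h.eq_sum_total u]
  rw [map_add, map_add, map_smul, map_smul, map_smul, h.lift_zero.self_of_nhds,
    h.lift_one.self_of_nhds, h.vertical.self_of_nhds, smul_zero, add_zero]

theorem inner_base_diff_zero (h : IsAdaptedFrame oM oN φ f e p) (u : TangentSpace (𝓡 3) p) :
    inner ℝ (f 0 (φ p)) (diff φ p u) = (inner ℝ (e 0 p) u : ℝ) := by
  rw [h.diff_eq, inner_add_right, inner_smul_right, inner_smul_right, h.inner_base, h.inner_base]
  simp

theorem inner_base_diff_one (h : IsAdaptedFrame oM oN φ f e p) (u : TangentSpace (𝓡 3) p) :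
    inner ℝ (f 1 (φ p)) (diff φ p u) = (inner ℝ (e 1 p) u : ℝ) := by
  rw [h.diff_eq, inner_add_right, inner_smul_right, inner_smul_right, h.inner_base, h.inner_base]
  simp

theorem diff_bracket (h : IsAdaptedFrame oM oN φ f e p) :
    diff φ p (VectorField.mlieBracket (𝓡 3) (e 0) (e 1) p)
      = VectorField.mlieBracket (𝓡 2) (f 0) (f 1) (φ p) :=
  mfderiv_mlieBracket φ.contMDiff.contMDiffAt (h.smooth_total 0) (h.smooth_total 1)
    (h.smooth_base 0) (h.smooth_base 1) h.lift_zero h.lift_one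

/-- The vertical field is φ-related to the zero field, so its bracket with a lifted field is related
to zero. -/
theorem diff_bracket_vertical (h : IsAdaptedFrame oM oN φ f e p) {i : Fin 3} {j : Fin 2}
    (hij : ∀ᶠ q in nhds p, diff φ q (e i q) = f j (φ q)) :
    diff φ p (VectorField.mlieBracket (𝓡 3) (e i) (e 2) p) = 0 := by
  have := mfderiv_mlieBracket (W' := 0) φ.contMDiff.contMDiffAt (h.smooth_total i)
    (h.smooth_total 2) (h.smooth_base j) (contMDiff_zeroSection ℝ _).contMDiffAt hij h.vertical
  rw [VectorField.mlieBracket_zero_right] at this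
  exact this

theorem inner_self (h : IsAdaptedFrame oM oN φ f e p) (hM : IsLeviCivita DM) (i : Fin 3)
    (v : TangentSpace (𝓡 3) p) : inner ℝ (DM (e i) p v) (e i p) = (0 : ℝ) := by
  have := h.total.isOrthonormalFrameNear.inner_covariantDerivative hM i i v
  linarith

theorem inner_swap (h : IsAdaptedFrame oM oN φ f e p) (hM : IsLeviCivita DM) (i j : Fin 3)
    (v : TangentSpace (𝓡 3) p) :
    inner ℝ (DM (e i) p v) (e j p) = -(inner ℝ (DM (e j) p v) (e i p) : ℝ) :=
  h.total.isOrthonormalFrameNear.inner_covariantDerivative hM i j v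

theorem torsion (h : IsAdaptedFrame oM oN φ f e p) (hM : IsLeviCivita DM) (i j : Fin 3)
    (w : TangentSpace (𝓡 3) p) :
    (inner ℝ (DM (e j) p (e i p)) w : ℝ) - inner ℝ (DM (e i) p (e j p)) w
      = inner ℝ (VectorField.mlieBracket (𝓡 3) (e i) (e j) p) w := by
  rw [← inner_sub_left, hM.sub_eq_mlieBracket (h.smooth_total i).mdifferentiableAt
    (h.smooth_total j).mdifferentiableAt]

theorem inner_bracket_vertical (h : IsAdaptedFrame oM oN φ f e p) {i : Fin 3} (hi : i ≠ 2)
    {j : Fin 3} (hj : j ≠ 2) :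
    inner ℝ (VectorField.mlieBracket (𝓡 3) (e i) (e 2) p) (e j p) = (0 : ℝ) := by
  have h0 : diff φ p (VectorField.mlieBracket (𝓡 3) (e i) (e 2) p) = 0 := by
    fin_cases i
    · exact h.diff_bracket_vertical h.lift_zero
    · exact h.diff_bracket_vertical h.lift_one
    · exact absurd rfl hi
  rw [real_inner_comm]
  fin_cases j
  · change inner ℝ (e 0 p) _ = (0 : ℝ)
    rw [← h.inner_base_diff_zero, h0, inner_zero_right]
  · change inner ℝ (e 1 p) _ = (0 : ℝ)
    rw [← h.inner_base_diff_one, h0, inner_zero_right]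
  · exact absurd rfl hj

theorem inner_vertical_self (h : IsAdaptedFrame oM oN φ f e p) (hM : IsLeviCivita DM) {i : Fin 3}
    (hi : i ≠ 2) : inner ℝ (DM (e 2) p (e i p)) (e i p) = (0 : ℝ) := by
  have := h.torsion hM i 2 (e i p)
  rw [h.inner_bracket_vertical hi hi, h.inner_self hM] at this
  linarith

/-- Since [e₀, e₂] is vertical, e₀ rotates along e₂ at the rate at which e₂ rotates along e₀. This
is the source of the (c/2)ν correction to the connection form of the base. -/
theorem inner_vertical_one (h : IsAdaptedFrame oM oN φ f e p) (hM : IsLeviCivita DM) :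
    inner ℝ (DM (e 0) p (e 2 p)) (e 1 p) = twist DM e p / 2 := by
  have := h.torsion hM 0 2 (e 1 p)
  rw [h.inner_bracket_vertical (by decide) (by decide)] at this
  rw [twist]
  linarith

theorem inner_vertical_zero (h : IsAdaptedFrame oM oN φ f e p) (hM : IsLeviCivita DM) :
    inner ℝ (DM (e 2) p (e 1 p)) (e 0 p) = -(twist DM e p / 2) := by
  have := h.torsion hM 1 2 (e 0 p)
  rw [h.inner_bracket_vertical (by decide) (by decide), h.inner_swap hM 1 0] at this
  rw [← h.inner_vertical_one hM]
  linarith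

/-- Together with `bend_eq`, this expresses the coefficients by brackets of smooth fields. Their
smoothness then follows without a smoothness assumption on the connection. -/
theorem twist_eq (h : IsAdaptedFrame oM oN φ f e p) (hM : IsLeviCivita DM) :
    twist DM e p = -inner ℝ (VectorField.mlieBracket (𝓡 3) (e 0) (e 1) p) (e 2 p) := by
  rw [← h.torsion hM, h.inner_swap hM 1 2, h.inner_swap hM 0 2, h.inner_vertical_zero hM, twist]
  ring

theorem bend_eq (h : IsAdaptedFrame oM oN φ f e p) (hM : IsLeviCivita DM) (i : Fin 3) :
    bend DM e i p = inner ℝ (VectorField.mlieBracket (𝓡 3) (e i) (e 2) p) (e 2 p) := by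
  rw [← h.torsion hM, h.inner_self hM, h.inner_swap hM i 2, bend]
  ring

theorem contMDiffAt_twist (h : IsAdaptedFrame oM oN φ f e p) (hM : IsLeviCivita DM) :
    ContMDiffAt (𝓡 3) 𝓘(ℝ) ∞ (twist DM e) p :=
  ((((h.smooth_total 0).mlieBracket (h.smooth_total 1)).inner
    (h.smooth_total 2)).neg).congr_of_eventuallyEq
    (h.eventually.mono fun _ hq => hq.twist_eq hM)

theorem contMDiffAt_bend (h : IsAdaptedFrame oM oN φ f e p) (hM : IsLeviCivita DM) (i : Fin 3) :
    ContMDiffAt (𝓡 3) 𝓘(ℝ) ∞ (bend DM e i) p :=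
  (((h.smooth_total i).mlieBracket (h.smooth_total 2)).inner
    (h.smooth_total 2)).congr_of_eventuallyEq
    (h.eventually.mono fun _ hq => hq.bend_eq hM i)

theorem covariantDerivative_two (h : IsAdaptedFrame oM oN φ f e p) (hM : IsLeviCivita DM)
    (u : TangentSpace (𝓡 3) p) :
    DM (e 2) p u
      = (inner ℝ (e 2 p) u * bend DM e 0 p - inner ℝ (e 1 p) u * (twist DM e p / 2) : ℝ) • e 0 p
      + (inner ℝ (e 2 p) u * bend DM e 1 p + inner ℝ (e 0 p) u * (twist DM e p / 2) : ℝ)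
        • e 1 p := by
  have hc : inner ℝ (DM (e 2) p (e 0 p)) (e 1 p) = twist DM e p / 2 := by rw [twist]; ring
  have key : ∀ i, inner ℝ (e i p) (DM (e 2) p u) =
      inner ℝ (e 0 p) u * inner ℝ (DM (e 2) p (e 0 p)) (e i p)
      + inner ℝ (e 1 p) u * inner ℝ (DM (e 2) p (e 1 p)) (e i p)
      + (inner ℝ (e 2 p) u * inner ℝ (DM (e 2) p (e 2 p)) (e i p) : ℝ) := by
    intro i
    conv_lhs => rw [h.eq_sum_total u]
    simp only [map_add, map_smul, inner_add_right, inner_smul_right]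
    simp only [real_inner_comm]
  rw [h.eq_sum_total (DM (e 2) p u), key, key, key, h.inner_self hM 2, h.inner_self hM 2,
    h.inner_self hM 2, h.inner_vertical_self hM (i := 0) (by decide),
    h.inner_vertical_self hM (i := 1) (by decide), h.inner_vertical_zero hM, hc, bend, bend]
  module

/-- On horizontal vectors the connection form of a plane frame is read off from the bracket of the
two fields, and the horizontal part of [e₀, e₁] projects to [f₀, f₁]. On the vertical vector only
the twist contributes. -/
theorem inner_covariantDerivative_zero (h : IsAdaptedFrame oM oN φ f e p) (hM : IsLeviCivita DM)
    (hN : IsLeviCivita DN) (u : TangentSpace (𝓡 3) p) :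
    inner ℝ (DM (e 0) p u) (e 1 p)
      = inner ℝ (DN (f 0) (φ p) (diff φ p u)) (f 1 (φ p))
        + (inner ℝ (e 2 p) u * (twist DM e p / 2) : ℝ) := by
  have hbr : inner ℝ (VectorField.mlieBracket (𝓡 3) (e 0) (e 1) p) (e 0 p)
      = (inner ℝ (VectorField.mlieBracket (𝓡 2) (f 0) (f 1) (φ p)) (f 0 (φ p)) : ℝ) ∧
      inner ℝ (VectorField.mlieBracket (𝓡 3) (e 0) (e 1) p) (e 1 p)
      = (inner ℝ (VectorField.mlieBracket (𝓡 2) (f 0) (f 1) (φ p)) (f 1 (φ p)) : ℝ) := by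
    rw [← h.diff_bracket, real_inner_comm, ← h.inner_base_diff_zero, real_inner_comm,
      real_inner_comm (e 1 p), ← h.inner_base_diff_one, real_inner_comm (f 1 (φ p))]
    exact ⟨rfl, rfl⟩
  have hN' := hN.sub_eq_mlieBracket (h.smooth_base 0).mdifferentiableAt
    (h.smooth_base 1).mdifferentiableAt
  have hs := h.base.isOrthonormalFrameNear.inner_covariantDerivative hN
  have h1 : inner ℝ (DM (e 0) p (e 0 p)) (e 1 p)
      = (inner ℝ (DN (f 0) (φ p) (f 0 (φ p))) (f 1 (φ p)) : ℝ) := by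
    have := h.torsion hM 0 1 (e 0 p)
    rw [hbr.1, ← hN', inner_sub_left, h.inner_self hM, h.inner_swap hM 1 0, hs 1 0, hs 0 0] at this
    have := hs 0 0 (f 1 (φ p))
    linarith
  have h2 : inner ℝ (DM (e 0) p (e 1 p)) (e 1 p)
      = (inner ℝ (DN (f 0) (φ p) (f 1 (φ p))) (f 1 (φ p)) : ℝ) := by
    have := h.torsion hM 0 1 (e 1 p)
    rw [hbr.2, ← hN', inner_sub_left, h.inner_self hM] at this
    have := hs 1 1 (f 0 (φ p))
    linarith
  conv_lhs => rw [h.eq_sum_total u]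
  rw [h.diff_eq]
  simp only [map_add, map_smul, inner_add_left, real_inner_smul_left]
  rw [h1, h2, h.inner_vertical_one hM]

theorem nuForm_eventuallyEq (h : IsAdaptedFrame oM oN φ f e p) :
    ∀ᶠ q in nhds p, nuForm oM oN φ q = flat (e 2 q) :=
  h.eventually.mono fun _ hq => hq.nuForm_eq

/-- The equality ν = e₂♭ holds on a neighbourhood, so it may be differentiated. -/
theorem covDerivForm_nuForm (h : IsAdaptedFrame oM oN φ f e p) (hM : IsLeviCivita DM)
    (u : TangentSpace (𝓡 3) p) : covDerivForm DM (nuForm oM oN φ) p u = flat (DM (e 2) p u) := by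
  rw [← hM.covDerivForm_flat (h.smooth_total 2).mdifferentiableAt]
  simp only [covDerivForm]
  refine Finset.sum_congr rfl fun i _ => ?_
  rw [mvfderiv_congr (h.nuForm_eventuallyEq.mono fun q hq => by
    exact congrArg (fun L => L (FiberBundle.extend (Euc 3) (onb p i) q)) hq), h.nuForm_eq]

/-- By `extDerivForm_flat`, dν has the values -h₁, h₀, c on (e₁, e₂), (e₂, e₀), (e₀, e₁). -/
theorem starDNu_eq (h : IsAdaptedFrame oM oN φ f e p) (hM : IsLeviCivita DM) :
    starDNu oM oN φ p
      = flat (-bend DM e 1 p • e 0 p + bend DM e 0 p • e 1 p + twist DM e p • e 2 p) := by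
  obtain ⟨-, b, hb, hbo⟩ := h.total.self_of_nhds
  have hd : ∀ u v, extDerivForm (nuForm oM oN φ) p u v
      = inner ℝ (DM (e 2) p u) v - inner ℝ (DM (e 2) p v) u := by
    intro u v
    rw [← hM.extDerivForm_flat (h.smooth_total 2).mdifferentiableAt]
    have hq : ∀ w : TangentSpace (𝓡 3) p,
        (fun q => nuForm oM oN φ q (FiberBundle.extend (Euc 3) w q)) =ᶠ[nhds p]
          fun q => flat (e 2 q) (FiberBundle.extend (Euc 3) w q) := fun w =>
      h.nuForm_eventuallyEq.mono fun q hq =>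
        congrArg (fun L => L (FiberBundle.extend (Euc 3) w q)) hq
    simp only [extDerivForm]
    rw [mvfderiv_congr (hq u), mvfderiv_congr (hq v), h.nuForm_eq]
  have hc : inner ℝ (DM (e 2) p (e 0 p)) (e 1 p) = twist DM e p / 2 := by rw [twist]; ring
  rw [starDNu, hodgeTwoForm_eq oM hbo]
  · simp only [hb, hd, h.inner_self hM, h.inner_vertical_zero hM, hc]
    rw [bend, bend]
    congr 1
    module
  · intro u v w
    simp only [hd, map_add, inner_add_left, inner_add_right]
    ring
  · intro r u w
    simp only [hd, map_smul, real_inner_smul_left, inner_smul_right]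
    ring
  · intro u v
    simp only [hd]
    ring

theorem cometric_nuForm_starDNu (h : IsAdaptedFrame oM oN φ f e p) (hM : IsLeviCivita DM) :
    cometric (nuForm oM oN φ p) (starDNu oM oN φ p) = twist DM e p := by
  rw [h.nuForm_eq, h.starDNu_eq hM, cometric_flat]
  simp only [inner_add_right, inner_smul_right, h.inner_total]
  simp

end IsAdaptedFrame

end AdaptedGeometry

/-! ### Trace-free endomorphisms of a plane -/

section Algebra

/-- Trace-free endomorphisms of a plane satisfy `AB + BA = Tr(AB)`. -/
theorem mul_add_mul_eq_trace_smul {V : Type*} [AddCommGroup V] [Module ℂ V]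
    (hV : Module.finrank ℂ V = 2) (A B : Module.End ℂ V) (hA : LinearMap.trace ℂ V A = 0)
    (hB : LinearMap.trace ℂ V B = 0) :
    A * B + B * A = LinearMap.trace ℂ V (A * B) • (1 : Module.End ℂ V) := by
  have : FiniteDimensional ℂ V := Module.finite_of_finrank_eq_succ hV
  let b : Module.Basis (Fin 2) ℂ V := Module.finBasisOfFinrankEq ℂ V hV
  rw [LinearMap.trace_eq_matrix_trace ℂ b] at hA hB ⊢
  rw [Matrix.trace_fin_two] at hA hB ⊢
  apply (LinearMap.toMatrixAlgEquiv b).injective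
  rw [map_add, map_mul, map_mul, map_smul, map_one]
  change LinearMap.toMatrix b b A * LinearMap.toMatrix b b B
    + LinearMap.toMatrix b b B * LinearMap.toMatrix b b A = _
  rw [LinearMap.toMatrix_mul]
  set P := LinearMap.toMatrix b b A
  set Q := LinearMap.toMatrix b b B
  have hP : P 1 1 = -P 0 0 := by linear_combination hA
  have hQ : Q 1 1 = -Q 0 0 := by linear_combination hB
  ext i j
  fin_cases i <;> fin_cases j <;>
    simp [Matrix.mul_apply, Fin.sum_univ_two, hP, hQ] <;> ring

end Algebra

/-! ### Clifford relations in a spinor bundle -/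

section Clifford

variable {n : ℕ} {M : Type*} [TopologicalSpace M] [ChartedSpace (Euc n) M]
  [IsManifold (𝓡 n) ∞ M]
  {V : M → Type*} [∀ x, NormedAddCommGroup (V x)] [∀ x, InnerProductSpace ℂ (V x)]
  [TopologicalSpace (TotalSpace SpinorFiber V)] [FiberBundle SpinorFiber V]
  [VectorBundle ℂ SpinorFiber V]
  [RiemannianBundle (fun x : M => TangentSpace (𝓡 n) x)]
  {σ : Π x : M, CotangentSpace n x →ₗ[ℝ] Module.End ℂ (V x)}

variable (V) in
theorem finrank_spinorFiber (x : M) : Module.finrank ℂ (V x) = 2 := by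
  rw [((trivializationAt SpinorFiber V x).linearEquivAt ℂ x
    (FiberBundle.mem_baseSet_trivializationAt' x)).finrank_eq]
  simp

/-- The definition fixes only the traces of products; in rank two, polarized Cayley–Hamilton turns
them into the full anticommutation relations. -/
theorem IsSpinorBundle.mul_add_mul (hσ : IsSpinorBundle σ) (x : M) (α β : CotangentSpace n x) :
    σ x α * σ x β + σ x β * σ x α = (2 * cometric α β : ℂ) • (1 : Module.End ℂ (V x)) := by
  rw [mul_add_mul_eq_trace_smul (finrank_spinorFiber V x) _ _ (hσ.trace_eq_zero x α)
    (hσ.trace_eq_zero x β), ← hσ.isometry]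
  congr 1
  ring

theorem IsSpinorBundle.apply_apply_add (hσ : IsSpinorBundle σ) {x : M}
    (u v : TangentSpace (𝓡 n) x) (ξ : V x) :
    σ x (flat u) (σ x (flat v) ξ) + σ x (flat v) (σ x (flat u) ξ)
      = (2 * (inner ℝ u v : ℝ) : ℂ) • ξ := by
  have := congrArg (fun L : Module.End ℂ (V x) => L ξ) (hσ.mul_add_mul x (flat u) (flat v))
  rw [cometric_flat] at this
  exact this

theorem IsSpinorBundle.inner_left (hσ : IsSpinorBundle σ) {x : M} (α : CotangentSpace n x)
    (ξ η : V x) : inner ℂ (σ x α ξ) η = inner ℂ ξ (σ x α η) :=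
  hσ.isSymmetric x α ξ η

end Clifford

/-! ### The spin operator on the surface -/

section Spin

variable {N : Type*} [TopologicalSpace N] [ChartedSpace (Euc 2) N]
  [IsManifold (𝓡 2) ∞ N]
  {Ψ : N → Type*} [∀ y, NormedAddCommGroup (Ψ y)] [∀ y, InnerProductSpace ℂ (Ψ y)]
  [TopologicalSpace (TotalSpace SpinorFiber Ψ)] [FiberBundle SpinorFiber Ψ]
  [VectorBundle ℂ SpinorFiber Ψ]
  [RiemannianBundle (fun y : N => TangentSpace (𝓡 2) y)]
  {σ : Π y : N, CotangentSpace 2 y →ₗ[ℝ] Module.End ℂ (Ψ y)}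
  {oN : ManifoldOrientation 2 N} {y : N}

/-- `v 0`, `v 1` is an oriented orthonormal pair of vectors at `y`. -/
def IsOrientedPair (oN : ManifoldOrientation 2 N) {y : N} (v : Fin 2 → TangentSpace (𝓡 2) y) :
    Prop :=
  ∃ b : OrthonormalBasis (Fin 2) ℝ (TangentSpace (𝓡 2) y), (∀ i, b i = v i) ∧
    b.toBasis.orientation = oN.orient y

theorem IsOrientedPair.inner_eq {v : Fin 2 → TangentSpace (𝓡 2) y} (hv : IsOrientedPair oN v)
    (i j : Fin 2) : inner ℝ (v i) (v j) = if i = j then (1 : ℝ) else 0 := by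
  obtain ⟨b, hb, -⟩ := hv
  rw [← hb, ← hb, orthonormal_iff_ite.1 b.orthonormal]

theorem IsSpinorBundle.apply_self (hσ : IsSpinorBundle σ) {v : Fin 2 → TangentSpace (𝓡 2) y}
    (hv : IsOrientedPair oN v) (i : Fin 2) (ξ : Ψ y) :
    σ y (flat (v i)) (σ y (flat (v i)) ξ) = ξ := by
  have := hσ.apply_apply_add (v i) (v i) ξ
  rw [hv.inner_eq, if_pos rfl, ← two_smul ℂ, ← smul_smul] at this
  simpa using smul_right_injective _ (two_ne_zero (α := ℂ)) this

theorem IsSpinorBundle.apply_one_zero (hσ : IsSpinorBundle σ) {v : Fin 2 → TangentSpace (𝓡 2) y}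
    (hv : IsOrientedPair oN v) (ξ : Ψ y) :
    σ y (flat (v 1)) (σ y (flat (v 0)) ξ) = -σ y (flat (v 0)) (σ y (flat (v 1)) ξ) := by
  have := hσ.apply_apply_add (v 0) (v 1) ξ
  rw [hv.inner_eq, if_neg (by decide)] at this
  rw [eq_neg_iff_add_eq_zero, add_comm, this]
  simp

theorem clifford_flat_smul (r : ℝ) (ζ : Ψ y) (u : TangentSpace (𝓡 2) y) :
    σ y (flat (r • u)) ζ = (r : ℂ) • σ y (flat u) ζ := by
  rw [flat_smul, map_smul, LinearMap.smul_apply, Complex.coe_smul]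

theorem clifford_flat_add (ζ : Ψ y) (u u' : TangentSpace (𝓡 2) y) :
    σ y (flat (u + u')) ζ = σ y (flat u) ζ + σ y (flat u') ζ := by
  rw [flat_add, map_add, LinearMap.add_apply]

/-- Two oriented orthonormal pairs differ by a rotation. The product σ(w₀)σ(w₁) expands into ⟨w₀,
w₁⟩ plus the determinant times σ(v₀)σ(v₁), that is 0 and 1. -/
theorem spinOperator_apply (hσ : IsSpinorBundle σ) {v : Fin 2 → TangentSpace (𝓡 2) y}
    (hv : IsOrientedPair oN v) (ξ : Ψ y) :
    spinOperator oN σ y ξ = -Complex.I • σ y (flat (v 0)) (σ y (flat (v 1)) ξ) := by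
  obtain ⟨w, hw, hS⟩ : ∃ w : Fin 2 → TangentSpace (𝓡 2) y, IsOrientedPair oN w ∧
      spinOperator oN σ y ξ = -Complex.I • σ y (flat (w 0)) (σ y (flat (w 1)) ξ) :=
    ⟨_, ⟨_, fun i => rfl, Orientation.finOrthonormalBasis_orientation _ _ _⟩, rfl⟩
  rw [hS]
  congr 1
  obtain ⟨b, hb, hbo⟩ := hv
  have hv : IsOrientedPair oN v := ⟨b, hb, hbo⟩
  obtain ⟨c, hc, hco⟩ := hw
  have hw : IsOrientedPair oN w := ⟨c, hc, hco⟩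
  -- Both oriented bases compute the same area form; evaluate it on (w₀, w₁).
  have hdet : (inner ℝ (v 0) (w 0) * inner ℝ (v 1) (w 1)
      - inner ℝ (v 0) (w 1) * inner ℝ (v 1) (w 0) : ℝ) = 1 := by
    have h1 := volForm_two oN hbo (w 0) (w 1)
    rw [volForm_two oN hco, hc, hc, hb, hb] at h1
    rw [← h1, hw.inner_eq, hw.inner_eq, hw.inner_eq, hw.inner_eq]
    simp
  have hex : ∀ i, w i = (inner ℝ (v 0) (w i) : ℝ) • v 0 + (inner ℝ (v 1) (w i) : ℝ) • v 1 := by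
    intro i
    have := b.sum_repr' (w i)
    rw [Fin.sum_univ_two] at this
    simp only [hb] at this
    exact this.symm
  have h01 := hw.inner_eq 0 1
  rw [if_neg (by decide), hex 0, hex 1] at h01
  simp only [inner_add_left, inner_add_right, real_inner_smul_left, inner_smul_right,
    hv.inner_eq] at h01
  norm_num at h01
  rw [hex 0, hex 1]
  simp only [clifford_flat_add, clifford_flat_smul, map_add, map_smul, hσ.apply_self hv,
    hσ.apply_one_zero hv]
  set a : ℝ := inner ℝ (v 0) (w 0)
  set b' : ℝ := inner ℝ (v 1) (w 0)
  set c' : ℝ := inner ℝ (v 0) (w 1)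
  set d : ℝ := inner ℝ (v 1) (w 1)
  have hdet' : (a * d - c' * b' : ℂ) = 1 := by exact_mod_cast hdet
  have h01' : (c' * a + d * b' : ℂ) = 0 := by exact_mod_cast (by linarith)
  rw [← sub_eq_zero]
  trans (c' * a + d * b' : ℂ) • ξ
    + ((a * d - c' * b' : ℂ) - 1) • σ y (flat (v 0)) (σ y (flat (v 1)) ξ)
  · module
  · rw [h01', hdet']; simp

section Relations

variable {v : Fin 2 → TangentSpace (𝓡 2) y}

theorem exists_isOrientedPair (oN : ManifoldOrientation 2 N) (y : N) :
    ∃ v : Fin 2 → TangentSpace (𝓡 2) y, IsOrientedPair oN v := by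
  obtain ⟨b, hb⟩ := exists_orthonormalBasis_orientation_eq (n := 2) (oN.orient y)
  exact ⟨b, b, fun _ => rfl, hb⟩

theorem IsSpinorBundle.spin_apply_zero (hσ : IsSpinorBundle σ) (hv : IsOrientedPair oN v)
    (ξ : Ψ y) :
    spinOperator oN σ y (σ y (flat (v 0)) ξ) = Complex.I • σ y (flat (v 1)) ξ := by
  rw [spinOperator_apply hσ hv, hσ.apply_one_zero hv, map_neg, hσ.apply_self hv]
  module

theorem IsSpinorBundle.spin_apply_one (hσ : IsSpinorBundle σ) (hv : IsOrientedPair oN v)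
    (ξ : Ψ y) :
    spinOperator oN σ y (σ y (flat (v 1)) ξ) = -Complex.I • σ y (flat (v 0)) ξ := by
  rw [spinOperator_apply hσ hv, hσ.apply_self hv]

theorem IsSpinorBundle.apply_zero_spin (hσ : IsSpinorBundle σ) (hv : IsOrientedPair oN v)
    (ξ : Ψ y) :
    σ y (flat (v 0)) (spinOperator oN σ y ξ) = -Complex.I • σ y (flat (v 1)) ξ := by
  rw [spinOperator_apply hσ hv, map_smul, hσ.apply_self hv]

theorem IsSpinorBundle.apply_one_spin (hσ : IsSpinorBundle σ) (hv : IsOrientedPair oN v)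
    (ξ : Ψ y) :
    σ y (flat (v 1)) (spinOperator oN σ y ξ) = Complex.I • σ y (flat (v 0)) ξ := by
  rw [spinOperator_apply hσ hv, map_smul, hσ.apply_one_zero hv, hσ.apply_self hv]
  module

theorem IsSpinorBundle.spin_spin (hσ : IsSpinorBundle σ) (ξ : Ψ y) :
    spinOperator oN σ y (spinOperator oN σ y ξ) = ξ := by
  obtain ⟨v, hv⟩ := exists_isOrientedPair oN y
  rw [spinOperator_apply hσ hv, hσ.apply_one_spin hv, map_smul, hσ.apply_self hv, smul_smul]
  simp

theorem IsOrientedPair.eq_sum (hv : IsOrientedPair oN v) (u : TangentSpace (𝓡 2) y) :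
    u = (inner ℝ (v 0) u : ℝ) • v 0 + (inner ℝ (v 1) u : ℝ) • v 1 := by
  obtain ⟨b, hb, -⟩ := hv
  have := b.sum_repr' u
  rw [Fin.sum_univ_two] at this
  simp only [hb] at this
  exact this.symm

/-- In dimension two the product of both generators anticommutes with each of them. This makes the
operator usable as a third Clifford generator. -/
theorem IsSpinorBundle.spin_apply (hσ : IsSpinorBundle σ) (u : TangentSpace (𝓡 2) y) (ξ : Ψ y) :
    spinOperator oN σ y (σ y (flat u) ξ) = -σ y (flat u) (spinOperator oN σ y ξ) := by
  obtain ⟨v, hv⟩ := exists_isOrientedPair oN y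
  rw [hv.eq_sum u]
  simp only [clifford_flat_add, clifford_flat_smul, map_add, map_smul, hσ.apply_zero_spin hv,
    hσ.apply_one_spin hv, hσ.spin_apply_one hv, hσ.spin_apply_zero hv]
  module

theorem IsSpinorBundle.spin_isSymmetric (hσ : IsSpinorBundle σ) :
    (spinOperator oN σ y).IsSymmetric := by
  intro ξ η
  obtain ⟨v, hv⟩ := exists_isOrientedPair oN y
  rw [spinOperator_apply hσ hv, spinOperator_apply hσ hv, inner_smul_left, inner_smul_right,
    hσ.inner_left, hσ.inner_left, hσ.apply_one_zero hv, inner_neg_right]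
  simp

theorem IsSpinorBundle.trace_spin (hσ : IsSpinorBundle σ) :
    LinearMap.trace ℂ (Ψ y) (spinOperator oN σ y) = 0 := by
  obtain ⟨v, hv⟩ := exists_isOrientedPair oN y
  have : spinOperator oN σ y = -Complex.I • (σ y (flat (v 0)) * σ y (flat (v 1))) :=
    LinearMap.ext fun ξ => spinOperator_apply hσ hv ξ
  have h := hσ.isometry y (flat (v 0)) (flat (v 1))
  rw [cometric_flat, hv.inner_eq, if_neg (by decide)] at h
  rw [this, map_smul, smul_eq_zero]
  right
  simpa using h

theorem IsSpinorBundle.trace_spin_spin (hσ : IsSpinorBundle σ) :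
    LinearMap.trace ℂ (Ψ y) (spinOperator oN σ y * spinOperator oN σ y) = 2 := by
  have h : spinOperator oN σ y * spinOperator oN σ y = 1 := LinearMap.ext fun ξ => hσ.spin_spin ξ
  have _ : FiniteDimensional ℂ (Ψ y) := Module.finite_of_finrank_eq_succ (finrank_spinorFiber Ψ y)
  rw [h, LinearMap.trace_one, finrank_spinorFiber Ψ y]
  simp

/-- The factors anticommute while the trace is symmetric, so each trace equals its own negative. -/
theorem IsSpinorBundle.trace_spin_apply (hσ : IsSpinorBundle σ) (u : TangentSpace (𝓡 2) y) :
    LinearMap.trace ℂ (Ψ y) (spinOperator oN σ y * σ y (flat u)) = 0 ∧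
      LinearMap.trace ℂ (Ψ y) (σ y (flat u) * spinOperator oN σ y) = 0 := by
  have h : spinOperator oN σ y * σ y (flat u) = -(σ y (flat u) * spinOperator oN σ y) :=
    LinearMap.ext fun ξ => hσ.spin_apply u ξ
  have h2 := LinearMap.trace_mul_comm ℂ (spinOperator oN σ y) (σ y (flat u))
  have h3 : LinearMap.trace ℂ (Ψ y) (spinOperator oN σ y * σ y (flat u)) = 0 := by
    rw [h, map_neg] at h2 ⊢
    exact neg_eq_zero.2 (self_eq_neg.1 h2.symm)
  exact ⟨h3, h2 ▸ h3⟩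

end Relations

end Spin

/-! ### Smooth sections of spinor bundles -/

section Sections

variable {n : ℕ} {M : Type*} [TopologicalSpace M] [ChartedSpace (Euc n) M]
  {V : M → Type*} [∀ x, NormedAddCommGroup (V x)] [∀ x, InnerProductSpace ℂ (V x)]
  [TopologicalSpace (TotalSpace SpinorFiber V)] [FiberBundle SpinorFiber V]

namespace SmoothSectionAt

theorem congr {ξ η : Π x : M, V x} {x : M} (h : SmoothSectionAt n ξ x)
    (e : ∀ᶠ y in nhds x, η y = ξ y) : SmoothSectionAt n η x :=
  ContMDiffAt.congr_of_eventuallyEq h (e.mono fun y hy => by simp [hy])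

variable [VectorBundle ℝ SpinorFiber V]

theorem add {ξ η : Π x : M, V x} {x : M} (hξ : SmoothSectionAt n ξ x)
    (hη : SmoothSectionAt n η x) : SmoothSectionAt n (fun y => ξ y + η y) x :=
  ContMDiffAt.add_section hξ hη

theorem smul {g : M → ℝ} {ξ : Π x : M, V x} {x : M} (hg : ContMDiffAt (𝓡 n) 𝓘(ℝ) ∞ g x)
    (hξ : SmoothSectionAt n ξ x) : SmoothSectionAt n (fun y => g y • ξ y) x :=
  ContMDiffAt.smul_section hg hξ

/-- Sections are smooth over the reals; complex scalars are admissible because the trivializations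
are also complex linear. -/
theorem const_smul [VectorBundle ℂ SpinorFiber V] (c : ℂ) {ξ : Π x : M, V x} {x : M}
    (hξ : SmoothSectionAt n ξ x) : SmoothSectionAt n (fun y => c • ξ y) x := by
  let e := trivializationAt SpinorFiber V x
  have h1 : ContMDiffAt (𝓡 n) 𝓘(ℝ, SpinorFiber) ∞ (fun y => (e ⟨y, ξ y⟩).2) x :=
    (contMDiffAt_section _).1 hξ
  refine (contMDiffAt_section _).2 ?_
  have h2 : ContMDiffAt (𝓡 n) 𝓘(ℝ, SpinorFiber) ∞ (fun y => c • (e ⟨y, ξ y⟩).2) x :=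
    ContDiffAt.comp_contMDiffAt (g := fun v : SpinorFiber => c • v)
      (contDiff_const_smul c).contDiffAt h1
  refine h2.congr_of_eventuallyEq ?_
  filter_upwards [e.open_baseSet.mem_nhds (FiberBundle.mem_baseSet_trivializationAt' x)] with y hy
  exact (e.linear ℂ hy).map_smul c (ξ y)

end SmoothSectionAt

/-- The section `ξ` is differentiable at `x`. -/
abbrev DiffSectionAt (n : ℕ) {M : Type*} [TopologicalSpace M] [ChartedSpace (Euc n) M]
    {V : M → Type*} [∀ x, NormedAddCommGroup (V x)] [∀ x, InnerProductSpace ℂ (V x)]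
    [TopologicalSpace (TotalSpace SpinorFiber V)] [FiberBundle SpinorFiber V]
    (ξ : Π x : M, V x) (x : M) : Prop :=
  MDifferentiableAt (𝓡 n) ((𝓡 n).prod 𝓘(ℝ, SpinorFiber))
    (fun y => TotalSpace.mk' SpinorFiber y (ξ y)) x

theorem SmoothSectionAt.diffSectionAt {ξ : Π x : M, V x} {x : M} (h : SmoothSectionAt n ξ x) :
    DiffSectionAt n ξ x :=
  ContMDiffAt.mdifferentiableAt h (by simp)

theorem SmoothSectionAt.eventually_diffSectionAt [IsManifold (𝓡 n) ∞ M]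
    [VectorBundle ℝ SpinorFiber V]
    [ContMDiffVectorBundle ∞ SpinorFiber V (𝓡 n)] {ξ : Π x : M, V x} {x : M}
    (h : SmoothSectionAt n ξ x) : ∀ᶠ y in nhds x, DiffSectionAt n ξ y := by
  let e := trivializationAt SpinorFiber V x
  have h1 : ContMDiffAt (𝓡 n) 𝓘(ℝ, SpinorFiber) ∞ (fun y => (e ⟨y, ξ y⟩).2) x :=
    (contMDiffAt_section _).1 h
  have : ContMDiffVectorBundle 1 SpinorFiber V (𝓡 n) :=
    ContMDiffVectorBundle.of_le (n := ∞) (by simp)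
  filter_upwards [h1.eventually_mdifferentiableAt,
    e.open_baseSet.mem_nhds (FiberBundle.mem_baseSet_trivializationAt' x)] with y hy hy'
  exact (e.mdifferentiableAt_section_iff _ _ hy').2 hy

end Sections

/-! ### Connections in a trivialization -/

section Connections

variable {n : ℕ} {M : Type*} [TopologicalSpace M] [ChartedSpace (Euc n) M]
  {V : M → Type*} [∀ x, NormedAddCommGroup (V x)] [∀ x, InnerProductSpace ℂ (V x)]
  [TopologicalSpace (TotalSpace SpinorFiber V)] [FiberBundle SpinorFiber V]
  {nab : (Π x : M, V x) → Π x : M, TangentSpace (𝓡 n) x →L[ℝ] V x}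

theorem connection_add (h : IsCovariantDerivativeOn SpinorFiber nab Set.univ) {ξ η : Π x : M, V x}
    {x : M} (hξ : DiffSectionAt n ξ x) (hη : DiffSectionAt n η x) (X : TangentSpace (𝓡 n) x) :
    nab (fun y => ξ y + η y) x X = nab ξ x X + nab η x X :=
  congrArg (fun L => L X) (h.add hξ hη)

theorem connection_smul (h : IsCovariantDerivativeOn SpinorFiber nab Set.univ) {g : M → ℝ}
    {ξ : Π x : M, V x} {x : M} (hg : MDifferentiableAt (𝓡 n) 𝓘(ℝ) g x)
    (hξ : DiffSectionAt n ξ x) (X : TangentSpace (𝓡 n) x) :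
    nab (fun y => g y • ξ y) x X = g x • nab ξ x X + mvfderiv (𝓡 n) g x X • ξ x :=
  congrArg (fun L => L X) (h.leibniz hξ hg)

variable [VectorBundle ℝ SpinorFiber V]

theorem DiffSectionAt.congr {ξ η : Π x : M, V x} {x : M} (h : DiffSectionAt n ξ x)
    (e : ∀ᶠ y in nhds x, η y = ξ y) : DiffSectionAt n η x :=
  MDifferentiableAt.congr_of_eventuallyEq h (e.mono fun y hy => by simp [hy])

theorem connection_congr (h : IsCovariantDerivativeOn SpinorFiber nab Set.univ) {ξ η : Π x : M, V x}
    {x : M} (hξ : DiffSectionAt n ξ x) (e : ∀ᶠ y in nhds x, η y = ξ y)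
    (X : TangentSpace (𝓡 n) x) : nab η x X = nab ξ x X := by
  rw [h.congr_of_eventuallyEq (hξ.congr e) hξ Filter.univ_mem e]

theorem connection_const_smul (h : IsCovariantDerivativeOn SpinorFiber nab Set.univ) (r : ℝ)
    {ξ : Π x : M, V x} {x : M} (hξ : DiffSectionAt n ξ x) (X : TangentSpace (𝓡 n) x) :
    nab (fun y => r • ξ y) x X = r • nab ξ x X := by
  rw [connection_smul h mdifferentiableAt_const hξ, mvfderiv_const]
  simp

theorem connection_sum (h : IsCovariantDerivativeOn SpinorFiber nab Set.univ) {ι : Type*}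
    (s : Finset ι) {ξ : ι → Π x : M, V x} {x : M} (hξ : ∀ i, DiffSectionAt n (ξ i) x)
    (X : TangentSpace (𝓡 n) x) :
    nab (fun y => ∑ i ∈ s, ξ i y) x X = ∑ i ∈ s, nab (ξ i) x X := by
  classical
  induction s using Finset.induction_on with
  | empty =>
    have := h.zero (x := x)
    simp only [Finset.sum_empty]
    exact congrArg (fun L => L X) this
  | insert i s hi ih =>
    simp only [Finset.sum_insert hi]
    rw [connection_add h (hξ i) (MDifferentiableAt.sum_section fun i _ => hξ i), ih]

variable [ContMDiffVectorBundle ∞ SpinorFiber V (𝓡 n)]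

/-- A connection in terms of the trivialization around a point. -/
theorem connection_eq_trivialization (h : IsCovariantDerivativeOn SpinorFiber nab Set.univ)
    {ξ : Π x : M, V x} {x : M} (hξ : DiffSectionAt n ξ x) (X : TangentSpace (𝓡 n) x) :
    nab ξ x X = (trivializationAt SpinorFiber V x).symmL ℝ x
        (mvfderiv (𝓡 n) (fun y => (trivializationAt SpinorFiber V x ⟨y, ξ y⟩).2) x X)
      + nab (FiberBundle.extend SpinorFiber (ξ x)) x X := by
  let e := trivializationAt SpinorFiber V x
  have : ContMDiffVectorBundle 1 SpinorFiber V (𝓡 n) :=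
    ContMDiffVectorBundle.of_le (n := ∞) (by simp)
  have hx : x ∈ e.baseSet := FiberBundle.mem_baseSet_trivializationAt' x
  let A : M → SpinorFiber := fun y => (e ⟨y, ξ y⟩).2
  have hA : MDifferentiableAt (𝓡 n) 𝓘(ℝ, SpinorFiber) A x :=
    (e.mdifferentiableAt_section_iff _ _ hx).1 hξ
  let b := Module.finBasis ℝ SpinorFiber
  let c : Fin (Module.finrank ℝ SpinorFiber) → SpinorFiber →L[ℝ] ℝ :=
    fun i => LinearMap.toContinuousLinearMap (b.coord i)
  have hc : ∀ v : SpinorFiber, v = ∑ i, c i v • b i := fun v => (b.sum_repr v).symm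
  -- A real frame, since the Leibniz rule is available for real functions only. Both ξ and the
  -- extension of its value have coordinates in this frame, variable and constant respectively;
  -- their derivatives differ by that of the coordinates.
  let E : Fin (Module.finrank ℝ SpinorFiber) → Π y : M, V y := fun i y => e.symmL ℝ y (b i)
  have hE : ∀ i, DiffSectionAt n (E i) x := by
    intro i
    refine (e.mdifferentiableAt_section_iff _ _ hx).2 ?_
    refine (mdifferentiableAt_const (c := b i)).congr_of_eventuallyEq ?_
    filter_upwards [e.open_baseSet.mem_nhds hx] with y hy
    change (e ⟨y, e.symmL ℝ y (b i)⟩).2 = b i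
    rw [e.symmL_apply hy]
    exact congrArg Prod.snd (e.apply_mk_symm hy (b i))
  have hsum : ∀ v : SpinorFiber, ∀ y, e.symmL ℝ y v = ∑ i, c i v • E i y := by
    intro v y
    conv_lhs => rw [hc v]
    simp only [map_sum, map_smul]
    rfl
  have hcA : ∀ i, MDifferentiableAt (𝓡 n) 𝓘(ℝ) (fun y => c i (A y)) x := fun i =>
    MDifferentiableAt.comp x (c i).differentiableAt.mdifferentiableAt hA
  have hd : ∀ i, mvfderiv (𝓡 n) (fun y => c i (A y)) x X = c i (mvfderiv (𝓡 n) A x X) := by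
    intro i
    have := mfderiv_comp_apply x ((c i).differentiableAt.mdifferentiableAt (x := A x)) hA X
    refine this.trans ?_
    rw [mfderiv_eq_fderiv, ContinuousLinearMap.fderiv]
    rfl
  have h1 : ∀ᶠ y in nhds x, ξ y = ∑ i, c i (A y) • E i y := by
    filter_upwards [e.open_baseSet.mem_nhds hx] with y hy
    rw [← hsum, e.symmL_apply hy]
    exact (e.symm_apply_apply_mk hy (ξ y)).symm
  have h2 : ∀ᶠ y in nhds x,
      FiberBundle.extend SpinorFiber (ξ x) y = ∑ i, c i (A x) • E i y := by
    filter_upwards [e.open_baseSet.mem_nhds hx] with y hy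
    rw [← hsum, e.symmL_apply hy]
    rfl
  have h3 : ∀ i, DiffSectionAt n (fun y => c i (A y) • E i y) x := fun i =>
    MDifferentiableAt.smul_section (hcA i) (hE i)
  have h4 : ∀ i, DiffSectionAt n (fun y => c i (A x) • E i y) x := fun i =>
    MDifferentiableAt.smul_section mdifferentiableAt_const (hE i)
  rw [connection_congr h (MDifferentiableAt.sum_section fun i _ => h3 i) h1,
    connection_sum h _ h3, connection_congr h (MDifferentiableAt.sum_section fun i _ => h4 i) h2,
    connection_sum h _ h4, hsum, ← Finset.sum_add_distrib]
  refine Finset.sum_congr rfl fun i _ => ?_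
  rw [connection_smul h (hcA i) (hE i), connection_const_smul h _ (hE i), hd, add_comm]

end Connections

/-! ### Real scalars in the Hermitian product -/

theorem inner_real_smul_left {E : Type*} [NormedAddCommGroup E] [InnerProductSpace ℂ E] (r : ℝ)
    (x y : E) : (inner ℂ (r • x) y : ℂ) = r • inner ℂ x y := by
  rw [← Complex.coe_smul, inner_smul_left, Complex.conj_ofReal, Complex.real_smul]

theorem inner_real_smul_right {E : Type*} [NormedAddCommGroup E] [InnerProductSpace ℂ E] (r : ℝ)
    (x y : E) : (inner ℂ x (r • y) : ℂ) = r • inner ℂ x y := by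
  rw [← Complex.coe_smul, inner_smul_right, Complex.real_smul]

/-! ### The induced bundle and its connection -/

section LiftedSections

variable {M : Type*} [TopologicalSpace M] [ChartedSpace (Euc 3) M]
  {N : Type*} [TopologicalSpace N] [ChartedSpace (Euc 2) N]
  [IsManifold (𝓡 3) ∞ M] [IsManifold (𝓡 2) ∞ N]
  {φ : C^∞⟮𝓡 3, M; 𝓡 2, N⟯}
  {Ψ : N → Type*} [∀ y, NormedAddCommGroup (Ψ y)] [∀ y, InnerProductSpace ℂ (Ψ y)]
  [TopologicalSpace (TotalSpace SpinorFiber Ψ)] [FiberBundle SpinorFiber Ψ]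
  {p : M}

/-- The coordinates of a section of the induced bundle. -/
theorem smoothSectionAt_lifted_iff {s : Π q : M, LiftedBundle φ Ψ q} :
    SmoothSectionAt 3 s p ↔ ContMDiffAt (𝓡 3) 𝓘(ℝ, SpinorFiber) ∞
      (fun q => (trivializationAt SpinorFiber Ψ (φ p) ⟨φ q, s q⟩).2) p :=
  contMDiffAt_section (F := SpinorFiber) (E := LiftedBundle φ Ψ) p

theorem SmoothSectionAt.liftSection {ξ : Π y : N, Ψ y} (h : SmoothSectionAt 2 ξ (φ p)) :
    SmoothSectionAt 3 (liftSection φ ξ) p := by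
  rw [smoothSectionAt_lifted_iff]
  exact ContMDiffAt.comp (g := fun y => (trivializationAt SpinorFiber Ψ (φ p) ⟨y, ξ y⟩).2) p
    ((contMDiffAt_section _).1 h) φ.contMDiff.contMDiffAt

theorem diffSectionAt_lifted_iff {s : Π q : M, LiftedBundle φ Ψ q} :
    DiffSectionAt 3 s p ↔ MDifferentiableAt (𝓡 3) 𝓘(ℝ, SpinorFiber)
      (fun q => (trivializationAt SpinorFiber Ψ (φ p) ⟨φ q, s q⟩).2) p :=
  mdifferentiableAt_section (F := SpinorFiber) (E := LiftedBundle φ Ψ) _ _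

variable [VectorBundle ℝ SpinorFiber Ψ] [ContMDiffVectorBundle ∞ SpinorFiber Ψ (𝓡 2)]

/-- Smooth sections of the induced bundle are locally generated by the lifts of sections. -/
theorem liftedSection_induction (Q : (Π q : M, LiftedBundle φ Ψ q) → Prop)
    (hcongr : ∀ s t, SmoothSectionAt 3 s p → (∀ᶠ q in nhds p, t q = s q) → Q s → Q t)
    (hadd : ∀ s t, SmoothSectionAt 3 s p → SmoothSectionAt 3 t p → Q s → Q t →
      Q (fun q => s q + t q))
    (hsmul : ∀ (g : M → ℝ) (s), ContMDiffAt (𝓡 3) 𝓘(ℝ) ∞ g p → SmoothSectionAt 3 s p → Q s →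
      Q (fun q => g q • s q))
    (hlift : ∀ ξ : Π y : N, Ψ y, SmoothSectionAt 2 ξ (φ p) → Q (liftSection φ ξ))
    {s : Π q : M, LiftedBundle φ Ψ q} (hs : SmoothSectionAt 3 s p) : Q s := by
  classical
  let e := trivializationAt SpinorFiber Ψ (φ p)
  have hx : φ p ∈ e.baseSet := FiberBundle.mem_baseSet_trivializationAt' (φ p)
  let A : M → SpinorFiber := fun q => (e ⟨φ q, s q⟩).2
  have hA : ContMDiffAt (𝓡 3) 𝓘(ℝ, SpinorFiber) ∞ A p := smoothSectionAt_lifted_iff.1 hs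
  let b := Module.finBasis ℝ SpinorFiber
  let c : Fin (Module.finrank ℝ SpinorFiber) → SpinorFiber →L[ℝ] ℝ :=
    fun i => LinearMap.toContinuousLinearMap (b.coord i)
  have hc : ∀ v : SpinorFiber, v = ∑ i, c i v • b i := fun v => (b.sum_repr v).symm
  let E : Fin (Module.finrank ℝ SpinorFiber) → Π y : N, Ψ y := fun i y => e.symmL ℝ y (b i)
  have hE : ∀ i, SmoothSectionAt 2 (E i) (φ p) := by
    intro i
    refine (contMDiffAt_section _).2 ?_
    refine (contMDiffAt_const (c := b i)).congr_of_eventuallyEq ?_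
    filter_upwards [e.open_baseSet.mem_nhds hx] with y hy
    change (e ⟨y, e.symmL ℝ y (b i)⟩).2 = b i
    rw [e.symmL_apply hy]
    exact congrArg Prod.snd (e.apply_mk_symm hy (b i))
  have hcA : ∀ i, ContMDiffAt (𝓡 3) 𝓘(ℝ) ∞ (fun q => c i (A q)) p := fun i =>
    ContDiffAt.comp_contMDiffAt (c i).contDiff.contDiffAt hA
  -- Smoothness of the partial sums is carried along because the additivity hypothesis on `Q` asks
  -- for it.
  have key : ∀ t : Finset (Fin (Module.finrank ℝ SpinorFiber)),
      SmoothSectionAt 3 (fun q => ∑ i ∈ t, c i (A q) • liftSection φ (E i) q) p ∧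
      Q (fun q => ∑ i ∈ t, c i (A q) • liftSection φ (E i) q) := by
    intro t
    induction t using Finset.induction_on with
    | empty =>
      have h0 : SmoothSectionAt 2 (fun y => (0 : Ψ y)) (φ p) :=
        (contMDiff_zeroSection ℝ Ψ).contMDiffAt
      simp only [Finset.sum_empty]
      exact ⟨h0.liftSection, hlift _ h0⟩
    | insert i t hi ih =>
      simp only [Finset.sum_insert hi]
      have h1 := SmoothSectionAt.smul (hcA i) (hE i).liftSection
      exact ⟨h1.add ih.1, hadd _ _ h1 ih.1 (hsmul _ _ (hcA i) (hE i).liftSection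
        (hlift _ (hE i))) ih.2⟩
  refine hcongr _ _ (key Finset.univ).1 ?_ (key Finset.univ).2
  filter_upwards [φ.contMDiff.continuous.continuousAt.eventually (e.open_baseSet.mem_nhds hx)]
    with q hq
  have h1 : (e.symmL ℝ (φ q) (A q) : Ψ (φ q)) = ∑ i, c i (A q) • E i (φ q) := by
    conv_lhs => rw [hc (A q)]
    simp only [map_sum, map_smul]
    rfl
  refine Eq.trans ?_ h1
  rw [e.symmL_apply hq]
  exact (e.symm_apply_apply_mk hq (s q : Ψ (φ q))).symm

/-- A real-linear map of a fiber of `Ψ` as a map of a fiber of the induced bundle. -/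
noncomputable def liftMap (φ : C^∞⟮𝓡 3, M; 𝓡 2, N⟯) (p : M) (T : Ψ (φ p) →ₗ[ℝ] Ψ (φ p)) :
    LiftedBundle φ Ψ p →ₗ[ℝ] LiftedBundle φ Ψ p :=
  T

theorem SmoothSectionAt.liftMap {T : Π y : N, Ψ y →ₗ[ℝ] Ψ y}
    (hT : ∀ ξ : Π y : N, Ψ y, SmoothSectionAt 2 ξ (φ p) →
      SmoothSectionAt 2 (fun y => T y (ξ y)) (φ p))
    {s : Π q : M, LiftedBundle φ Ψ q} (hs : SmoothSectionAt 3 s p) :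
    SmoothSectionAt 3 (fun q => liftMap φ q (T (φ q)) (s q)) p := by
  refine liftedSection_induction
    (fun s => SmoothSectionAt 3 (fun q => _root_.liftMap φ q (T (φ q)) (s q)) p) ?_ ?_ ?_ ?_ hs
  · intro s t _ hst h
    exact h.congr (hst.mono fun q hq => by rw [hq])
  · intro s t _ _ h1 h2
    simp only [map_add]
    exact h1.add h2
  · intro g s hg _ h
    simp only [map_smul]
    exact SmoothSectionAt.smul hg h
  · exact fun ξ hξ => (hT ξ hξ).liftSection

variable {nab : (Π y : N, Ψ y) → Π y : N, TangentSpace (𝓡 2) y →L[ℝ] Ψ y}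

theorem extend_eventuallyEq {y : N} (v : Ψ y) : ∀ᶠ z in nhds y,
    FiberBundle.extend SpinorFiber v z = (trivializationAt SpinorFiber Ψ y).symmL ℝ z
      ((trivializationAt SpinorFiber Ψ y) ⟨y, v⟩).2 := by
  filter_upwards [(trivializationAt SpinorFiber Ψ y).open_baseSet.mem_nhds
    (FiberBundle.mem_baseSet_trivializationAt' y)] with z hz
  rw [Trivialization.symmL_apply _ hz]
  rfl

/-- Near `y` the extension is linear in the extended vector, the trivialization being linear. Thus
the second term of `inducedConnection` is a connection matrix acting on the value of the section. -/
theorem connection_extend_add (h : IsCovariantDerivativeOn SpinorFiber nab Set.univ) {y : N}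
    (v w : Ψ y) (Y : TangentSpace (𝓡 2) y) :
    nab (FiberBundle.extend SpinorFiber (v + w)) y Y
      = nab (FiberBundle.extend SpinorFiber v) y Y
        + nab (FiberBundle.extend SpinorFiber w) y Y := by
  have hd : ∀ v : Ψ y, DiffSectionAt 2 (FiberBundle.extend SpinorFiber v) y :=
    fun v => FiberBundle.mdifferentiableAt_extend ..
  rw [← connection_add h (hd v) (hd w)]
  refine connection_congr h (mdifferentiableAt_add_section (hd v) (hd w)) ?_ Y
  filter_upwards [extend_eventuallyEq v, extend_eventuallyEq w, extend_eventuallyEq (v + w)]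
    with z h1 h2 h3
  rw [Pi.add_apply, h1, h2, h3, ← map_add]
  congr 1
  exact ((trivializationAt SpinorFiber Ψ y).linear ℝ
    (FiberBundle.mem_baseSet_trivializationAt' y)).map_add v w

theorem connection_extend_smul (h : IsCovariantDerivativeOn SpinorFiber nab Set.univ) {y : N}
    (r : ℝ) (v : Ψ y) (Y : TangentSpace (𝓡 2) y) :
    nab (FiberBundle.extend SpinorFiber (r • v)) y Y
      = r • nab (FiberBundle.extend SpinorFiber v) y Y := by
  have hd : ∀ v : Ψ y, DiffSectionAt 2 (FiberBundle.extend SpinorFiber v) y :=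
    fun v => FiberBundle.mdifferentiableAt_extend ..
  rw [← connection_const_smul h r (hd v)]
  refine connection_congr h (MDifferentiableAt.smul_section mdifferentiableAt_const (hd v)) ?_ Y
  filter_upwards [extend_eventuallyEq v, extend_eventuallyEq (r • v)] with z h1 h3
  rw [Pi.smul_apply', h1, h3, ← map_smul]
  congr 1
  exact ((trivializationAt SpinorFiber Ψ y).linear ℝ
    (FiberBundle.mem_baseSet_trivializationAt' y)).map_smul r v

theorem inducedConnection_apply (s : Π q : M, LiftedBundle φ Ψ q) (X : TangentSpace (𝓡 3) p) :
    inducedConnection φ nab s p X = ((trivializationAt SpinorFiber Ψ (φ p)).symmL ℝ (φ p)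
        (mvfderiv (𝓡 3) (fun q => (trivializationAt SpinorFiber Ψ (φ p)
          (TotalSpace.mk' SpinorFiber (φ q) (s q))).2) p X)
      + nab (FiberBundle.extend SpinorFiber (show Ψ (φ p) from s p)) (φ p) (diff φ p X)
      : Ψ (φ p)) :=
  rfl

theorem inducedConnection_isCovariantDerivativeOn
    (h : IsCovariantDerivativeOn SpinorFiber nab Set.univ) :
    IsCovariantDerivativeOn SpinorFiber (inducedConnection φ nab) Set.univ where
  add := by
    intro s t p hs ht _
    have hs' := diffSectionAt_lifted_iff.1 hs
    have ht' := diffSectionAt_lifted_iff.1 ht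
    let e := trivializationAt SpinorFiber Ψ (φ p)
    ext X
    have h1 : mvfderiv (𝓡 3) (fun q => (e (TotalSpace.mk' SpinorFiber (φ q) ((s + t) q))).2) p X
        = mvfderiv (𝓡 3) (fun q => (e (TotalSpace.mk' SpinorFiber (φ q) (s q))).2) p X
          + mvfderiv (𝓡 3) (fun q => (e (TotalSpace.mk' SpinorFiber (φ q) (t q))).2) p X := by
      refine (mvfderiv_congr ?_ X).trans (congrArg (fun L => L X) (mvfderiv_add hs' ht'))
      filter_upwards [φ.contMDiff.continuous.continuousAt.eventually
        (e.open_baseSet.mem_nhds (FiberBundle.mem_baseSet_trivializationAt' (φ p)))] with q hq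
      exact (e.linear ℝ hq).map_add (s q : Ψ (φ q)) (t q)
    have key : ∀ d d1 d2 : SpinorFiber, d = d1 + d2 → ∀ v w : Ψ (φ p),
        e.symmL ℝ (φ p) d + nab (FiberBundle.extend SpinorFiber (v + w)) (φ p) (diff φ p X)
        = (e.symmL ℝ (φ p) d1 + nab (FiberBundle.extend SpinorFiber v) (φ p) (diff φ p X))
        + (e.symmL ℝ (φ p) d2 + nab (FiberBundle.extend SpinorFiber w) (φ p) (diff φ p X)) := by
      rintro d d1 d2 rfl v w
      rw [connection_extend_add h, map_add]
      abel
    exact key _ _ _ h1 (s p) (t p)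
  leibniz := by
    intro s g p hs hg _
    have hs' := diffSectionAt_lifted_iff.1 hs
    let e := trivializationAt SpinorFiber Ψ (φ p)
    have hp := FiberBundle.mem_baseSet_trivializationAt' (F := SpinorFiber) (E := Ψ) (φ p)
    ext X
    have h1 : mvfderiv (𝓡 3) (fun q => (e (TotalSpace.mk' SpinorFiber (φ q) ((g • s) q))).2) p X
        = g p • mvfderiv (𝓡 3) (fun q => (e (TotalSpace.mk' SpinorFiber (φ q) (s q))).2) p X
          + mvfderiv (𝓡 3) g p X • (e (TotalSpace.mk' SpinorFiber (φ p) (s p))).2 := by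
      refine (mvfderiv_congr ?_ X).trans (congrArg (fun L => L X) (mvfderiv_smul hg hs'))
      filter_upwards [φ.contMDiff.continuous.continuousAt.eventually
        (e.open_baseSet.mem_nhds hp)] with q hq
      exact (e.linear ℝ hq).map_smul (g q) (s q : Ψ (φ q))
    have key : ∀ (d d1 : SpinorFiber) (r r' : ℝ) (v : Ψ (φ p)),
        d = r • d1 + r' • (e (TotalSpace.mk' SpinorFiber (φ p) v)).2 →
        e.symmL ℝ (φ p) d + nab (FiberBundle.extend SpinorFiber (r • v)) (φ p) (diff φ p X)
        = r • (e.symmL ℝ (φ p) d1 + nab (FiberBundle.extend SpinorFiber v) (φ p) (diff φ p X))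
        + r' • v := by
      rintro d d1 r r' v rfl
      have h3 : e.symmL ℝ (φ p) (e (TotalSpace.mk' SpinorFiber (φ p) v)).2 = v := by
        rw [e.symmL_apply hp]
        exact e.symm_apply_apply_mk hp v
      rw [connection_extend_smul h, map_add, map_smul, map_smul, h3]
      module
    exact key _ _ _ _ (s p) h1

/-- The defining property of the induced connection: for a lifted section the formula is that of
`connection_eq_trivialization`, with the coordinates differentiated through φ by the chain rule. -/
theorem inducedConnection_liftSection (h : IsCovariantDerivativeOn SpinorFiber nab Set.univ)
    {ξ : Π y : N, Ψ y} (hξ : DiffSectionAt 2 ξ (φ p)) (X : TangentSpace (𝓡 3) p) :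
    inducedConnection φ nab (liftSection φ ξ) p X = (nab ξ (φ p) (diff φ p X) : Ψ (φ p)) := by
  have : ContMDiffVectorBundle 1 SpinorFiber Ψ (𝓡 2) :=
    ContMDiffVectorBundle.of_le (n := ∞) (by simp)
  rw [inducedConnection_apply, connection_eq_trivialization h hξ]
  congr 2
  exact mvfderiv_comp_mfderiv (f := fun y => (trivializationAt SpinorFiber Ψ (φ p) ⟨y, ξ y⟩).2)
    ((mdifferentiableAt_section _ _).1 hξ)
    (φ.contMDiff.contMDiffAt.mdifferentiableAt (by simp)) X

/-- A commutation rule [∇, T] = R on `N` passes to the induced bundle: it is tensorial in the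
section, and every section is locally a combination of lifts. It serves the Clifford action, the
spin operator and multiplication by i. -/
theorem inducedConnection_liftMap (h : IsCovariantDerivativeOn SpinorFiber nab Set.univ)
    {T : Π y : N, Ψ y →ₗ[ℝ] Ψ y} {X : TangentSpace (𝓡 3) p} {R : Ψ (φ p) →ₗ[ℝ] Ψ (φ p)}
    (hT : ∀ ξ : Π y : N, Ψ y, SmoothSectionAt 2 ξ (φ p) →
      SmoothSectionAt 2 (fun y => T y (ξ y)) (φ p))
    (hTR : ∀ ξ : Π y : N, Ψ y, SmoothSectionAt 2 ξ (φ p) →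
      nab (fun y => T y (ξ y)) (φ p) (diff φ p X)
        = T (φ p) (nab ξ (φ p) (diff φ p X)) + R (ξ (φ p)))
    {s : Π q : M, LiftedBundle φ Ψ q} (hs : SmoothSectionAt 3 s p) :
    inducedConnection φ nab (fun q => liftMap φ q (T (φ q)) (s q)) p X
      = liftMap φ p (T (φ p)) (inducedConnection φ nab s p X) + liftMap φ p R (s p) := by
  have hi := inducedConnection_isCovariantDerivativeOn (φ := φ) h
  have hd : ∀ s : Π q : M, LiftedBundle φ Ψ q, SmoothSectionAt 3 s p →
      DiffSectionAt 3 (fun q => liftMap φ q (T (φ q)) (s q)) p :=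
    fun s hs => (hs.liftMap hT).diffSectionAt
  refine liftedSection_induction
    (fun s => inducedConnection φ nab (fun q => liftMap φ q (T (φ q)) (s q)) p X
      = liftMap φ p (T (φ p)) (inducedConnection φ nab s p X) + liftMap φ p R (s p))
    ?_ ?_ ?_ ?_ hs
  · intro s t hs hst hQ
    rw [connection_congr hi (hd s hs) (hst.mono fun q hq => by rw [hq]),
      connection_congr hi hs.diffSectionAt hst, hst.self_of_nhds]
    exact hQ
  · intro s t hs ht h1 h2
    simp only [map_add]
    rw [connection_add hi (hd s hs) (hd t ht), connection_add hi hs.diffSectionAt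
      ht.diffSectionAt, h1, h2, map_add]
    abel
  · intro g s hg hs h1
    have hg' := hg.mdifferentiableAt (by simp)
    simp only [map_smul]
    rw [connection_smul hi hg' (hd s hs), connection_smul hi hg' hs.diffSectionAt, h1, map_add,
      map_smul, map_smul]
    module
  · intro ξ hξ
    rw [inducedConnection_liftSection h hξ.diffSectionAt]
    exact (inducedConnection_liftSection h (hT ξ hξ).diffSectionAt X).trans (hTR ξ hξ)

theorem SmoothSectionAt.inducedConnection [RiemannianBundle (fun x : M => TangentSpace (𝓡 3) x)]
    [RiemannianBundle (fun y : N => TangentSpace (𝓡 2) y)]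
    [IsContMDiffRiemannianBundle (𝓡 2) ∞ (Euc 2) (fun y : N => TangentSpace (𝓡 2) y)]
    (h : IsCovariantDerivativeOn SpinorFiber nab Set.univ)
    (hnab : ∀ (ξ : Π y : N, Ψ y) (Y : Π y : N, TangentSpace (𝓡 2) y) (y : N),
      SmoothSectionAt 2 ξ y → SmoothFieldAt Y y → SmoothSectionAt 2 (fun z => nab ξ z (Y z)) y)
    {s : Π q : M, LiftedBundle φ Ψ q} (hs : SmoothSectionAt 3 s p)
    {X : Π q : M, TangentSpace (𝓡 3) q} (hX : SmoothFieldAt X p) :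
    SmoothSectionAt 3 (fun q => inducedConnection φ nab s q (X q)) p := by
  have hi := inducedConnection_isCovariantDerivativeOn (φ := φ) h
  refine liftedSection_induction
    (fun s => SmoothSectionAt 3 (fun q => _root_.inducedConnection φ nab s q (X q)) p)
    ?_ ?_ ?_ ?_ hs
  · intro s t hs hst hQ
    refine hQ.congr ?_
    filter_upwards [hs.eventually_diffSectionAt, eventually_eventually_nhds.2 hst] with q h1 h2
    exact connection_congr hi h1 h2 _
  · intro s t hs ht h1 h2
    refine (h1.add h2).congr ?_
    filter_upwards [hs.eventually_diffSectionAt, ht.eventually_diffSectionAt] with q h3 h4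
    exact connection_add hi h3 h4 _
  · intro g s hg hs h1
    refine ((SmoothSectionAt.smul hg h1).add
      (SmoothSectionAt.smul (SmoothFieldAt.mvfderiv_apply hg hX) hs)).congr ?_
    filter_upwards [hs.eventually_diffSectionAt, hg.eventually_mdifferentiableAt] with q h3 h4
    exact connection_smul hi h4 h3 _
  · intro ξ hξ
    obtain ⟨f, -, hf⟩ := exists_orthonormalFrame (onb (n := 2) (φ p))
    have hc : ∀ j, ContMDiffAt (𝓡 3) 𝓘(ℝ) ∞
        (fun q => (inner ℝ (f j (φ q)) (diff φ q (X q)) : ℝ)) p := by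
      intro j
      have h1 : ContMDiffAt (𝓡 3) ((𝓡 2).prod (𝓡 2)) ∞ (fun q => TotalSpace.mk' (Euc 2)
          (E := (TangentSpace (𝓡 2) : N → Type _)) (φ q) (f j (φ q))) p :=
        ContMDiffAt.comp p (hf.self_of_nhds.1 j) φ.contMDiff.contMDiffAt
      have h2 : ContMDiffAt (𝓡 3) ((𝓡 2).prod (𝓡 2)) ∞ (fun q => TotalSpace.mk' (Euc 2)
          (E := (TangentSpace (𝓡 2) : N → Type _)) (φ q) (diff φ q (X q))) p :=
        ContMDiffAt.comp p (φ.contMDiff.contMDiff_tangentMap (m := ∞) (by simp)).contMDiffAt hX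
      exact ContMDiffAt.inner_bundle (b := φ) h1 h2
    -- The vectors φ_*X need not form a field on `N`, so they are expanded in a frame of `N` with
    -- coefficients that are functions on `M`.
    have hsm := fun j => SmoothSectionAt.smul (hc j)
      (hnab ξ (f j) (φ p) hξ (hf.self_of_nhds.1 j)).liftSection
    refine ((hsm 0).add (hsm 1)).congr ?_
    filter_upwards [φ.contMDiff.continuous.continuousAt.eventually hf,
      φ.contMDiff.continuous.continuousAt.eventually hξ.eventually_diffSectionAt] with q h1 h2
    rw [inducedConnection_liftSection h h2]
    obtain ⟨b, hb⟩ := exists_orthonormalBasis_of_inner h1.2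
    have h3 := b.sum_repr' (diff φ q (X q))
    rw [Fin.sum_univ_two] at h3
    simp only [hb] at h3
    have h4 := congrArg (fun Y => nab ξ (φ q) Y) h3
    simp only [map_add, map_smul] at h4
    exact h4.symm

theorem smooth_inner_lifted
    (hinner : ∀ (ξ η : Π y : N, Ψ y) (y : N), SmoothSectionAt 2 ξ y → SmoothSectionAt 2 η y →
      ContMDiffAt (𝓡 2) 𝓘(ℝ, ℂ) ∞ (fun z => inner ℂ (ξ z) (η z)) y)
    {s t : Π q : M, LiftedBundle φ Ψ q} (hs : SmoothSectionAt 3 s p)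
    (ht : SmoothSectionAt 3 t p) :
    ContMDiffAt (𝓡 3) 𝓘(ℝ, ℂ) ∞ (fun q => inner ℂ (s q) (t q)) p := by
  refine liftedSection_induction
    (fun s => ContMDiffAt (𝓡 3) 𝓘(ℝ, ℂ) ∞ (fun q => inner ℂ (s q) (t q)) p) ?_ ?_ ?_ ?_ hs
  · intro s s' _ h hQ
    exact hQ.congr_of_eventuallyEq (h.mono fun q hq => by simp only [hq])
  · intro s s' _ _ h1 h2
    simp only [inner_add_left]
    exact h1.add h2
  · intro g s hg _ h
    simp only [inner_real_smul_left]
    exact hg.smul h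
  intro ξ hξ
  refine liftedSection_induction
    (fun t => ContMDiffAt (𝓡 3) 𝓘(ℝ, ℂ) ∞ (fun q => inner ℂ (liftSection φ ξ q) (t q)) p)
    ?_ ?_ ?_ ?_ ht
  · intro s s' _ h hQ
    exact hQ.congr_of_eventuallyEq (h.mono fun q hq => by simp only [hq])
  · intro s s' _ _ h1 h2
    simp only [inner_add_right]
    exact h1.add h2
  · intro g s hg _ h
    simp only [inner_real_smul_right]
    exact hg.smul h
  · intro η hη
    exact ContMDiffAt.comp (g := fun y => (inner ℂ (ξ y) (η y) : ℂ)) p (hinner ξ η _ hξ hη)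
      φ.contMDiff.contMDiffAt

/-- Both sides obey the same Leibniz rule in each argument, so `liftedSection_induction`, applied to
one argument and then the other, reduces the claim to lifts, where it is the chain rule. -/
theorem inducedConnection_metric (h : IsCovariantDerivativeOn SpinorFiber nab Set.univ)
    (hinner : ∀ (ξ η : Π y : N, Ψ y) (y : N), SmoothSectionAt 2 ξ y → SmoothSectionAt 2 η y →
      ContMDiffAt (𝓡 2) 𝓘(ℝ, ℂ) ∞ (fun z => inner ℂ (ξ z) (η z)) y)
    (hmetric : ∀ (ξ η : Π y : N, Ψ y) (y : N) (Y : TangentSpace (𝓡 2) y),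
      SmoothSectionAt 2 ξ y → SmoothSectionAt 2 η y →
      mvfderiv (𝓡 2) (fun z => (inner ℂ (ξ z) (η z) : ℂ)) y Y
        = inner ℂ (nab ξ y Y) (η y) + inner ℂ (ξ y) (nab η y Y))
    {s t : Π q : M, LiftedBundle φ Ψ q} (hs : SmoothSectionAt 3 s p)
    (ht : SmoothSectionAt 3 t p) (X : TangentSpace (𝓡 3) p) :
    mvfderiv (𝓡 3) (fun q => (inner ℂ (s q) (t q) : ℂ)) p X
      = inner ℂ (inducedConnection φ nab s p X) (t p)
        + inner ℂ (s p) (inducedConnection φ nab t p X) := by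
  have hi := inducedConnection_isCovariantDerivativeOn (φ := φ) h
  have hd : ∀ {s t : Π q : M, LiftedBundle φ Ψ q}, SmoothSectionAt 3 s p → SmoothSectionAt 3 t p →
      MDifferentiableAt (𝓡 3) 𝓘(ℝ, ℂ) (fun q => (inner ℂ (s q) (t q) : ℂ)) p := fun hs ht =>
    (smooth_inner_lifted hinner hs ht).mdifferentiableAt (by simp)
  have hadd : ∀ {g g' : M → ℂ}, MDifferentiableAt (𝓡 3) 𝓘(ℝ, ℂ) g p →
      MDifferentiableAt (𝓡 3) 𝓘(ℝ, ℂ) g' p → mvfderiv (𝓡 3) (fun q => g q + g' q) p X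
        = mvfderiv (𝓡 3) g p X + mvfderiv (𝓡 3) g' p X :=
    fun hg hg' => congrArg (fun L => L X) (mvfderiv_add hg hg')
  have hsmul : ∀ {g : M → ℝ} {g' : M → ℂ}, MDifferentiableAt (𝓡 3) 𝓘(ℝ) g p →
      MDifferentiableAt (𝓡 3) 𝓘(ℝ, ℂ) g' p → mvfderiv (𝓡 3) (fun q => g q • g' q) p X
        = g p • mvfderiv (𝓡 3) g' p X + mvfderiv (𝓡 3) g p X • g' p :=
    fun hg hg' => congrArg (fun L => L X) (mvfderiv_smul hg hg')
  refine liftedSection_induction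
    (fun s => mvfderiv (𝓡 3) (fun q => (inner ℂ (s q) (t q) : ℂ)) p X
      = inner ℂ (inducedConnection φ nab s p X) (t p)
        + inner ℂ (s p) (inducedConnection φ nab t p X)) ?_ ?_ ?_ ?_ hs
  · intro s s' hs h hQ
    rw [mvfderiv_congr (h.mono fun q hq => by simp only [hq]; exact rfl),
      connection_congr hi hs.diffSectionAt h, h.self_of_nhds, hQ]
  · intro s s' hs hs' h1 h2
    simp only [inner_add_left]
    rw [hadd (hd hs ht) (hd hs' ht), h1, h2, connection_add hi hs.diffSectionAt hs'.diffSectionAt,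
      inner_add_left]
    ring
  · intro g s hg hs h1
    have hg' := hg.mdifferentiableAt (by simp)
    simp only [inner_real_smul_left]
    rw [hsmul hg' (hd hs ht), h1, connection_smul hi hg' hs.diffSectionAt, inner_add_left,
      inner_real_smul_left, inner_real_smul_left]
    module
  intro ξ hξ
  refine liftedSection_induction
    (fun t => mvfderiv (𝓡 3) (fun q => (inner ℂ (liftSection φ ξ q) (t q) : ℂ)) p X
      = inner ℂ (inducedConnection φ nab (liftSection φ ξ) p X) (t p)
        + inner ℂ (liftSection φ ξ p) (inducedConnection φ nab t p X)) ?_ ?_ ?_ ?_ ht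
  · intro s s' hs h hQ
    rw [mvfderiv_congr (h.mono fun q hq => by simp only [hq]; exact rfl),
      connection_congr hi hs.diffSectionAt h, h.self_of_nhds, hQ]
  · intro s s' hs hs' h1 h2
    simp only [inner_add_right]
    rw [hadd (hd hξ.liftSection hs) (hd hξ.liftSection hs'), h1, h2,
      connection_add hi hs.diffSectionAt hs'.diffSectionAt, inner_add_right]
    ring
  · intro g s hg hs h1
    have hg' := hg.mdifferentiableAt (by simp)
    simp only [inner_real_smul_right]
    rw [hsmul hg' (hd hξ.liftSection hs), h1, connection_smul hi hg' hs.diffSectionAt,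
      inner_add_right, inner_real_smul_right, inner_real_smul_right]
    module
  · intro η hη
    rw [inducedConnection_liftSection h hξ.diffSectionAt,
      inducedConnection_liftSection h hη.diffSectionAt]
    exact (mvfderiv_comp_mfderiv (f := fun y => (inner ℂ (ξ y) (η y) : ℂ))
      ((hinner ξ η _ hξ hη).mdifferentiableAt (by simp))
      (φ.contMDiff.contMDiffAt.mdifferentiableAt (by simp)) X).trans (hmetric ξ η _ _ hξ hη)

end LiftedSections

/-! ### The spin operator is parallel -/

section Base

variable {N : Type*} [TopologicalSpace N] [ChartedSpace (Euc 2) N] [IsManifold (𝓡 2) ∞ N]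
  [RiemannianBundle (fun y : N => TangentSpace (𝓡 2) y)]
  [IsContMDiffRiemannianBundle (𝓡 2) ∞ (Euc 2) (fun y : N => TangentSpace (𝓡 2) y)]
  {oN : ManifoldOrientation 2 N}
  {DN : CovariantDerivative (𝓡 2) (Euc 2) (TangentSpace (𝓡 2) : N → Type _)}
  {Ψ : N → Type*} [∀ y, NormedAddCommGroup (Ψ y)] [∀ y, InnerProductSpace ℂ (Ψ y)]
  [TopologicalSpace (TotalSpace SpinorFiber Ψ)] [FiberBundle SpinorFiber Ψ]
  {σ : Π y : N, CotangentSpace 2 y →ₗ[ℝ] Module.End ℂ (Ψ y)}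
  {nab : (Π y : N, Ψ y) → Π y : N, TangentSpace (𝓡 2) y →L[ℝ] Ψ y}
  {f : Fin 2 → Π y : N, TangentSpace (𝓡 2) y} {y : N}

theorem IsOrientedFrameNear.isOrientedPair (hf : IsOrientedFrameNear oN f y) :
    IsOrientedPair oN (fun i => f i y) :=
  hf.self_of_nhds.2

theorem IsOrientedFrameNear.smoothFieldAt (hf : IsOrientedFrameNear oN f y) (i : Fin 2) :
    SmoothFieldAt (f i) y :=
  hf.self_of_nhds.1 i

theorem IsOrientedFrameNear.eventually (hf : IsOrientedFrameNear oN f y) :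
    ∀ᶠ z in nhds y, IsOrientedFrameNear oN f z :=
  eventually_eventually_nhds.2 hf

theorem IsOrientedFrameNear.covariantDerivative_zero (hf : IsOrientedFrameNear oN f y)
    (hN : IsLeviCivita DN) (Y : TangentSpace (𝓡 2) y) :
    DN (f 0) y Y = (inner ℝ (DN (f 0) y Y) (f 1 y) : ℝ) • f 1 y := by
  have hs := hf.isOrthonormalFrameNear.inner_covariantDerivative hN 0 0 Y
  conv_lhs => rw [hf.isOrientedPair.eq_sum (DN (f 0) y Y)]
  rw [real_inner_comm, show inner ℝ (DN (f 0) y Y) (f 0 y) = (0 : ℝ) by linarith, zero_smul,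
    zero_add, real_inner_comm]

theorem IsOrientedFrameNear.covariantDerivative_one (hf : IsOrientedFrameNear oN f y)
    (hN : IsLeviCivita DN) (Y : TangentSpace (𝓡 2) y) :
    DN (f 1) y Y = -(inner ℝ (DN (f 0) y Y) (f 1 y) : ℝ) • f 0 y := by
  have hs := hf.isOrthonormalFrameNear.inner_covariantDerivative hN
  have h1 := hs 1 1 Y
  conv_lhs => rw [hf.isOrientedPair.eq_sum (DN (f 1) y Y)]
  rw [real_inner_comm, real_inner_comm _ (f 1 y),
    show inner ℝ (DN (f 1) y Y) (f 1 y) = (0 : ℝ) by linarith, zero_smul, add_zero, hs 1 0]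

theorem IsSpinorBundle.smooth_flat (hσ : IsSpinorBundle σ) {v : Π y : N, TangentSpace (𝓡 2) y}
    (hv : SmoothFieldAt v y) {ξ : Π y : N, Ψ y} (hξ : SmoothSectionAt 2 ξ y) :
    SmoothSectionAt 2 (fun z => σ z (flat (v z)) (ξ z)) y :=
  hσ.smooth _ ξ y hv.flat hξ

theorem IsSpincConnection.clifford_flat (hnab : IsSpincConnection DN σ nab) (hN : IsLeviCivita DN)
    {v : Π y : N, TangentSpace (𝓡 2) y} (hv : SmoothFieldAt v y) {ξ : Π y : N, Ψ y}
    (hξ : SmoothSectionAt 2 ξ y) (Y : TangentSpace (𝓡 2) y) :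
    nab (fun z => σ z (flat (v z)) (ξ z)) y Y
      = σ y (flat (v y)) (nab ξ y Y) + σ y (flat (DN v y Y)) (ξ y) := by
  rw [← hN.covDerivForm_flat hv.mdifferentiableAt, ← hnab.clifford _ ξ y Y hv.flat hξ]
  abel

variable [VectorBundle ℂ SpinorFiber Ψ] [VectorBundle ℝ SpinorFiber Ψ]

theorem IsOrientedFrameNear.spinOperator_apply (hf : IsOrientedFrameNear oN f y)
    (hσ : IsSpinorBundle σ) (ξ : Ψ y) :
    spinOperator oN σ y ξ = -Complex.I • σ y (flat (f 0 y)) (σ y (flat (f 1 y)) ξ) :=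
  _root_.spinOperator_apply hσ hf.isOrientedPair ξ

theorem IsSpinorBundle.smooth_spin (hσ : IsSpinorBundle σ) {ξ : Π y : N, Ψ y}
    (hξ : SmoothSectionAt 2 ξ y) : SmoothSectionAt 2 (fun z => spinOperator oN σ z (ξ z)) y := by
  obtain ⟨f, hf⟩ := exists_orientedFrame oN y
  refine ((hσ.smooth_flat (hf.smoothFieldAt 0) (hσ.smooth_flat (hf.smoothFieldAt 1)
    hξ)).const_smul (-Complex.I)).congr ?_
  filter_upwards [hf.eventually] with z hz
  exact hz.spinOperator_apply hσ (ξ z)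

/-- The spin operator is parallel. -/
theorem IsSpincConnection.spin (hnab : IsSpincConnection DN σ nab) (hN : IsLeviCivita DN)
    (hσ : IsSpinorBundle σ) {ξ : Π y : N, Ψ y} (hξ : SmoothSectionAt 2 ξ y)
    (Y : TangentSpace (𝓡 2) y) :
    nab (fun z => spinOperator oN σ z (ξ z)) y Y = spinOperator oN σ y (nab ξ y Y) := by
  obtain ⟨f, hf⟩ := exists_orientedFrame oN y
  have h1 := hσ.smooth_flat (hf.smoothFieldAt 1) hξ
  have h0 := hσ.smooth_flat (hf.smoothFieldAt 0) h1
  have hn := hnab.isCovariantDerivative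
  -- The factor -i is split into -1 and i: the connection is assumed to commute with i, and with
  -- real constants by the Leibniz rule.
  have h2 : ∀ᶠ z in nhds y, spinOperator oN σ z (ξ z)
      = (-1 : ℝ) • Complex.I • σ z (flat (f 0 z)) (σ z (flat (f 1 z)) (ξ z)) := by
    filter_upwards [hf.eventually] with z hz
    rw [hz.spinOperator_apply hσ, neg_smul, neg_smul, one_smul]
  have h3 : SmoothSectionAt 2
      (fun z => (-1 : ℝ) • Complex.I • σ z (flat (f 0 z)) (σ z (flat (f 1 z)) (ξ z))) y :=
    SmoothSectionAt.smul contMDiffAt_const (h0.const_smul Complex.I)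
  -- With connection form ω, Df₀ = ωf₁ and Df₁ = -ωf₀, so the derivative of σ(f₀)σ(f₁) is ω(σ(f₁)² -
  -- σ(f₀)²) = 0.
  rw [connection_congr hn h3.diffSectionAt h2,
    connection_const_smul hn _ (h0.const_smul Complex.I).diffSectionAt, hnab.map_I_smul _ _ _ h0,
    hnab.clifford_flat hN (hf.smoothFieldAt 0) h1, hnab.clifford_flat hN (hf.smoothFieldAt 1) hξ,
    hf.covariantDerivative_zero hN, hf.covariantDerivative_one hN, clifford_flat_smul,
    clifford_flat_smul, hf.spinOperator_apply hσ, map_add, map_smul,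
    hσ.apply_self hf.isOrientedPair, hσ.apply_self hf.isOrientedPair]
  module

end Base

/-! ### Pauli relations -/

section PauliTriple

/-- The relations of the Pauli matrices. -/
structure IsPauliTriple {W : Type*} [NormedAddCommGroup W] [InnerProductSpace ℂ W]
    (A B C : Module.End ℂ W) : Prop where
  zero_zero : ∀ s, A (A s) = s
  one_one : ∀ s, B (B s) = s
  two_two : ∀ s, C (C s) = s
  one_zero : ∀ s, B (A s) = -A (B s)
  two_zero : ∀ s, C (A s) = Complex.I • B s
  two_one : ∀ s, C (B s) = -Complex.I • A s
  zero_two : ∀ s, A (C s) = -Complex.I • B s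
  one_two : ∀ s, B (C s) = Complex.I • A s
  two_eq : ∀ s, C s = -Complex.I • A (B s)
  symm_zero : A.IsSymmetric
  symm_one : B.IsSymmetric
  symm_two : C.IsSymmetric

end PauliTriple

/-! ### The lifted Clifford action in an adapted frame -/

section Lifted

variable {M : Type*} [TopologicalSpace M] [ChartedSpace (Euc 3) M]
  {N : Type*} [TopologicalSpace N] [ChartedSpace (Euc 2) N]
  [RiemannianBundle (fun x : M => TangentSpace (𝓡 3) x)]
  [RiemannianBundle (fun y : N => TangentSpace (𝓡 2) y)]
  {φ : C^∞⟮𝓡 3, M; 𝓡 2, N⟯}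
  [IsManifold (𝓡 3) ∞ M] [IsManifold (𝓡 2) ∞ N]
  [IsContMDiffRiemannianBundle (𝓡 3) ∞ (Euc 3) (fun x : M => TangentSpace (𝓡 3) x)]
  [IsContMDiffRiemannianBundle (𝓡 2) ∞ (Euc 2) (fun y : N => TangentSpace (𝓡 2) y)]
  {oM : ManifoldOrientation 3 M} {oN : ManifoldOrientation 2 N}
  {DM : CovariantDerivative (𝓡 3) (Euc 3) (TangentSpace (𝓡 3) : M → Type _)}
  {DN : CovariantDerivative (𝓡 2) (Euc 2) (TangentSpace (𝓡 2) : N → Type _)}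
  {f : Fin 2 → Π y : N, TangentSpace (𝓡 2) y} {e : Fin 3 → Π p : M, TangentSpace (𝓡 3) p}
  {Ψ : N → Type*} [∀ y, NormedAddCommGroup (Ψ y)] [∀ y, InnerProductSpace ℂ (Ψ y)]
  {σ : Π y : N, CotangentSpace 2 y →ₗ[ℝ] Module.End ℂ (Ψ y)}
  {nab : (Π y : N, Ψ y) → Π y : N, TangentSpace (𝓡 2) y →L[ℝ] Ψ y}
  {p : M}

/-- An endomorphism of a fiber of `Ψ` as an endomorphism of a fiber of the induced bundle. -/
noncomputable def liftEnd (φ : C^∞⟮𝓡 3, M; 𝓡 2, N⟯) (p : M) (T : Module.End ℂ (Ψ (φ p))) :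
    Module.End ℂ (LiftedBundle φ Ψ p) :=
  T

/-- Under the musical isomorphisms, composing a covector with the adjoint of φ_* becomes applying
φ_* to the vector. -/
theorem descend_flat (u : TangentSpace (𝓡 3) p) : descend φ p (flat u) = flat (diff φ p u) := by
  have h := (onb (n := 3) p).sum_repr' u
  have h2 : flat (diff φ p u) = flat (diff φ p (∑ i, (inner ℝ (onb p i) u : ℝ) • onb p i)) := by
    rw [h]
  rw [h2, map_sum, flat_sum, descend]
  refine Finset.sum_congr rfl fun i _ => ?_
  rw [map_smul, flat_smul, flat_apply, real_inner_comm]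

namespace IsAdaptedFrame

theorem liftClifford_flat (h : IsAdaptedFrame oM oN φ f e p) (u : TangentSpace (𝓡 3) p) :
    liftClifford oM oN φ σ p (flat u) = liftEnd φ p (σ (φ p) (flat (diff φ p u)))
      + (inner ℝ (e 2 p) u : ℝ) • liftEnd φ p (spinOperator oN σ (φ p)) := by
  rw [← descend_flat, real_inner_comm, ← cometric_flat, ← h.nuForm_eq]
  rfl

theorem liftClifford_zero (h : IsAdaptedFrame oM oN φ f e p) :
    liftClifford oM oN φ σ p (flat (e 0 p)) = liftEnd φ p (σ (φ p) (flat (f 0 (φ p)))) := by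
  rw [h.liftClifford_flat, h.inner_total, if_neg (by decide), zero_smul, add_zero,
    h.lift_zero.self_of_nhds]

theorem liftClifford_one (h : IsAdaptedFrame oM oN φ f e p) :
    liftClifford oM oN φ σ p (flat (e 1 p)) = liftEnd φ p (σ (φ p) (flat (f 1 (φ p)))) := by
  rw [h.liftClifford_flat, h.inner_total, if_neg (by decide), zero_smul, add_zero,
    h.lift_one.self_of_nhds]

theorem liftClifford_two (h : IsAdaptedFrame oM oN φ f e p) :
    liftClifford oM oN φ σ p (flat (e 2 p)) = liftEnd φ p (spinOperator oN σ (φ p)) := by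
  have h0 : flat (0 : TangentSpace (𝓡 2) (φ p)) = 0 := map_zero (innerSL ℝ)
  rw [h.liftClifford_flat, h.inner_total, if_pos rfl, one_smul, h.vertical.self_of_nhds, h0,
    map_zero]
  exact zero_add _

theorem flat_eq_sum (h : IsAdaptedFrame oM oN φ f e p) (α : CotangentSpace 3 p) :
    α = α (e 0 p) • flat (e 0 p) + α (e 1 p) • flat (e 1 p) + α (e 2 p) • flat (e 2 p) := by
  conv_lhs => rw [← flat_sharp α, h.eq_sum_total (sharp α)]
  simp only [flat_add, flat_smul, real_inner_comm (sharp α), inner_sharp]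

theorem liftClifford_eq (h : IsAdaptedFrame oM oN φ f e p) (α : CotangentSpace 3 p)
    (s : LiftedBundle φ Ψ p) :
    liftClifford oM oN φ σ p α s
      = α (e 0 p) • liftEnd φ p (σ (φ p) (flat (f 0 (φ p)))) s
      + α (e 1 p) • liftEnd φ p (σ (φ p) (flat (f 1 (φ p)))) s
      + α (e 2 p) • liftEnd φ p (spinOperator oN σ (φ p)) s := by
  conv_lhs => rw [h.flat_eq_sum α]
  simp only [map_add, map_smul, h.liftClifford_zero, h.liftClifford_one, h.liftClifford_two]
  rfl

variable [TopologicalSpace (TotalSpace SpinorFiber Ψ)] [FiberBundle SpinorFiber Ψ]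
  [VectorBundle ℂ SpinorFiber Ψ]

theorem isPauliTriple (h : IsAdaptedFrame oM oN φ f e p) (hσ : IsSpinorBundle σ) :
    IsPauliTriple (liftEnd φ p (σ (φ p) (flat (f 0 (φ p)))))
      (liftEnd φ p (σ (φ p) (flat (f 1 (φ p))))) (liftEnd φ p (spinOperator oN σ (φ p))) where
  zero_zero := hσ.apply_self h.base.isOrientedPair 0
  one_one := hσ.apply_self h.base.isOrientedPair 1
  two_two := hσ.spin_spin
  one_zero := hσ.apply_one_zero h.base.isOrientedPair
  two_zero := hσ.spin_apply_zero h.base.isOrientedPair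
  two_one := hσ.spin_apply_one h.base.isOrientedPair
  zero_two := hσ.apply_zero_spin h.base.isOrientedPair
  one_two := hσ.apply_one_spin h.base.isOrientedPair
  two_eq := spinOperator_apply hσ h.base.isOrientedPair
  symm_zero := hσ.isSymmetric _ _
  symm_one := hσ.isSymmetric _ _
  symm_two := hσ.spin_isSymmetric

variable [VectorBundle ℝ SpinorFiber Ψ] [ContMDiffVectorBundle ∞ SpinorFiber Ψ (𝓡 2)]

theorem smooth_base_action (h : IsAdaptedFrame oM oN φ f e p) (hσ : IsSpinorBundle σ) (i : Fin 2)
    {s : Π q : M, LiftedBundle φ Ψ q} (hs : SmoothSectionAt 3 s p) :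
    SmoothSectionAt 3 (fun q => liftEnd φ q (σ (φ q) (flat (f i (φ q)))) (s q)) p :=
  hs.liftMap (T := fun y => (σ y (flat (f i y))).restrictScalars ℝ) fun _ hξ =>
    hσ.smooth_flat (h.smooth_base i) hξ

theorem induced_zero (h : IsAdaptedFrame oM oN φ f e p) (hσ : IsSpinorBundle σ)
    (hnab : IsSpincConnection DN σ nab) (hN : IsLeviCivita DN)
    {s : Π q : M, LiftedBundle φ Ψ q} (hs : SmoothSectionAt 3 s p) (X : TangentSpace (𝓡 3) p) :
    inducedConnection φ nab (fun q => liftEnd φ q (σ (φ q) (flat (f 0 (φ q)))) (s q)) p X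
      = liftEnd φ p (σ (φ p) (flat (f 0 (φ p)))) (inducedConnection φ nab s p X)
        + (inner ℝ (DN (f 0) (φ p) (diff φ p X)) (f 1 (φ p)) : ℝ) •
          liftEnd φ p (σ (φ p) (flat (f 1 (φ p)))) (s p) := by
  refine inducedConnection_liftMap hnab.isCovariantDerivative
    (T := fun y => (σ y (flat (f 0 y))).restrictScalars ℝ)
    (R := (inner ℝ (DN (f 0) (φ p) (diff φ p X)) (f 1 (φ p)) : ℝ) •
      (σ (φ p) (flat (f 1 (φ p)))).restrictScalars ℝ)
    (fun _ hξ => hσ.smooth_flat (h.smooth_base 0) hξ) (fun ξ hξ => ?_) hs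
  refine (hnab.clifford_flat hN (h.smooth_base 0) hξ _).trans ?_
  have h0 := congrArg (fun v => σ (φ p) (flat v) (ξ (φ p)))
    (h.base.covariantDerivative_zero hN (diff φ p X))
  simp only [clifford_flat_smul, Complex.coe_smul] at h0
  rw [h0]
  rfl

theorem induced_one (h : IsAdaptedFrame oM oN φ f e p) (hσ : IsSpinorBundle σ)
    (hnab : IsSpincConnection DN σ nab) (hN : IsLeviCivita DN)
    {s : Π q : M, LiftedBundle φ Ψ q} (hs : SmoothSectionAt 3 s p) (X : TangentSpace (𝓡 3) p) :
    inducedConnection φ nab (fun q => liftEnd φ q (σ (φ q) (flat (f 1 (φ q)))) (s q)) p X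
      = liftEnd φ p (σ (φ p) (flat (f 1 (φ p)))) (inducedConnection φ nab s p X)
        + (-(inner ℝ (DN (f 0) (φ p) (diff φ p X)) (f 1 (φ p)) : ℝ)) •
          liftEnd φ p (σ (φ p) (flat (f 0 (φ p)))) (s p) := by
  refine inducedConnection_liftMap hnab.isCovariantDerivative
    (T := fun y => (σ y (flat (f 1 y))).restrictScalars ℝ)
    (R := (-(inner ℝ (DN (f 0) (φ p) (diff φ p X)) (f 1 (φ p)) : ℝ)) •
      (σ (φ p) (flat (f 0 (φ p)))).restrictScalars ℝ)
    (fun _ hξ => hσ.smooth_flat (h.smooth_base 1) hξ) (fun ξ hξ => ?_) hs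
  refine (hnab.clifford_flat hN (h.smooth_base 1) hξ _).trans ?_
  rw [h.base.covariantDerivative_one hN, clifford_flat_smul, Complex.coe_smul]
  rfl

end IsAdaptedFrame

variable [TopologicalSpace (TotalSpace SpinorFiber Ψ)] [FiberBundle SpinorFiber Ψ]
  [VectorBundle ℂ SpinorFiber Ψ]
variable [VectorBundle ℝ SpinorFiber Ψ] [ContMDiffVectorBundle ∞ SpinorFiber Ψ (𝓡 2)]

theorem SmoothSectionAt.liftEnd_spin (hσ : IsSpinorBundle σ)
    {s : Π q : M, LiftedBundle φ Ψ q} (hs : SmoothSectionAt 3 s p) :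
    SmoothSectionAt 3 (fun q => liftEnd φ q (spinOperator oN σ (φ q)) (s q)) p :=
  hs.liftMap (T := fun y => (spinOperator oN σ y).restrictScalars ℝ) fun _ hξ => hσ.smooth_spin hξ

theorem inducedConnection_spin (hσ : IsSpinorBundle σ)
    (hnab : IsSpincConnection DN σ nab) (hN : IsLeviCivita DN)
    {s : Π q : M, LiftedBundle φ Ψ q} (hs : SmoothSectionAt 3 s p) (X : TangentSpace (𝓡 3) p) :
    inducedConnection φ nab (fun q => liftEnd φ q (spinOperator oN σ (φ q)) (s q)) p X
      = liftEnd φ p (spinOperator oN σ (φ p)) (inducedConnection φ nab s p X) := by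
  refine (inducedConnection_liftMap hnab.isCovariantDerivative
    (T := fun y => (spinOperator oN σ y).restrictScalars ℝ) (R := 0)
    (fun _ hξ => hσ.smooth_spin hξ) (fun ξ hξ => ?_) hs).trans (add_zero _)
  exact (hnab.spin hN hσ hξ _).trans (add_zero _).symm

/-- Complex linearity is not part of the real definition of the induced connection; it is inherited
from the base as the parallelism of multiplication by i. -/
theorem inducedConnection_I_smul (hnab : IsSpincConnection DN σ nab)
    {s : Π q : M, LiftedBundle φ Ψ q} (hs : SmoothSectionAt 3 s p) (X : TangentSpace (𝓡 3) p) :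
    inducedConnection φ nab (fun q => Complex.I • s q) p X
      = Complex.I • inducedConnection φ nab s p X := by
  refine (inducedConnection_liftMap hnab.isCovariantDerivative
    (T := fun y => (Complex.I • (1 : Module.End ℂ (Ψ y))).restrictScalars ℝ) (R := 0)
    (fun _ hξ => hξ.const_smul Complex.I) (fun ξ hξ => ?_) hs).trans (add_zero _)
  exact (hnab.map_I_smul ξ _ _ hξ).trans (add_zero _).symm

end Lifted

/-! ### The lifted bundle and the corrected connections -/

section LiftedConnection

variable {M : Type*} [TopologicalSpace M] [ChartedSpace (Euc 3) M]
  {N : Type*} [TopologicalSpace N] [ChartedSpace (Euc 2) N]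
  [RiemannianBundle (fun x : M => TangentSpace (𝓡 3) x)]
  [RiemannianBundle (fun y : N => TangentSpace (𝓡 2) y)]
  {φ : C^∞⟮𝓡 3, M; 𝓡 2, N⟯}
  [IsManifold (𝓡 3) ∞ M] [IsManifold (𝓡 2) ∞ N]
  [IsContMDiffRiemannianBundle (𝓡 3) ∞ (Euc 3) (fun x : M => TangentSpace (𝓡 3) x)]
  [IsContMDiffRiemannianBundle (𝓡 2) ∞ (Euc 2) (fun y : N => TangentSpace (𝓡 2) y)]
  {oM : ManifoldOrientation 3 M} {oN : ManifoldOrientation 2 N}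
  {DM : CovariantDerivative (𝓡 3) (Euc 3) (TangentSpace (𝓡 3) : M → Type _)}
  {DN : CovariantDerivative (𝓡 2) (Euc 2) (TangentSpace (𝓡 2) : N → Type _)}
  {f : Fin 2 → Π y : N, TangentSpace (𝓡 2) y} {e : Fin 3 → Π p : M, TangentSpace (𝓡 3) p}
  {Ψ : N → Type*} [∀ y, NormedAddCommGroup (Ψ y)] [∀ y, InnerProductSpace ℂ (Ψ y)]
  [TopologicalSpace (TotalSpace SpinorFiber Ψ)] [FiberBundle SpinorFiber Ψ]
  [VectorBundle ℂ SpinorFiber Ψ] [VectorBundle ℝ SpinorFiber Ψ]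
  [ContMDiffVectorBundle ∞ SpinorFiber Ψ (𝓡 2)]
  {σ : Π y : N, CotangentSpace 2 y →ₗ[ℝ] Module.End ℂ (Ψ y)}
  {nab : (Π y : N, Ψ y) → Π y : N, TangentSpace (𝓡 2) y →L[ℝ] Ψ y}
  {p : M}

/-- Products of the spin operator with σ_N are trace-free and its square has trace 2, so the
horizontal and vertical parts contribute separately, as they do to ⟨u, v⟩. -/
theorem IsSpinorBundle.liftClifford_trace_mul (hσ : IsSpinorBundle σ)
    (h : IsAdaptedFrame oM oN φ f e p) (u v : TangentSpace (𝓡 3) p) :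
    LinearMap.trace ℂ (LiftedBundle φ Ψ p) (liftClifford oM oN φ σ p (flat u)
      * liftClifford oM oN φ σ p (flat v)) = (2 * (inner ℝ u v : ℝ) : ℂ) := by
  have key : ∀ (P Q S : Module.End ℂ (Ψ (φ p))) (a b : ℝ), LinearMap.trace ℂ _ (P * S) = 0 →
      LinearMap.trace ℂ _ (S * Q) = 0 → LinearMap.trace ℂ _ (S * S) = 2 →
      LinearMap.trace ℂ _ ((P + a • S) * (Q + b • S))
        = LinearMap.trace ℂ _ (P * Q) + (2 * (a * b : ℝ) : ℂ) := by
    intro P Q S a b h1 h2 h3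
    simp only [← Complex.coe_smul, add_mul, mul_add, smul_mul_assoc, mul_smul_comm, map_add,
      map_smul, h1, h2, h3]
    push_cast
    simp only [smul_eq_mul]
    ring
  have h1 := key (σ (φ p) (flat (diff φ p u))) (σ (φ p) (flat (diff φ p v)))
    (spinOperator oN σ (φ p)) (inner ℝ (e 2 p) u) (inner ℝ (e 2 p) v)
    (hσ.trace_spin_apply _).2 (hσ.trace_spin_apply _).1 hσ.trace_spin_spin
  rw [h.liftClifford_flat, h.liftClifford_flat]
  refine h1.trans ?_
  have h2 := hσ.isometry (φ p) (flat (diff φ p u)) (flat (diff φ p v))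
  have h3 : (inner ℝ u v : ℝ) = inner ℝ (diff φ p u) (diff φ p v)
      + inner ℝ (e 2 p) u * inner ℝ (e 2 p) v := by
    conv_lhs => rw [h.eq_sum_total u]
    conv_rhs => rw [h.diff_eq u]
    simp only [inner_add_left, real_inner_smul_left, h.inner_base_diff_zero,
      h.inner_base_diff_one]
  rw [cometric_flat] at h2
  rw [h3]
  push_cast
  linear_combination 2 * h2

theorem IsSpinorBundle.lift (hσ : IsSpinorBundle σ) (hφ : IsRiemannianSubmersion φ) :
    IsSpinorBundle (liftClifford oM oN φ σ) where
  smooth_inner _ _ _ hs ht := smooth_inner_lifted hσ.smooth_inner hs ht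
  isSymmetric p α s t := by
    obtain ⟨f, e, h⟩ := hφ.exists_adaptedFrame oM oN p
    have hP := h.isPauliTriple hσ
    simp only [h.liftClifford_eq, inner_add_left, inner_add_right, inner_real_smul_left,
      inner_real_smul_right]
    rw [hP.symm_zero, hP.symm_one, hP.symm_two]
  trace_eq_zero p α := by
    have h1 : LinearMap.trace ℂ _ (σ (φ p) (descend φ p α)
        + (cometric α (nuForm oM oN φ p)) • spinOperator oN σ (φ p)) = 0 := by
      rw [map_add, hσ.trace_eq_zero, ← Complex.coe_smul, map_smul, hσ.trace_spin, smul_zero,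
        add_zero]
    exact h1
  isometry p α β := by
    obtain ⟨f, e, h⟩ := hφ.exists_adaptedFrame oM oN p
    rw [← flat_sharp α, ← flat_sharp β, hσ.liftClifford_trace_mul h, cometric_flat]
    ring
  smooth α s p hα hs := by
    obtain ⟨f, e, h⟩ := hφ.exists_adaptedFrame oM oN p
    have ha := fun i => hα.apply (h.smooth_total i)
    refine (((SmoothSectionAt.smul (ha 0) (h.smooth_base_action hσ 0 hs)).add
      (SmoothSectionAt.smul (ha 1) (h.smooth_base_action hσ 1 hs))).add
      (SmoothSectionAt.smul (ha 2) (hs.liftEnd_spin (oN := oN) hσ))).congr ?_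
    filter_upwards [h.eventually] with q hq
    exact hq.liftClifford_eq (α q) (s q)

/-- The coefficients of the Pauli triple and of the identity in the difference of the corrected
connection and the induced connection. -/
noncomputable def spinCoeff
    (D : CovariantDerivative (𝓡 3) (Euc 3) (TangentSpace (𝓡 3) : M → Type _))
    (e : Fin 3 → Π p : M, TangentSpace (𝓡 3) p) (ε : ℝ) (p : M) (X : TangentSpace (𝓡 3) p) :
    Fin 4 → ℝ :=
  ![(inner ℝ (e 2 p) X * bend D e 1 p + inner ℝ (e 0 p) X * (twist D e p / 2)) / 2,
    -((inner ℝ (e 2 p) X * bend D e 0 p - inner ℝ (e 1 p) X * (twist D e p / 2)) / 2),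
    -(inner ℝ (e 2 p) X * twist D e p / 4),
    -(ε * (-(inner ℝ (e 0 p) X * bend D e 1 p) + inner ℝ (e 1 p) X * bend D e 0 p
      + inner ℝ (e 2 p) X * twist D e p / 2) / 2)]

theorem IsAdaptedFrame.contMDiffAt_spinCoeff (h : IsAdaptedFrame oM oN φ f e p)
    (hM : IsLeviCivita DM) (ε : ℝ) {X : Π q : M, TangentSpace (𝓡 3) q} (hX : SmoothFieldAt X p)
    (i : Fin 4) : ContMDiffAt (𝓡 3) 𝓘(ℝ) ∞ (fun q => spinCoeff DM e ε q (X q) i) p := by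
  have hx := fun j => (h.smooth_total j).inner hX
  have hb := fun j => h.contMDiffAt_bend hM j
  have ht := h.contMDiffAt_twist hM
  have hh := ht.div_const (2 : ℝ)
  fin_cases i
  · exact (((hx 2).mul (hb 1)).add ((hx 0).mul hh)).div_const 2
  · exact ((((hx 2).mul (hb 0)).sub ((hx 1).mul hh)).div_const 2).neg
  · exact (((hx 2).mul ht).div_const 4).neg
  · exact ((contMDiffAt_const.mul ((((hx 0).mul (hb 1)).neg.add ((hx 1).mul (hb 0))).add
      (((hx 2).mul ht).div_const 2))).div_const 2).neg

/-- Writing D_Xν as αe₀ + βe₁, the relations CA = iB and CB = -iA turn -½σ(ν)σ(D_Xν) into i(βA -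
αB)/2. The other two corrections are multiples of iC and of i. -/
theorem IsAdaptedFrame.correctedConnection_eq (h : IsAdaptedFrame oM oN φ f e p)
    (hσ : IsSpinorBundle σ)
    (hM : IsLeviCivita DM) (ε : ℝ) (s : Π q : M, LiftedBundle φ Ψ q) (X : TangentSpace (𝓡 3) p) :
    correctedConnection oM oN DM φ σ nab ε s p X = inducedConnection φ nab s p X
      + Complex.I • (spinCoeff DM e ε p X 0 • liftEnd φ p (σ (φ p) (flat (f 0 (φ p)))) (s p)
        + spinCoeff DM e ε p X 1 • liftEnd φ p (σ (φ p) (flat (f 1 (φ p)))) (s p)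
        + spinCoeff DM e ε p X 2 • liftEnd φ p (spinOperator oN σ (φ p)) (s p)
        + spinCoeff DM e ε p X 3 • s p) := by
  have hdef : correctedConnection oM oN DM φ σ nab ε s p X = inducedConnection φ nab s p X
      - (1 / 2 : ℂ) • liftClifford oM oN φ σ p (nuForm oM oN φ p)
        (liftClifford oM oN φ σ p (covDerivForm DM (nuForm oM oN φ) p X) (s p))
      - (Complex.I / 4 * (nuForm oM oN φ p X : ℂ)
        * (cometric (nuForm oM oN φ p) (starDNu oM oN φ p) : ℂ)) •
          liftClifford oM oN φ σ p (nuForm oM oN φ p) (s p)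
      - (starDNu oM oN φ p X - (1 / 2 * cometric (nuForm oM oN φ p) (starDNu oM oN φ p))
        * nuForm oM oN φ p X) • (ε * (Complex.I / 2) : ℂ) • s p := rfl
  have hP := h.isPauliTriple hσ
  rw [hdef, h.cometric_nuForm_starDNu hM, h.covDerivForm_nuForm hM, h.starDNu_eq hM, h.nuForm_eq,
    h.covariantDerivative_two hM, h.liftClifford_two, flat_add, flat_smul, flat_smul, map_add,
    map_smul, map_smul, h.liftClifford_zero, h.liftClifford_one]
  simp only [LinearMap.add_apply, LinearMap.smul_apply, map_add, ← Complex.coe_smul, map_smul,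
    hP.two_zero, hP.two_one, flat_apply, inner_add_left, real_inner_smul_left,
    spinCoeff, Matrix.cons_val]
  push_cast
  module

theorem IsAdaptedFrame.smooth_liftClifford (h : IsAdaptedFrame oM oN φ f e p)
    (hσ : IsSpinorBundle σ) (hφ : IsRiemannianSubmersion φ) (i : Fin 3)
    {s : Π q : M, LiftedBundle φ Ψ q} (hs : SmoothSectionAt 3 s p) :
    SmoothSectionAt 3 (fun q => liftClifford oM oN φ σ q (flat (e i q)) (s q)) p :=
  (hσ.lift hφ).smooth _ _ _ (h.smooth_total i).flat hs

theorem IsPauliTriple.zero_one {W : Type*} [NormedAddCommGroup W] [InnerProductSpace ℂ W]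
    {A B C : Module.End ℂ W} (h : IsPauliTriple A B C) (s : W) : A (B s) = Complex.I • C s := by
  rw [h.two_eq, smul_smul]
  simp

theorem IsAdaptedFrame.covariantDerivative_zero (h : IsAdaptedFrame oM oN φ f e p)
    (hM : IsLeviCivita DM) (hN : IsLeviCivita DN) (X : TangentSpace (𝓡 3) p) :
    DM (e 0) p X = (inner ℝ (DN (f 0) (φ p) (diff φ p X)) (f 1 (φ p))
        + inner ℝ (e 2 p) X * (twist DM e p / 2) : ℝ) • e 1 p
      + (-(inner ℝ (e 2 p) X * bend DM e 0 p - inner ℝ (e 1 p) X * (twist DM e p / 2)) : ℝ)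
        • e 2 p := by
  have h1 := h.inner_self hM 0 X
  have h2 := h.inner_covariantDerivative_zero hM hN X
  have h3 := h.inner_swap hM 0 2 X
  rw [h.covariantDerivative_two hM, inner_add_left, real_inner_smul_left, real_inner_smul_left,
    h.inner_total, h.inner_total] at h3
  rw [real_inner_comm] at h1 h2 h3
  rw [h.eq_sum_total (DM (e 0) p X), h1, h2, h3]
  simp

theorem IsAdaptedFrame.covariantDerivative_one (h : IsAdaptedFrame oM oN φ f e p)
    (hM : IsLeviCivita DM) (hN : IsLeviCivita DN) (X : TangentSpace (𝓡 3) p) :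
    DM (e 1) p X = (-(inner ℝ (DN (f 0) (φ p) (diff φ p X)) (f 1 (φ p))
        + inner ℝ (e 2 p) X * (twist DM e p / 2)) : ℝ) • e 0 p
      + (-(inner ℝ (e 2 p) X * bend DM e 1 p + inner ℝ (e 0 p) X * (twist DM e p / 2)) : ℝ)
        • e 2 p := by
  have h1 := h.inner_self hM 1 X
  have h2 := h.inner_swap hM 1 0 X
  rw [h.inner_covariantDerivative_zero hM hN X] at h2
  have h3 := h.inner_swap hM 1 2 X
  rw [h.covariantDerivative_two hM, inner_add_left, real_inner_smul_left, real_inner_smul_left,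
    h.inner_total, h.inner_total] at h3
  rw [real_inner_comm] at h1 h2 h3
  rw [h.eq_sum_total (DM (e 1) p X), h1, h2, h3]
  simp

/-- Commuting i(a₀A + a₁B + a₂C + a₃) with A leaves 2a₁C - 2a₂B, the part of D_X e₀ that the induced
connection does not produce. The remaining two frame vectors work alike, with the spin operator
parallel for the induced connection. -/
theorem IsAdaptedFrame.correctedConnection_clifford_zero (h : IsAdaptedFrame oM oN φ f e p)
    (hnab : IsSpincConnection DN σ nab) (hσ : IsSpinorBundle σ)
    (hM : IsLeviCivita DM) (hN : IsLeviCivita DN) (ε : ℝ)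
    {s : Π q : M, LiftedBundle φ Ψ q} (hs : SmoothSectionAt 3 s p) (X : TangentSpace (𝓡 3) p) :
    correctedConnection oM oN DM φ σ nab ε
        (fun q => liftClifford oM oN φ σ q (flat (e 0 q)) (s q)) p X
      = liftClifford oM oN φ σ p (flat (e 0 p)) (correctedConnection oM oN DM φ σ nab ε s p X)
        + liftClifford oM oN φ σ p (flat (DM (e 0) p X)) (s p) := by
  have hi := inducedConnection_isCovariantDerivativeOn (φ := φ) hnab.isCovariantDerivative
  have hP := h.isPauliTriple hσ
  have hI : Complex.I * Complex.I = -1 := Complex.I_mul_I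
  rw [h.correctedConnection_eq hσ hM, h.correctedConnection_eq hσ hM,
    connection_congr hi (h.smooth_base_action hσ 0 hs).diffSectionAt
      (h.eventually.mono fun q hq => by rw [hq.liftClifford_zero]) X,
    h.induced_zero hσ hnab hN hs, h.covariantDerivative_zero hM hN]
  simp only [flat_add, flat_smul, map_add, map_smul, h.liftClifford_zero, h.liftClifford_one,
    h.liftClifford_two, LinearMap.add_apply, LinearMap.smul_apply]
  generalize inducedConnection φ nab s p X = z
  generalize liftEnd φ p (σ (φ p) (flat (f 0 (φ p)))) = A at hP ⊢
  generalize liftEnd φ p (σ (φ p) (flat (f 1 (φ p)))) = B at hP ⊢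
  generalize liftEnd φ p (spinOperator oN σ (φ p)) = C at hP ⊢
  simp only [← Complex.coe_smul, map_smul, hP.one_zero, hP.zero_zero, hP.two_zero, hP.zero_two,
    hP.zero_one, spinCoeff, Matrix.cons_val]
  push_cast
  -- The coefficients are real-linear expressions in the components of X; only i² = -1 has to be
  -- supplied by hand.
  linear_combination (norm := module)
    ((inner ℝ (e 2 p) X * bend DM e 0 p - inner ℝ (e 1 p) X * (twist DM e p / 2) : ℂ) * hI)
      • C (s p)
    - ((inner ℝ (e 2 p) X * twist DM e p / 2 : ℂ) * hI)
      • B (s p)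

theorem IsAdaptedFrame.correctedConnection_clifford_one (h : IsAdaptedFrame oM oN φ f e p)
    (hnab : IsSpincConnection DN σ nab) (hσ : IsSpinorBundle σ)
    (hM : IsLeviCivita DM) (hN : IsLeviCivita DN) (ε : ℝ)
    {s : Π q : M, LiftedBundle φ Ψ q} (hs : SmoothSectionAt 3 s p) (X : TangentSpace (𝓡 3) p) :
    correctedConnection oM oN DM φ σ nab ε
        (fun q => liftClifford oM oN φ σ q (flat (e 1 q)) (s q)) p X
      = liftClifford oM oN φ σ p (flat (e 1 p)) (correctedConnection oM oN DM φ σ nab ε s p X)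
        + liftClifford oM oN φ σ p (flat (DM (e 1) p X)) (s p) := by
  have hi := inducedConnection_isCovariantDerivativeOn (φ := φ) hnab.isCovariantDerivative
  have hP := h.isPauliTriple hσ
  have hI : Complex.I * Complex.I = -1 := Complex.I_mul_I
  rw [h.correctedConnection_eq hσ hM, h.correctedConnection_eq hσ hM,
    connection_congr hi (h.smooth_base_action hσ 1 hs).diffSectionAt
      (h.eventually.mono fun q hq => by rw [hq.liftClifford_one]) X,
    h.induced_one hσ hnab hN hs, h.covariantDerivative_one hM hN]
  simp only [flat_add, flat_smul, map_add, map_smul, h.liftClifford_zero, h.liftClifford_one,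
    h.liftClifford_two, LinearMap.add_apply, LinearMap.smul_apply]
  generalize inducedConnection φ nab s p X = z
  generalize liftEnd φ p (σ (φ p) (flat (f 0 (φ p)))) = A at hP ⊢
  generalize liftEnd φ p (σ (φ p) (flat (f 1 (φ p)))) = B at hP ⊢
  generalize liftEnd φ p (spinOperator oN σ (φ p)) = C at hP ⊢
  simp only [← Complex.coe_smul, map_smul, hP.one_zero, hP.zero_one, hP.one_one, hP.two_one, hP.one_two,
    spinCoeff, Matrix.cons_val]
  push_cast
  linear_combination (norm := module)
    ((inner ℝ (e 2 p) X * bend DM e 1 p + inner ℝ (e 0 p) X * (twist DM e p / 2) : ℂ) * hI)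
      • C (s p)
    + ((inner ℝ (e 2 p) X * twist DM e p / 2 : ℂ) * hI)
      • A (s p)

theorem IsAdaptedFrame.correctedConnection_clifford_two (h : IsAdaptedFrame oM oN φ f e p)
    (hnab : IsSpincConnection DN σ nab) (hσ : IsSpinorBundle σ)
    (hM : IsLeviCivita DM) (hN : IsLeviCivita DN) (ε : ℝ)
    {s : Π q : M, LiftedBundle φ Ψ q} (hs : SmoothSectionAt 3 s p) (X : TangentSpace (𝓡 3) p) :
    correctedConnection oM oN DM φ σ nab ε
        (fun q => liftClifford oM oN φ σ q (flat (e 2 q)) (s q)) p X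
      = liftClifford oM oN φ σ p (flat (e 2 p)) (correctedConnection oM oN DM φ σ nab ε s p X)
        + liftClifford oM oN φ σ p (flat (DM (e 2) p X)) (s p) := by
  have hi := inducedConnection_isCovariantDerivativeOn (φ := φ) hnab.isCovariantDerivative
  have hP := h.isPauliTriple hσ
  have hI : Complex.I * Complex.I = -1 := Complex.I_mul_I
  rw [h.correctedConnection_eq hσ hM, h.correctedConnection_eq hσ hM,
    connection_congr hi (hs.liftEnd_spin (oN := oN) hσ).diffSectionAt
      (h.eventually.mono fun q hq => by rw [hq.liftClifford_two]) X,
    inducedConnection_spin hσ hnab hN hs, h.covariantDerivative_two hM]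
  simp only [flat_add, flat_smul, map_add, map_smul, h.liftClifford_zero, h.liftClifford_one,
    h.liftClifford_two, LinearMap.add_apply, LinearMap.smul_apply]
  generalize inducedConnection φ nab s p X = z
  generalize liftEnd φ p (σ (φ p) (flat (f 0 (φ p)))) = A at hP ⊢
  generalize liftEnd φ p (σ (φ p) (flat (f 1 (φ p)))) = B at hP ⊢
  generalize liftEnd φ p (spinOperator oN σ (φ p)) = C at hP ⊢
  simp only [← Complex.coe_smul, map_smul, hP.two_zero, hP.two_one, hP.zero_two, hP.one_two,
    hP.two_two, spinCoeff, Matrix.cons_val]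
  push_cast
  linear_combination (norm := module)
    -((inner ℝ (e 2 p) X * bend DM e 1 p + inner ℝ (e 0 p) X * (twist DM e p / 2) : ℂ) * hI)
      • B (s p)
    - ((inner ℝ (e 2 p) X * bend DM e 0 p - inner ℝ (e 1 p) X * (twist DM e p / 2) : ℂ) * hI)
      • A (s p)

/-- The corrected connection is compatible with the Clifford action of an adapted frame. -/
theorem IsAdaptedFrame.correctedConnection_clifford (h : IsAdaptedFrame oM oN φ f e p)
    (hnab : IsSpincConnection DN σ nab) (hσ : IsSpinorBundle σ)
    (hM : IsLeviCivita DM) (hN : IsLeviCivita DN) (ε : ℝ) (i : Fin 3)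
    {s : Π q : M, LiftedBundle φ Ψ q} (hs : SmoothSectionAt 3 s p) (X : TangentSpace (𝓡 3) p) :
    correctedConnection oM oN DM φ σ nab ε
        (fun q => liftClifford oM oN φ σ q (flat (e i q)) (s q)) p X
      = liftClifford oM oN φ σ p (flat (e i p)) (correctedConnection oM oN DM φ σ nab ε s p X)
        + liftClifford oM oN φ σ p (flat (DM (e i) p X)) (s p) := by
  fin_cases i
  exacts [h.correctedConnection_clifford_zero hnab hσ hM hN ε hs X,
    h.correctedConnection_clifford_one hnab hσ hM hN ε hs X,
    h.correctedConnection_clifford_two hnab hσ hM hN ε hs X]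

/-- The sign ε is arbitrary here: it enters only through an imaginary scalar one-form, which affects
neither the metric nor the Clifford condition. -/
theorem IsSpincConnection.lift (hnab : IsSpincConnection DN σ nab) (hσ : IsSpinorBundle σ)
    (hφ : IsRiemannianSubmersion φ) (hM : IsLeviCivita DM) (hN : IsLeviCivita DN) (ε : ℝ) :
    IsSpincConnection DM (liftClifford oM oN φ σ)
      (correctedConnection oM oN DM φ σ nab ε) := by
  have hi := inducedConnection_isCovariantDerivativeOn (φ := φ) hnab.isCovariantDerivative
  have hcov : IsCovariantDerivativeOn SpinorFiber (correctedConnection oM oN DM φ σ nab ε)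
      Set.univ :=
    { add := by
        intro s t p hs ht _
        obtain ⟨f, e, h⟩ := hφ.exists_adaptedFrame oM oN p
        ext X
        change _ = correctedConnection oM oN DM φ σ nab ε s p X
          + correctedConnection oM oN DM φ σ nab ε t p X
        rw [h.correctedConnection_eq hσ hM, h.correctedConnection_eq hσ hM,
          h.correctedConnection_eq hσ hM]
        have h1 : inducedConnection φ nab (s + t) p X = inducedConnection φ nab s p X
          + inducedConnection φ nab t p X := connection_add hi hs ht X
        rw [h1]
        simp only [Pi.add_apply, map_add]
        module
      leibniz := by
        intro s g p hs hg _
        obtain ⟨f, e, h⟩ := hφ.exists_adaptedFrame oM oN p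
        ext X
        change _ = g p • correctedConnection oM oN DM φ σ nab ε s p X
          + mvfderiv (𝓡 3) g p X • s p
        rw [h.correctedConnection_eq hσ hM, h.correctedConnection_eq hσ hM]
        have h1 : inducedConnection φ nab (g • s) p X = g p • inducedConnection φ nab s p X
          + mvfderiv (𝓡 3) g p X • s p := connection_smul hi hg hs X
        rw [h1]
        simp only [Pi.smul_apply', ← Complex.coe_smul, map_smul]
        module }
  refine ⟨hcov, ?_, ?_, ?_, ?_⟩
  · intro s p X hs
    obtain ⟨f, e, h⟩ := hφ.exists_adaptedFrame oM oN p
    rw [h.correctedConnection_eq hσ hM, h.correctedConnection_eq hσ hM,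
      inducedConnection_I_smul hnab hs]
    simp only [← Complex.coe_smul, map_smul]
    module
  · intro s X p hs hX
    obtain ⟨f, e, h⟩ := hφ.exists_adaptedFrame oM oN p
    have hc := h.contMDiffAt_spinCoeff hM ε hX
    have h0 := hs.inducedConnection hnab.isCovariantDerivative hnab.smooth hX
    refine (h0.add ((((SmoothSectionAt.smul (hc 0) (h.smooth_base_action hσ 0 hs)).add
      (SmoothSectionAt.smul (hc 1) (h.smooth_base_action hσ 1 hs))).add
      (SmoothSectionAt.smul (hc 2) (hs.liftEnd_spin (oN := oN) hσ))).add
      (SmoothSectionAt.smul (hc 3) hs) |>.const_smul Complex.I)).congr ?_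
    filter_upwards [h.eventually] with q hq
    exact hq.correctedConnection_eq hσ hM ε s (X q)
  · intro s t p X hs ht
    obtain ⟨f, e, h⟩ := hφ.exists_adaptedFrame oM oN p
    have hP := h.isPauliTriple hσ
    rw [inducedConnection_metric hnab.isCovariantDerivative hσ.smooth_inner hnab.metric hs ht,
      h.correctedConnection_eq hσ hM, h.correctedConnection_eq hσ hM]
    -- The zeroth-order term is i times a real combination of self-adjoint operators, hence skew,
    -- and it drops out.
    simp only [inner_add_left, inner_add_right, inner_smul_left, inner_smul_right,
      inner_real_smul_left, inner_real_smul_right, hP.symm_zero (s p) (t p),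
      hP.symm_one (s p) (t p), hP.symm_two (s p) (t p), Complex.conj_I]
    ring
  · intro α s p X hα hs
    obtain ⟨f, e, h⟩ := hφ.exists_adaptedFrame oM oN p
    have ha := fun i => hα.apply (h.smooth_total i)
    have ha' := fun i => (ha i).mdifferentiableAt (by simp : (∞ : WithTop ℕ∞) ≠ 0)
    have hA := fun i => h.smooth_liftClifford hσ hφ i hs
    have hsum : ∀ᶠ q in nhds p, liftClifford oM oN φ σ q (α q) (s q)
        = ∑ i, α q (e i q) • liftClifford oM oN φ σ q (flat (e i q)) (s q) := by
      filter_upwards [h.eventually] with q hq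
      conv_lhs => rw [hq.flat_eq_sum (α q)]
      rw [Fin.sum_univ_three, map_add, map_add, map_smul, map_smul, map_smul]
      rfl
    have hαs : ∀ᶠ q in nhds p, sharp (α q) = ∑ i, α q (e i q) • e i q := by
      filter_upwards [h.eventually] with q hq
      conv_lhs => rw [hq.eq_sum_total (sharp (α q))]
      simp only [real_inner_comm (sharp (α q)), inner_sharp, Fin.sum_univ_three]
    have hd := fun i => (SmoothSectionAt.smul (ha i) (hA i)).diffSectionAt
    have hde := fun i => (SmoothFieldAt.smul (ha i) (h.smooth_total i)).mdifferentiableAt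
    -- Derivatives of α are taken through α♯ = ∑ α(e_i)e_i, so the Leibniz rules for D and for the
    -- spinor connection produce matching terms.
    have hcd : covDerivForm DM α p X = flat (DM (fun q => sharp (α q)) p X) := by
      rw [← hM.covDerivForm_flat hα.sharp.mdifferentiableAt]
      simp only [flat_sharp]
    have hDM : DM (fun q => sharp (α q)) p X = ∑ i, (α p (e i p) • DM (e i) p X
        + mvfderiv (𝓡 3) (fun q => α q (e i q)) p X • e i p) := by
      have hsm : SmoothFieldAt (fun q => ∑ i, α q (e i q) • e i q) p :=
        SmoothFieldAt.sum _ fun i _ => SmoothFieldAt.smul (ha i) (h.smooth_total i)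
      rw [covariantDerivative_congr DM hsm.mdifferentiableAt hαs]
      simp only [Fin.sum_univ_three]
      rw [covariantDerivative_add DM (SmoothFieldAt.add
          (SmoothFieldAt.smul (ha 0) (h.smooth_total 0))
          (SmoothFieldAt.smul (ha 1) (h.smooth_total 1))).mdifferentiableAt (hde 2),
        covariantDerivative_add DM (hde 0) (hde 1),
        covariantDerivative_smul DM (ha' 0) (h.smooth_total 0).mdifferentiableAt,
        covariantDerivative_smul DM (ha' 1) (h.smooth_total 1).mdifferentiableAt,
        covariantDerivative_smul DM (ha' 2) (h.smooth_total 2).mdifferentiableAt]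
    rw [connection_congr hcov (MDifferentiableAt.sum_section fun i _ => hd i) hsum,
      connection_sum hcov _ hd, hcd, hDM]
    conv_lhs => rw [h.flat_eq_sum (α p)]
    simp only [connection_smul hcov (ha' _) (hA _).diffSectionAt,
      h.correctedConnection_clifford hnab hσ hM hN ε _ hs, Fin.sum_univ_three, flat_add,
      flat_smul, map_add, map_smul, LinearMap.add_apply, LinearMap.smul_apply]
    module

end LiftedConnection

/-! ### Lifting the Dirac operator -/

section Dirac

/-- The operator is the trace of a bilinear expression, so the arbitrary basis in its definition may
be replaced by an adapted one. -/
theorem diracOperator_eq_sum {n : ℕ} {M : Type*} [TopologicalSpace M] [ChartedSpace (Euc n) M]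
    [RiemannianBundle (fun x : M => TangentSpace (𝓡 n) x)]
    {V : M → Type*} [∀ x, NormedAddCommGroup (V x)] [∀ x, InnerProductSpace ℂ (V x)]
    (σ : Π x : M, CotangentSpace n x →ₗ[ℝ] Module.End ℂ (V x))
    (nab : (Π x : M, V x) → Π x : M, TangentSpace (𝓡 n) x →L[ℝ] V x)
    (ξ : Π x : M, V x) {x : M} (b : OrthonormalBasis (Fin n) ℝ (TangentSpace (𝓡 n) x)) :
    diracOperator σ nab ξ x = (-Complex.I) • ∑ j, σ x (flat (b j)) (nab ξ x (b j)) := by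
  rw [diracOperator]
  congr 1
  refine OrthonormalBasis.sum_apply_self_eq (onb x) b
    (fun u v => σ x (flat u) (nab ξ x v)) ?_ ?_ ?_ ?_
  · intro u v w
    simp only [flat_add, map_add, LinearMap.add_apply]
  · intro r u w
    simp only [flat_smul, map_smul, LinearMap.smul_apply]
  · intro u v w
    simp only [map_add]
  · intro r u w
    simp only [map_smul, ← Complex.coe_smul]

variable {M : Type*} [TopologicalSpace M] [ChartedSpace (Euc 3) M]
  {N : Type*} [TopologicalSpace N] [ChartedSpace (Euc 2) N]
  [RiemannianBundle (fun x : M => TangentSpace (𝓡 3) x)]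
  [RiemannianBundle (fun y : N => TangentSpace (𝓡 2) y)]
  {φ : C^∞⟮𝓡 3, M; 𝓡 2, N⟯}
  [IsManifold (𝓡 3) ∞ M] [IsManifold (𝓡 2) ∞ N]
  [IsContMDiffRiemannianBundle (𝓡 3) ∞ (Euc 3) (fun x : M => TangentSpace (𝓡 3) x)]
  [IsContMDiffRiemannianBundle (𝓡 2) ∞ (Euc 2) (fun y : N => TangentSpace (𝓡 2) y)]
  {oM : ManifoldOrientation 3 M} {oN : ManifoldOrientation 2 N}
  {DM : CovariantDerivative (𝓡 3) (Euc 3) (TangentSpace (𝓡 3) : M → Type _)}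
  {DN : CovariantDerivative (𝓡 2) (Euc 2) (TangentSpace (𝓡 2) : N → Type _)}
  {Ψ : N → Type*} [∀ y, NormedAddCommGroup (Ψ y)] [∀ y, InnerProductSpace ℂ (Ψ y)]
  [TopologicalSpace (TotalSpace SpinorFiber Ψ)] [FiberBundle SpinorFiber Ψ]
  [VectorBundle ℂ SpinorFiber Ψ] [VectorBundle ℝ SpinorFiber Ψ]
  [ContMDiffVectorBundle ∞ SpinorFiber Ψ (𝓡 2)]
  {σ : Π y : N, CotangentSpace 2 y →ₗ[ℝ] Module.End ℂ (Ψ y)}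
  {nab : (Π y : N, Ψ y) → Π y : N, TangentSpace (𝓡 2) y →L[ℝ] Ψ y}

theorem liftClifford_nuForm (hφ : IsRiemannianSubmersion φ) (p : M) :
    liftClifford oM oN φ σ p (nuForm oM oN φ p) = liftEnd φ p (spinOperator oN σ (φ p)) := by
  obtain ⟨f, e, h⟩ := hφ.exists_adaptedFrame oM oN p
  rw [h.nuForm_eq, h.liftClifford_two]

theorem IsAdaptedFrame.spinCoeff_zero {f : Fin 2 → Π y : N, TangentSpace (𝓡 2) y}
    {e : Fin 3 → Π p : M, TangentSpace (𝓡 3) p} {p : M} (h : IsAdaptedFrame oM oN φ f e p) (ε : ℝ) :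
    spinCoeff DM e ε p (e 0 p) = ![twist DM e p / 4, 0, 0, ε * bend DM e 1 p / 2] := by
  simp only [spinCoeff, h.inner_total, Fin.reduceEq, reduceIte]
  ring_nf

theorem IsAdaptedFrame.spinCoeff_one {f : Fin 2 → Π y : N, TangentSpace (𝓡 2) y}
    {e : Fin 3 → Π p : M, TangentSpace (𝓡 3) p} {p : M} (h : IsAdaptedFrame oM oN φ f e p) (ε : ℝ) :
    spinCoeff DM e ε p (e 1 p) = ![0, twist DM e p / 4, 0, -(ε * bend DM e 0 p / 2)] := by
  simp only [spinCoeff, h.inner_total, Fin.reduceEq, reduceIte]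
  ring_nf

theorem IsAdaptedFrame.spinCoeff_two {f : Fin 2 → Π y : N, TangentSpace (𝓡 2) y}
    {e : Fin 3 → Π p : M, TangentSpace (𝓡 3) p} {p : M} (h : IsAdaptedFrame oM oN φ f e p) (ε : ℝ) :
    spinCoeff DM e ε p (e 2 p) = ![bend DM e 1 p / 2, -(bend DM e 0 p / 2), -(twist DM e p / 4),
      -(ε * twist DM e p / 4)] := by
  simp only [spinCoeff, h.inner_total, Fin.reduceEq, reduceIte]
  ring_nf

/-- The algebraic identity behind the lifting of the Dirac operator. -/
theorem IsPauliTriple.sum_eq {W : Type*} [NormedAddCommGroup W] [InnerProductSpace ℂ W]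
    {A B C : Module.End ℂ W} (hP : IsPauliTriple A B C) {ε : ℝ} {s : W} (hs : C s = (ε : ℂ) • s)
    {x y u v w : W} {c h₀ h₁ : ℝ} {a : Fin 3 → Fin 4 → ℝ}
    (ha₀ : a 0 = ![c / 4, 0, 0, ε * h₁ / 2]) (ha₁ : a 1 = ![0, c / 4, 0, -(ε * h₀ / 2)])
    (ha₂ : a 2 = ![h₁ / 2, -(h₀ / 2), -(c / 4), -(ε * c / 4)])
    (hu : u = x + Complex.I • (a 0 0 • A s + a 0 1 • B s + a 0 2 • C s + a 0 3 • s))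
    (hv : v = y + Complex.I • (a 1 0 • A s + a 1 1 • B s + a 1 2 • C s + a 1 3 • s))
    (hw : w = 0 + Complex.I • (a 2 0 • A s + a 2 1 • B s + a 2 2 • C s + a 2 3 • s)) :
    A u + B v + C w = A x + B y := by
  -- Applying A, B, C to Cs = εs gives relations that cancel the h₁, h₀ and c terms in turn. The c
  -- terms are c/4 + c/4 - c/4 - εcC/4, and εCs = C²s = s.
  have hA := congrArg A hs
  have hB := congrArg B hs
  have hC := congrArg C hs
  rw [map_smul, hP.zero_two] at hA
  rw [map_smul, hP.one_two] at hB
  rw [map_smul, hP.two_two] at hC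
  rw [hu, hv, hw, ha₀, ha₁, ha₂]
  simp only [← Complex.coe_smul, map_add, map_smul, map_zero, hP.zero_zero, hP.one_one, hP.two_two,
    hP.two_zero, hP.two_one, Matrix.cons_val]
  push_cast
  linear_combination (norm := module) (-(Complex.I * h₁ / 2)) • hA + (Complex.I * h₀ / 2) • hB
    + (Complex.I * c / 4) • hC

theorem IsAdaptedFrame.diracOperator_lift {f : Fin 2 → Π y : N, TangentSpace (𝓡 2) y}
    {e : Fin 3 → Π p : M, TangentSpace (𝓡 3) p} {p : M} (h : IsAdaptedFrame oM oN φ f e p)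
    (nabM : (Π p : M, LiftedBundle φ Ψ p) → Π p : M, TangentSpace (𝓡 3) p →L[ℝ] LiftedBundle φ Ψ p)
    (s : Π p : M, LiftedBundle φ Ψ p) :
    diracOperator (liftClifford oM oN φ σ) nabM s p = (-Complex.I) •
      (liftEnd φ p (σ (φ p) (flat (f 0 (φ p)))) (nabM s p (e 0 p))
        + liftEnd φ p (σ (φ p) (flat (f 1 (φ p)))) (nabM s p (e 1 p))
        + liftEnd φ p (spinOperator oN σ (φ p)) (nabM s p (e 2 p))) := by
  obtain ⟨b, hb⟩ := exists_orthonormalBasis_of_inner h.inner_total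
  rw [diracOperator_eq_sum _ _ _ b, Fin.sum_univ_three, hb, hb, hb, h.liftClifford_zero,
    h.liftClifford_one, h.liftClifford_two]

theorem IsAdaptedFrame.diracOperator_base {f : Fin 2 → Π y : N, TangentSpace (𝓡 2) y}
    {e : Fin 3 → Π p : M, TangentSpace (𝓡 3) p} {p : M} (h : IsAdaptedFrame oM oN φ f e p)
    (ξ : Π y : N, Ψ y) :
    diracOperator σ nab ξ (φ p) = (-Complex.I) •
      (σ (φ p) (flat (f 0 (φ p))) (nab ξ (φ p) (f 0 (φ p)))
        + σ (φ p) (flat (f 1 (φ p))) (nab ξ (φ p) (f 1 (φ p)))) := by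
  obtain ⟨b, hb⟩ := exists_orthonormalBasis_of_inner h.inner_base
  rw [diracOperator_eq_sum _ _ _ b, Fin.sum_univ_two, hb, hb]

theorem IsAdaptedFrame.diracOperator_correctedConnection
    {f : Fin 2 → Π y : N, TangentSpace (𝓡 2) y}
    {e : Fin 3 → Π p : M, TangentSpace (𝓡 3) p} {p : M} (h : IsAdaptedFrame oM oN φ f e p)
    (hσ : IsSpinorBundle σ) (hM : IsLeviCivita DM) {ε : ℝ} {s : Π p : M, LiftedBundle φ Ψ p}
    (hs : liftEnd φ p (spinOperator oN σ (φ p)) (s p) = (ε : ℂ) • s p)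
    (h2 : inducedConnection φ nab s p (e 2 p) = 0) :
    diracOperator (liftClifford oM oN φ σ) (correctedConnection oM oN DM φ σ nab ε) s p
      = (-Complex.I) •
        (liftEnd φ p (σ (φ p) (flat (f 0 (φ p)))) (inducedConnection φ nab s p (e 0 p))
          + liftEnd φ p (σ (φ p) (flat (f 1 (φ p)))) (inducedConnection φ nab s p (e 1 p))) := by
  have k := fun X => h.correctedConnection_eq hσ hM (nab := nab) ε s X
  have k2 := k (e 2 p)
  rw [h2] at k2
  exact (h.diracOperator_lift _ _).trans (congrArg _ ((h.isPauliTriple hσ).sum_eq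
    (a := fun i => spinCoeff DM e ε p (e i p)) hs (h.spinCoeff_zero ε) (h.spinCoeff_one ε)
    (h.spinCoeff_two ε) (k (e 0 p)) (k (e 1 p)) k2))

/-- The Dirac operator of the corrected connection extends the Dirac operator of the base on lifts
of spinors of definite spin. -/
theorem diracOperator_liftSection (hnab : IsSpincConnection DN σ nab) (hσ : IsSpinorBundle σ)
    (hφ : IsRiemannianSubmersion φ) (hM : IsLeviCivita DM) {ε : ℝ} {ξ : Π y : N, Ψ y}
    (hξ : IsSmoothSection 2 ξ)
    (hspin : ∀ p : M, liftClifford oM oN φ σ p (nuForm oM oN φ p) (liftSection φ ξ p)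
      = (ε : ℂ) • liftSection φ ξ p) :
    diracOperator (liftClifford oM oN φ σ) (correctedConnection oM oN DM φ σ nab ε)
      (liftSection φ ξ) = liftSection φ (diracOperator σ nab ξ) := by
  funext p
  obtain ⟨f, e, h⟩ := hφ.exists_adaptedFrame oM oN p
  have hs := hspin p
  rw [liftClifford_nuForm hφ] at hs
  have hd := (hξ (φ p)).diffSectionAt
  have hi := fun X => inducedConnection_liftSection (φ := φ) hnab.isCovariantDerivative hd X
  have h2 : inducedConnection φ nab (liftSection φ ξ) p (e 2 p) = 0 := by
    refine (hi (e 2 p)).trans ?_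
    rw [h.vertical.self_of_nhds, map_zero]
    rfl
  refine (h.diracOperator_correctedConnection hσ hM hs h2).trans ?_
  have h0 := (hi (e 0 p)).trans (congrArg (nab ξ (φ p)) h.lift_zero.self_of_nhds)
  have h1 := (hi (e 1 p)).trans (congrArg (nab ξ (φ p)) h.lift_one.self_of_nhds)
  rw [h0, h1]
  exact (h.diracOperator_base ξ).symm

end Dirac

/-! ### Positivity of the Riemannian measure on open sets -/

section RiemannianMeasure

variable {n : ℕ} {M : Type*} [TopologicalSpace M] [ChartedSpace (Euc n) M]
  [IsManifold (𝓡 n) ∞ M]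
  [RiemannianBundle (fun x : M => TangentSpace (𝓡 n) x)]
  [IsContMDiffRiemannianBundle (𝓡 n) ∞ (Euc n) (fun x : M => TangentSpace (𝓡 n) x)]

theorem contMDiffAt_mfderiv_symm {c : OpenPartialHomeomorph M (Euc n)} (hc : c ∈ atlas (Euc n) M)
    {u : Euc n} (hu : u ∈ c.target) (w : Euc n) :
    ContMDiffAt (𝓡 n) ((𝓡 n).prod (𝓡 n)) ∞
      (fun v => TotalSpace.mk' (Euc n) (E := (TangentSpace (𝓡 n) : M → Type _)) (c.symm v)
        (mfderiv (𝓡 n) (𝓡 n) c.symm v w)) u := by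
  have h : ContMDiffAt (𝓡 n) (𝓡 n) ∞ c.symm u :=
    contMDiffAt_symm_of_mem_maximalAtlas (IsManifold.subset_maximalAtlas hc) hu
  have hw : ContMDiffAt (𝓡 n) ((𝓡 n).prod (𝓡 n)) ∞
      (fun v => TotalSpace.mk' (Euc n) (E := (TangentSpace (𝓡 n) : Euc n → Type _)) v w) u :=
    contMDiffAt_vectorSpace_iff_contDiffAt.2 contDiffAt_const
  exact ContMDiffAt.clm_apply_of_inCoordinates (n := ∞) (IB₁ := 𝓡 n) (IB₂ := 𝓡 n)
    (E₁ := (TangentSpace (𝓡 n) : Euc n → Type _)) (E₂ := (TangentSpace (𝓡 n) : M → Type _))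
    (F₁ := Euc n) (F₂ := Euc n) (b₁ := id) (b₂ := c.symm)
    (ϕ := fun v => mfderiv (𝓡 n) (𝓡 n) c.symm v)
    (h.mfderiv_const (m := ∞) (by simp)) hw h

theorem continuousOn_det_gramMatrix {c : OpenPartialHomeomorph M (Euc n)}
    (hc : c ∈ atlas (Euc n) M) : ContinuousOn (fun u => (gramMatrix c u).det) c.target := by
  intro u hu
  have h (i j : Fin n) : ContinuousAt (fun v => gramMatrix c v i j) u :=
    (ContMDiffAt.inner_bundle (IM := 𝓡 n) (b := c.symm) (contMDiffAt_mfderiv_symm hc hu _)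
      (contMDiffAt_mfderiv_symm hc hu _)).continuousAt
  have h' : ContinuousAt (fun v => gramMatrix c v) u :=
    continuousAt_pi.2 fun i => continuousAt_pi.2 (h i)
  exact ((continuous_id.matrix_det).continuousAt.comp h').continuousWithinAt

/-- A chart inverse has injective derivative, so the matrix is the Gram matrix of linearly
independent vectors. -/
theorem det_gramMatrix_pos {c : OpenPartialHomeomorph M (Euc n)} (hc : c ∈ atlas (Euc n) M)
    {u : Euc n} (hu : u ∈ c.target) : 0 < (gramMatrix c u).det := by
  have hd := (mdifferentiable_of_mem_atlas (I := 𝓡 n) hc).comp_symm_deriv hu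
  have hinj : Function.Injective (mfderiv (𝓡 n) (𝓡 n) c.symm u) := by
    refine Function.LeftInverse.injective (g := mfderiv (𝓡 n) (𝓡 n) c (c.symm u)) fun w => ?_
    exact congrArg (fun L => L w) hd
  have hli : LinearIndependent ℝ fun i : Fin n => (EuclideanSpace.single i (1 : ℝ) : Euc n) := by
    have h := (EuclideanSpace.basisFun (Fin n) ℝ).toBasis.linearIndependent
    rw [OrthonormalBasis.coe_toBasis] at h
    exact (funext fun i => EuclideanSpace.basisFun_apply (Fin n) ℝ i :
      ⇑(EuclideanSpace.basisFun (Fin n) ℝ) = _) ▸ h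
  have h := hli.map' (mfderiv (𝓡 n) (𝓡 n) c.symm u).toLinearMap (LinearMap.ker_eq_bot.2 hinj)
  exact (Matrix.posDef_gram_of_linearIndependent h).det_pos

/-- The measure dominates the image of Lebesgue measure with positive density from each chart, and
the chart image of a nonempty open set is open. Agreement of different charts on overlaps plays no
role. -/
instance isOpenPosMeasure_riemannianMeasure [MeasurableSpace M] [BorelSpace M] :
    (riemannianMeasure n M).IsOpenPosMeasure := by
  refine ⟨fun U hU ⟨x, hx⟩ h0 => ?_⟩
  have hc := chart_mem_atlas (Euc n) x
  set c := chartAt (Euc n) x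
  set ρ : Euc n → ENNReal := fun u => ENNReal.ofReal (Real.sqrt (gramMatrix c u).det)
  set μ := MeasureTheory.volume.restrict c.target
  have hle : MeasureTheory.Measure.map c.symm (μ.withDensity ρ) ≤ riemannianMeasure n M :=
    le_iSup (fun c : atlas (Euc n) M => MeasureTheory.Measure.map c.1.symm
      ((MeasureTheory.volume.restrict c.1.target).withDensity
        fun u => ENNReal.ofReal (Real.sqrt (gramMatrix c.1 u).det))) ⟨c, hc⟩
  -- Required because the image measure is zero by default for a map that is not almost everywhere
  -- measurable; off the target of the chart its inverse is uncontrolled.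
  have hm : AEMeasurable c.symm (μ.withDensity ρ) :=
    (c.continuousOn_symm.aemeasurable c.open_target.measurableSet).mono_ac
      (MeasureTheory.withDensity_absolutelyContinuous _ _)
  have hρ : AEMeasurable ρ μ :=
    ((ENNReal.continuous_ofReal.comp Real.continuous_sqrt).comp_continuousOn
      (continuousOn_det_gramMatrix hc)).aemeasurable c.open_target.measurableSet
  have h1 := le_antisymm ((hle U).trans h0.le) zero_le
  rw [MeasureTheory.Measure.map_apply_of_aemeasurable hm hU.measurableSet,
    MeasureTheory.withDensity_apply_eq_zero' hρ] at h1
  have hW : IsOpen (c.target ∩ c.symm ⁻¹' U) := c.isOpen_inter_preimage_symm hU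
  have h2 : MeasureTheory.volume (c.target ∩ c.symm ⁻¹' U) = 0 := by
    have h3 := MeasureTheory.Measure.le_restrict_apply c.target ({u | ρ u ≠ 0} ∩ c.symm ⁻¹' U)
      (μ := MeasureTheory.volume)
    refine MeasureTheory.measure_mono_null ?_ (le_antisymm (h3.trans h1.le) zero_le)
    rintro u ⟨hu, hu'⟩
    refine ⟨⟨?_, hu'⟩, hu⟩
    exact (ENNReal.ofReal_pos.2 (Real.sqrt_pos.2 (det_gramMatrix_pos hc hu))).ne'
  refine hW.measure_ne_zero MeasureTheory.volume ⟨c x, ?_, ?_⟩ h2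
  · exact mem_chart_target (Euc n) x
  · rwa [Set.mem_preimage, c.left_inv (mem_chart_source (Euc n) x)]

end RiemannianMeasure

/-! ### From mean spin to pointwise spin -/

section DefiniteSpin

/-- The equality case of Cauchy–Schwarz: T is an isometry, and expanding |Tw - Sw|² gives |w|² -
2S·S|w|² + |w|² = 0. -/
theorem apply_eq_smul_of_inner_eq {W : Type*} [NormedAddCommGroup W] [InnerProductSpace ℂ W]
    {T : Module.End ℂ W} (hT : T.IsSymmetric) (hT2 : ∀ w, T (T w) = w) {S : ℝ}
    (hS : S = 1 ∨ S = -1) {w : W} (h : (inner ℂ w (T w)).re = S * ‖w‖ ^ 2) :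
    T w = (S : ℂ) • w := by
  have hn : (inner ℂ (T w) (T w)) = inner ℂ w w := by rw [hT, hT2]
  have hsym : (inner ℂ (T w) w).re = S * ‖w‖ ^ 2 := by rw [hT, h]
  have hw : (inner ℂ w w).re = ‖w‖ ^ 2 := inner_self_eq_norm_sq (𝕜 := ℂ) w
  have hS2 : S * S = 1 := by rcases hS with rfl | rfl <;> norm_num
  rw [← sub_eq_zero, ← norm_eq_zero, ← sq_eq_zero_iff, ← inner_self_eq_norm_sq (𝕜 := ℂ)]
  simp only [inner_sub_left, inner_sub_right, inner_smul_left, inner_smul_right, hn,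
    Complex.conj_ofReal, map_sub, RCLike.re_eq_complex_re, Complex.sub_re, Complex.re_ofReal_mul,
    h, hsym, hw]
  linear_combination (-(‖w‖ ^ 2)) * hS2

theorem re_inner_apply_le {W : Type*} [NormedAddCommGroup W] [InnerProductSpace ℂ W]
    {T : Module.End ℂ W} (hT : T.IsSymmetric) (hT2 : ∀ w, T (T w) = w) {S : ℝ}
    (hS : S = 1 ∨ S = -1) (w : W) : S * (inner ℂ w (T w)).re ≤ ‖w‖ ^ 2 := by
  have hn : ‖T w‖ = ‖w‖ := by
    rw [@norm_eq_sqrt_re_inner ℂ, @norm_eq_sqrt_re_inner ℂ _ _ _ _ w, hT, hT2]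
  have h := (Complex.abs_re_le_norm _).trans (norm_inner_le_norm (𝕜 := ℂ) w (T w))
  rw [hn, ← sq, abs_le] at h
  rcases hS with rfl | rfl <;> linarith

variable {N : Type*} [TopologicalSpace N] [ChartedSpace (Euc 2) N]
  [RiemannianBundle (fun y : N => TangentSpace (𝓡 2) y)] [IsManifold (𝓡 2) ∞ N]
  [IsContMDiffRiemannianBundle (𝓡 2) ∞ (Euc 2) (fun y : N => TangentSpace (𝓡 2) y)]
  {oN : ManifoldOrientation 2 N}
  {Ψ : N → Type*} [∀ y, NormedAddCommGroup (Ψ y)] [∀ y, InnerProductSpace ℂ (Ψ y)]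
  [TopologicalSpace (TotalSpace SpinorFiber Ψ)] [FiberBundle SpinorFiber Ψ]
  [VectorBundle ℂ SpinorFiber Ψ] [VectorBundle ℝ SpinorFiber Ψ]
  [ContMDiffVectorBundle ∞ SpinorFiber Ψ (𝓡 2)]
  {σ : Π y : N, CotangentSpace 2 y →ₗ[ℝ] Module.End ℂ (Ψ y)}

/-- A normalized spinor whose mean spin is `±1` has spin `±1` at every point. -/
theorem re_inner_spinOperator_of_integral [MeasurableSpace N] [BorelSpace N]
    (hσ : IsSpinorBundle σ) {ξ : Π y : N, Ψ y} (hξ : IsSmoothSection 2 ξ) {S : ℝ}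
    (hS : S = 1 ∨ S = -1) (h1 : ∫ y, ‖ξ y‖ ^ 2 ∂(riemannianMeasure 2 N) = 1)
    (h2 : ∫ y, (inner ℂ (ξ y) (spinOperator oN σ y (ξ y)) : ℂ) ∂(riemannianMeasure 2 N) = (S : ℂ))
    (y : N) : (inner ℂ (ξ y) (spinOperator oN σ y (ξ y)) : ℂ).re = S * ‖ξ y‖ ^ 2 := by
  have hS2 : S * S = 1 := by rcases hS with rfl | rfl <;> norm_num
  have hS0 : (S : ℂ) ≠ 0 := by rcases hS with rfl | rfl <;> norm_num
  -- The integral of a non-integrable function is 0 by default, so the nonzero values 1 and S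
  -- already imply integrability.
  have hi1 := MeasureTheory.Integrable.of_integral_ne_zero (h1.trans_ne one_ne_zero)
  have hi2 := MeasureTheory.Integrable.of_integral_ne_zero (h2.trans_ne hS0)
  have hre := integral_re hi2
  rw [h2] at hre
  have hc1 : Continuous fun y => ‖ξ y‖ ^ 2 := by
    have : Continuous fun y => (inner ℂ (ξ y) (ξ y) : ℂ) := continuous_iff_continuousAt.2
      fun y => (hσ.smooth_inner ξ ξ y (hξ y) (hξ y)).continuousAt
    refine (Complex.continuous_re.comp this).congr fun y => ?_
    exact inner_self_eq_norm_sq (𝕜 := ℂ) (ξ y)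
  have hc2 : Continuous fun y => (inner ℂ (ξ y) (spinOperator oN σ y (ξ y)) : ℂ) :=
    continuous_iff_continuousAt.2 fun y =>
      (hσ.smooth_inner ξ _ y (hξ y) (hσ.smooth_spin (hξ y))).continuousAt
  set g : N → ℝ := fun y => ‖ξ y‖ ^ 2 - S * (inner ℂ (ξ y) (spinOperator oN σ y (ξ y)) : ℂ).re
  have hg : Continuous g := hc1.sub (continuous_const.mul (Complex.continuous_re.comp hc2))
  have hg0 : 0 ≤ g := fun y =>
    sub_nonneg.2 (re_inner_apply_le hσ.spin_isSymmetric hσ.spin_spin hS (ξ y))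
  have hint : ∫ y, g y ∂(riemannianMeasure 2 N) = 0 := by
    refine (MeasureTheory.integral_sub hi1 (hi2.re.const_mul S)).trans ?_
    rw [MeasureTheory.integral_const_mul, h1]
    have : S * (∫ y, (inner ℂ (ξ y) (spinOperator oN σ y (ξ y)) : ℂ).re
        ∂(riemannianMeasure 2 N)) = 1 := by
      rw [← hS2]
      exact congrArg (S * ·) (hre.trans (Complex.ofReal_re S))
    exact sub_eq_zero.2 this.symm
  have hae := (MeasureTheory.integral_eq_zero_iff_of_nonneg hg0
    (hi1.sub (hi2.re.const_mul S))).1 hint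
  -- Almost everywhere becomes everywhere: continuous functions equal off a null set agree, since
  -- null sets contain no nonempty open set.
  have h := congrFun ((hg.ae_eq_iff_eq _ continuous_zero).1 hae) y
  have h' : ‖ξ y‖ ^ 2 - S * (inner ℂ (ξ y) (spinOperator oN σ y (ξ y)) : ℂ).re = 0 := h
  linear_combination (-S) * h' - (inner ℂ (ξ y) (spinOperator oN σ y (ξ y)) : ℂ).re * hS2

end DefiniteSpin

/-! ### Assembly of the theorem -/

section Main

variable {M : Type*} [TopologicalSpace M] [ChartedSpace (Euc 3) M]
  {N : Type*} [TopologicalSpace N] [ChartedSpace (Euc 2) N]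
  [RiemannianBundle (fun x : M => TangentSpace (𝓡 3) x)]
  [RiemannianBundle (fun y : N => TangentSpace (𝓡 2) y)]
  {φ : C^∞⟮𝓡 3, M; 𝓡 2, N⟯}
  [IsManifold (𝓡 3) ∞ M] [IsManifold (𝓡 2) ∞ N]
  [IsContMDiffRiemannianBundle (𝓡 3) ∞ (Euc 3) (fun x : M => TangentSpace (𝓡 3) x)]
  [IsContMDiffRiemannianBundle (𝓡 2) ∞ (Euc 2) (fun y : N => TangentSpace (𝓡 2) y)]
  {oM : ManifoldOrientation 3 M} {oN : ManifoldOrientation 2 N}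
  {Ψ : N → Type*} [∀ y, NormedAddCommGroup (Ψ y)] [∀ y, InnerProductSpace ℂ (Ψ y)]
  [TopologicalSpace (TotalSpace SpinorFiber Ψ)] [FiberBundle SpinorFiber Ψ]
  [VectorBundle ℂ SpinorFiber Ψ] [VectorBundle ℝ SpinorFiber Ψ]
  [ContMDiffVectorBundle ∞ SpinorFiber Ψ (𝓡 2)]
  {σ : Π y : N, CotangentSpace 2 y →ₗ[ℝ] Module.End ℂ (Ψ y)}

/-- The lift of a spinor of spin `S` is an eigenvector of the action of `ν`. -/
theorem liftClifford_nuForm_liftSection (hφ : IsRiemannianSubmersion φ) (hσ : IsSpinorBundle σ)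
    {S : ℝ} (hS : S = 1 ∨ S = -1) {ξ : Π y : N, Ψ y}
    (h : ∀ y, (inner ℂ (ξ y) (spinOperator oN σ y (ξ y)) : ℂ).re = S * ‖ξ y‖ ^ 2) (p : M) :
    liftClifford oM oN φ σ p (nuForm oM oN φ p) (liftSection φ ξ p)
      = (S : ℂ) • liftSection φ ξ p := by
  rw [liftClifford_nuForm hφ]
  exact apply_eq_smul_of_inner_eq hσ.spin_isSymmetric hσ.spin_spin hS (h (φ p))

end Main
theorem mainTheorem5
    -- the oriented Riemannian 3-manifold `M`, with Levi-Civita connection `DM`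
    {M : Type*} [TopologicalSpace M] [T2Space M] [SecondCountableTopology M]
    [ChartedSpace (Euc 3) M] [IsManifold (𝓡 3) ∞ M]
    [RiemannianBundle (fun x : M => TangentSpace (𝓡 3) x)]
    [IsContMDiffRiemannianBundle (𝓡 3) ∞ (Euc 3) (fun x : M => TangentSpace (𝓡 3) x)]
    (oM : ManifoldOrientation 3 M)
    (DM : CovariantDerivative (𝓡 3) (Euc 3) (TangentSpace (𝓡 3) : M → Type _))
    (hDM : IsLeviCivita DM)
    -- the oriented Riemannian 2-manifold `N`, with Levi-Civita connection `DN`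
    {N : Type*} [TopologicalSpace N] [T2Space N] [SecondCountableTopology N]
    [MeasurableSpace N] [BorelSpace N]
    [ChartedSpace (Euc 2) N] [IsManifold (𝓡 2) ∞ N]
    [RiemannianBundle (fun y : N => TangentSpace (𝓡 2) y)]
    [IsContMDiffRiemannianBundle (𝓡 2) ∞ (Euc 2) (fun y : N => TangentSpace (𝓡 2) y)]
    (oN : ManifoldOrientation 2 N)
    (DN : CovariantDerivative (𝓡 2) (Euc 2) (TangentSpace (𝓡 2) : N → Type _))
    (hDN : IsLeviCivita DN)
    -- the Riemannian submersion
    (φ : C^∞⟮𝓡 3, M; 𝓡 2, N⟯) (hφ : IsRiemannianSubmersion φ)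
    -- the spinor bundle on `N`, a smooth complex vector bundle of rank two, and its connection
    {Ψ : N → Type*} [∀ y, NormedAddCommGroup (Ψ y)] [∀ y, InnerProductSpace ℂ (Ψ y)]
    [TopologicalSpace (TotalSpace SpinorFiber Ψ)] [FiberBundle SpinorFiber Ψ]
    [VectorBundle ℂ SpinorFiber Ψ] [VectorBundle ℝ SpinorFiber Ψ]
    [ContMDiffVectorBundle ∞ SpinorFiber Ψ (𝓡 2)]
    (σ : Π y : N, CotangentSpace 2 y →ₗ[ℝ] Module.End ℂ (Ψ y)) (hσ : IsSpinorBundle σ)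
    (nab : (Π y : N, Ψ y) → Π y : N, TangentSpace (𝓡 2) y →L[ℝ] Ψ y)
    (hnab : IsSpincConnection DN σ nab) :
    -- `∇^{M,±}` are `Spin^c` connections on the lifted spinor bundle
    IsSpinorBundle (liftClifford oM oN φ σ) ∧
    (∀ ε : ℝ, ε = 1 ∨ ε = -1 →
      IsSpincConnection DM (liftClifford oM oN φ σ) (correctedConnection oM oN DM φ σ nab ε)) ∧
    -- `D_M^± (ξ ∘ φ) = (D_N ξ) ∘ φ` if `σ_M(ν) (ξ ∘ φ) = ± ξ ∘ φ`
    (∀ ε : ℝ, ε = 1 ∨ ε = -1 → ∀ ξ : Π y : N, Ψ y, IsSmoothSection 2 ξ →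
      (∀ p : M, liftClifford oM oN φ σ p (nuForm oM oN φ p) (liftSection φ ξ p)
        = (ε : ℂ) • liftSection φ ξ p) →
      diracOperator (liftClifford oM oN φ σ) (correctedConnection oM oN DM φ σ nab ε)
          (liftSection φ ξ)
        = liftSection φ (diracOperator σ nab ξ)) ∧
    -- zero modes of `D_N` of definite spin `S = ±1` lift to zero modes of `D_M^S`
    (∀ S : ℝ, S = 1 ∨ S = -1 → ∀ ξ : Π y : N, Ψ y, IsSmoothSection 2 ξ → ξ ≠ 0 →
      diracOperator σ nab ξ = 0 →
      ((∫ y, ‖ξ y‖ ^ 2 ∂(riemannianMeasure 2 N) = 1 ∧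
          ∫ y, (inner ℂ (ξ y) (spinOperator oN σ y (ξ y)) : ℂ) ∂(riemannianMeasure 2 N) = (S : ℂ)) ∨
        ∀ y, (inner ℂ (ξ y) (spinOperator oN σ y (ξ y)) : ℂ) = ((S * ‖ξ y‖ ^ 2 : ℝ) : ℂ)) →
      IsSmoothSection 3 (liftSection φ ξ) ∧
        diracOperator (liftClifford oM oN φ σ) (correctedConnection oM oN DM φ σ nab S)
          (liftSection φ ξ) = 0 ∧
        (Function.Surjective φ → liftSection φ ξ ≠ 0)) := by
  refine ⟨hσ.lift hφ, fun ε _ => hnab.lift hσ hφ hDM hDN ε,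
    fun ε _ ξ hξ hspin => diracOperator_liftSection hnab hσ hφ hDM hξ hspin,
    fun S hS ξ hξ hne h0 hdef => ?_⟩
  -- Both notions of definite spin yield the same pointwise identity; only its real part is needed.
  have hre (y : N) : (inner ℂ (ξ y) (spinOperator oN σ y (ξ y)) : ℂ).re = S * ‖ξ y‖ ^ 2 := by
    rcases hdef with ⟨h1, h2⟩ | h
    · exact re_inner_spinOperator_of_integral hσ hξ hS h1 h2 y
    · rw [h y, Complex.ofReal_re]
  refine ⟨fun p => (hξ (φ p)).liftSection, ?_, fun hsurj hl => hne ?_⟩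
  · rw [diracOperator_liftSection hnab hσ hφ hDM hξ
      (liftClifford_nuForm_liftSection hφ hσ hS hre), h0]
    rfl
  -- If the lift vanishes, ξ vanishes on the image of φ; surjectivity makes this all of `N`.
  · funext y
    obtain ⟨p, rfl⟩ := hsurj y
    exact congrFun hl p
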